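/- **Setting.** Let $\Bbbk$ be an algebraically closed field of characteristic zero and $\mathfrak g$ a root-reductive Lie algebra over $\Bbbk$: $\mathfrak g=\bigcup_{n\in\mathbb N}\widetilde{\mathfrak g}_n$ for nested finite dimensional reductive subalgebras $\widetilde{\mathfrak g}_n\subset\widetilde{\mathfrak g}_{n+1}$, with $\widetilde{\mathfrak g}_n$ reductive in $\widetilde{\mathfrak g}_{n+1}$ (its adjoint action is semisimple), together with Cartan subalgebras $\mathfrak h_n\subset\widetilde{\mathfrak g}_n$ such that $\mathfrak h_n\subset\mathfrak h_{n+1}$ and every root vector of $\widetilde{\mathfrak g}_n$ is a root vector of $\widetilde{\mathfrak g}_{n+1}$. Put $\mathfrak h=\bigcup_n\mathfrak h_n$ and $\mathfrak g_n=\widetilde{\mathfrak g}_n+\mathfrak h$, let $\mathfrak g^\alpha$ be the root spaces, and let $\Phi\supset\Phi_n$ be the sets of roots of $\mathfrak g$ and $\mathfrak g_n$ in $\mathfrak h^*$. Let $\Phi=\Phi^+\amalg(-\Phi^+)$ with $\alpha+\beta\in\Phi^+$ whenever $\alpha,\beta\in\Phi^+$ and $\alpha+\beta\in\Phi$; put $\mathfrak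 n^+=\bigoplus_{\alpha\in\Phi^+}\mathfrak g^\alpha$, $\mathfrak b=\mathfrak h\oplus\mathfrak n^+$ and $\mathfrak b_n=\mathfrak b\cap\mathfrak g_n$. Assume that $\mathfrak b$ is a Dynkin Borel subalgebra and that the exhaustion is adapted to it, i.e. that each $\widetilde{\mathfrak g}_n+\mathfrak b$ is a subalgebra of $\mathfrak g$. Write $\mu\le\lambda$ (respectively $\mu\le_n\lambda$) if $\lambda-\mu$ is a possibly empty finite sum of elements of $\Phi^+$ (respectively $\Phi_n\cap\Phi^+$). For $\mathsf K\subset\mathfrak h^*$, let ${}^{\mathsf K}\mathbf O$ be the category of $\mathfrak g$-modules that are direct sums of their $\mathfrak h$-weight spaces, on which $\mathfrak b$ acts locally finitely, and whose weights all lie in $\mathsf K$. Define ${}^{\mathsf K}\mathbf O(\mathfrak g_n,\mathfrak b_n)$ in the same way. For $\mathsf L\subset\mathsf K$ let ${}^{\mathsf K}_{\mathsf L}\mathbf O$ be the Serre quotient ${}^{\mathsf K}\mathbf O/{}^{\mathsf L}\mathbf O$, with quotient functor $\pi$. Let $\mathrm{Ind}^n_+$ be parabolic induction: extend a $\mathfrak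 g_n$-module to $\mathfrak p=\mathfrak g_n+\mathfrak b$ with the nilradical $\bigoplus_{\alpha\in\Phi^+\setminus\Phi_n}\mathfrak g^\alpha$ acting by zero, and apply $U(\mathfrak g)\otimes_{U(\mathfrak p)}-$. Let $\mathrm{Res}^n_\lambda$ be restriction to $\mathfrak g_n$ followed by taking the maximal direct summand with weights in $\lambda+\mathbb Z\Phi_n$. Let $\Delta(\mu)=U(\mathfrak g)\otimes_{U(\mathfrak b)}\Bbbk_\mu$ and $\Delta_n(\mu)=U(\mathfrak g_n)\otimes_{U(\mathfrak b_n)}\Bbbk_\mu$ be the Verma modules. **Theorem.** Let $n\in\mathbb N$ and $\lambda\in\mathfrak h^*$. (a) Put $\Lambda_n=\lambda+\mathbb Z\Phi_n$, $\overline\Lambda_n=\{\mu\in\mathfrak h^*: \mu\le\nu\text{ for some }\nu\in\Lambda_n\}$ and $\mathring\Lambda_n=\overline\Lambda_n\setminus\Lambda_n$. Then $\mathrm{Ind}^n_+$ and $\mathrm{Res}^n_\lambda$ restrict to functors $${}^{\Lambda_n}\mathbf O(\mathfrak g_n,\mathfrak b_n)\xrightarrow{\ \mathrm{Ind}^n_+\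 }{}^{\overline\Lambda_n}\mathbf O\xrightarrow{\ \mathrm{Res}^n_\lambda\ }{}^{\Lambda_n}\mathbf O(\mathfrak g_n,\mathfrak b_n),$$ and there are mutually inverse equivalences of abelian categories $\Psi:{}^{\Lambda_n}\mathbf O(\mathfrak g_n,\mathfrak b_n)\to{}^{\overline\Lambda_n}_{\mathring\Lambda_n}\mathbf O$ and $\Phi$ in the opposite direction with $\Psi=\pi\circ\mathrm{Ind}^n_+$ and $\Phi\circ\pi=\mathrm{Res}^n_\lambda$. Moreover, for every $\mu\in\Lambda_n$ the modules $\Delta_n(\mu)$ and $\Delta(\mu)$ lie in ${}^{\Lambda_n}\mathbf O(\mathfrak g_n,\mathfrak b_n)$ and ${}^{\overline\Lambda_n}\mathbf O$, and $\Psi(\Delta_n(\mu))\cong\Delta(\mu)$ in ${}^{\overline\Lambda_n}_{\mathring\Lambda_n}\mathbf O$. (b) Let $E$ be a finite subset of $\lambda+\mathbb Z\Phi_n$, let $\mathsf K$ and $\mathsf K_n$ be the ideals of $(\mathfrak h^*,\le)$ and $(\mathfrak h^*,\le_n)$ generated by $E$, and put $\mathring{\mathsf K}_n=\mathsf K\setminus\mathsf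 K_n$. Then all assertions of (a) hold with $\Lambda_n,\overline\Lambda_n,\mathring\Lambda_n$ replaced by $\mathsf K_n,\mathsf K,\mathring{\mathsf K}_n$. -/

import Mathlib

open CategoryTheory CategoryTheory.Limits
open scoped TensorProduct ModuleCat

universe u

noncomputable section

namespace CatO

/-! ## Weight modules and category `O` over a Lie algebra with a chosen torus and Borel subalgebra

Modules over a Lie algebra `L` are modules over its universal enveloping algebra. The torus `H` is
given together with a linear embedding `j : H → L`, so that the same space `Dual k H` of weights
serves all Lie algebras which contain `H`. -/

section Modules

variable {k : Type u} [Field k] {L : Type u} [LieRing L] [LieAlgebra k L]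
  {H : Type u} [AddCommGroup H] [Module k H]

/-- The universal enveloping algebra `U(L)`. -/
abbrev Env (k L : Type u) [Field k] [LieRing L] [LieAlgebra k L] : Type u :=
  UniversalEnvelopingAlgebra k L

/-- The canonical map `L → U(L)`, as a function. -/
abbrev toEnv (k : Type u) {L : Type u} [Field k] [LieRing L] [LieAlgebra k L] (x : L) : Env k L :=
  UniversalEnvelopingAlgebra.ι k x

/-- The weight space `M_μ`. -/
def weightSpace (j : H →ₗ[k] L) (M : ModuleCat.{u} (Env k L)) (μ : Module.Dual k H) :
    Submodule k M where
  carrier := {m | ∀ h : H, toEnv k (j h) • m = μ h • m}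
  add_mem' := fun {a b} ha hb h => by rw [smul_add, smul_add, ha h, hb h]
  zero_mem' := fun h => by rw [smul_zero, smul_zero]
  smul_mem' := fun c m hm h => by rw [smul_algebra_smul_comm, hm h, smul_comm]

/-- `M` is the sum (automatically direct) of its weight spaces. -/
def IsWeightModule (j : H →ₗ[k] L) (M : ModuleCat.{u} (Env k L)) : Prop :=
  ⨆ μ, weightSpace j M μ = ⊤

/-- The support of `M`: the set of weights `μ` with `M_μ ≠ 0`. -/
def support (j : H →ₗ[k] L) (M : ModuleCat.{u} (Env k L)) : Set (Module.Dual k H) :=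
  {μ | weightSpace j M μ ≠ ⊥}

/-- The subalgebra `b` acts locally finitely on `M`: every vector lies in a finite dimensional
`b`-stable subspace. -/
def IsLocallyFinite (b : LieSubalgebra k L) (M : ModuleCat.{u} (Env k L)) : Prop :=
  ∀ m : M, ∃ N : Submodule k M, m ∈ N ∧ FiniteDimensional k N ∧
    ∀ x ∈ b, ∀ v ∈ N, toEnv k x • v ∈ N

/-- The objects of the truncated category `ᴷO`: weight modules on which `b` acts locally
finitely, with support contained in `K`. -/
def truncO (j : H →ₗ[k] L) (b : LieSubalgebra k L) (K : Set (Module.Dual k H)) :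
    ObjectProperty (ModuleCat.{u} (Env k L)) :=
  fun M => IsWeightModule j M ∧ IsLocallyFinite b M ∧ support j M ⊆ K

/-- The truncated category `ᴷO`, a full subcategory of the category of `L`-modules. -/
abbrev TruncO (j : H →ₗ[k] L) (b : LieSubalgebra k L) (K : Set (Module.Dual k H)) :=
  (truncO j b K).FullSubcategory

/-! ### `ᴷO` is an abelian category -/

lemma hom_smul_k {M N : ModuleCat.{u} (Env k L)} (f : M ⟶ N) (c : k) (m : M) :
    f.hom (c • m) = c • f.hom m :=
  (f.hom.restrictScalars k).map_smul c m

lemma map_mem_weightSpace (j : H →ₗ[k] L) {M N : ModuleCat.{u} (Env k L)} (f : M ⟶ N)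
    {μ : Module.Dual k H} {m : M} (hm : m ∈ weightSpace j M μ) :
    f.hom m ∈ weightSpace j N μ := fun h => by
  rw [← map_smul, hm h, hom_smul_k]

lemma mem_weightSpace_of_injective (j : H →ₗ[k] L) {M N : ModuleCat.{u} (Env k L)} (f : M ⟶ N)
    (hf : Function.Injective f.hom) {μ : Module.Dual k H} {m : M}
    (hm : f.hom m ∈ weightSpace j N μ) : m ∈ weightSpace j M μ := fun h => hf <| by
  rw [map_smul, hm h, hom_smul_k]

lemma map_mem_iSup (j : H →ₗ[k] L) (S : Set (Module.Dual k H)) {M N : ModuleCat.{u} (Env k L)}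
    (f : M ⟶ N) {m : M} (hm : m ∈ ⨆ μ ∈ S, weightSpace j M μ) :
    f.hom m ∈ ⨆ μ ∈ S, weightSpace j N μ := by
  have h : (⨆ μ ∈ S, weightSpace j M μ) ≤
      (⨆ μ ∈ S, weightSpace j N μ).comap (f.hom.restrictScalars k) :=
    iSup₂_le fun μ hμ x hx =>
      (le_iSup₂ (f := fun μ (_ : μ ∈ S) => weightSpace j N μ) μ hμ) (map_mem_weightSpace j f hx)
  exact h hm

/-- A submodule which contains a finite sum of weight vectors of different weights contains each
of them. -/
lemma mem_of_sum_mem (j : H →ₗ[k] L) (M : ModuleCat.{u} (Env k L)) (R : Submodule k M)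
    (hR : ∀ h : H, ∀ m ∈ R, toEnv k (j h) • m ∈ R) (s : Finset (Module.Dual k H)) :
    ∀ v : Module.Dual k H → M, (∀ μ ∈ s, v μ ∈ weightSpace j M μ) → ∑ μ ∈ s, v μ ∈ R →
      ∀ μ ∈ s, v μ ∈ R := by
  classical
  induction s using Finset.induction_on with
  | empty => simp
  | insert a s ha ih =>
    intro v hv hsum
    have key : ∀ μ ∈ s, v μ ∈ R := by
      intro μ hμ
      obtain ⟨h, hh⟩ : ∃ h, μ h ≠ a h := by
        by_contra! hc
        exact ha ((LinearMap.ext hc : μ = a) ▸ hμ)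
      have h1 : ∑ ν ∈ s, (ν h - a h) • v ν ∈ R := by
        have h2 := R.sub_mem (hR h _ hsum) (R.smul_mem (a h) hsum)
        rw [Finset.sum_insert ha, smul_add, smul_add, Finset.smul_sum, Finset.smul_sum,
          hv a (Finset.mem_insert_self a s) h, add_sub_add_left_eq_sub,
          ← Finset.sum_sub_distrib] at h2
        convert h2 using 1
        refine Finset.sum_congr rfl fun ν hν => ?_
        rw [hv ν (Finset.mem_insert_of_mem hν) h, sub_smul]
      have h3 := ih (fun ν => (ν h - a h) • v ν)
        (fun ν hν => Submodule.smul_mem _ _ (hv ν (Finset.mem_insert_of_mem hν))) h1 μ hμ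
      exact (R.smul_mem_iff (sub_ne_zero.2 hh)).1 h3
    intro μ hμ
    rcases Finset.mem_insert.1 hμ with rfl | hμ
    · rw [Finset.sum_insert ha] at hsum
      simpa using R.sub_mem hsum (R.sum_mem key)
    · exact key μ hμ

/-- Being a weight module with support in `K` means being the sum of the weight spaces for
the weights in `K`. -/
lemma weight_support_iff (j : H →ₗ[k] L) (M : ModuleCat.{u} (Env k L))
    (K : Set (Module.Dual k H)) :
    (IsWeightModule j M ∧ support j M ⊆ K) ↔ ⨆ μ ∈ K, weightSpace j M μ = ⊤ := by
  classical
  constructor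
  · rintro ⟨h1, h2⟩
    rw [eq_top_iff, ← (h1 : _ = ⊤)]
    refine iSup_le fun μ => ?_
    by_cases hμ : weightSpace j M μ = ⊥
    · rw [hμ]; exact bot_le
    · exact le_iSup₂ (f := fun μ (_ : μ ∈ K) => weightSpace j M μ) μ (h2 hμ)
  · intro h
    refine ⟨?_, ?_⟩
    · refine eq_top_iff.2 (h ▸ ?_)
      exact iSup₂_le fun μ _ => le_iSup (weightSpace j M) μ
    · intro ν hν
      by_contra hνK
      refine hν (eq_bot_iff.2 fun m hm => ?_)
      have hmem : m ∈ ⨆ μ ∈ K, weightSpace j M μ := h ▸ Submodule.mem_top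
      rw [iSup_subtype', Submodule.mem_iSup_iff_exists_finsupp] at hmem
      obtain ⟨f, hf, hs⟩ := hmem
      let v : Module.Dual k H → M := fun μ =>
        if h : μ ∈ K then f ⟨μ, h⟩ else if μ = ν then -m else 0
      let s : Finset (Module.Dual k H) := f.support.map (Function.Embedding.subtype _)
      have hνs : ν ∉ s := by
        intro hc
        obtain ⟨⟨x, hx⟩, -, rfl⟩ := Finset.mem_map.1 hc
        exact hνK hx
      have hvν : v ν = -m := by simp [v, hνK]
      have hsum : ∑ μ ∈ insert ν s, v μ = 0 := by
        rw [Finset.sum_insert hνs, hvν, Finset.sum_map, neg_add_eq_zero, ← hs, Finsupp.sum]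
        refine Finset.sum_congr rfl fun x _ => ?_
        simp [v]
      have := mem_of_sum_mem j M ⊥ (fun h m hm => by
        rw [Submodule.mem_bot] at hm ⊢; rw [hm, smul_zero]) (insert ν s) v (by
          intro μ hμ
          by_cases hK : μ ∈ K
          · simpa [v, hK] using hf ⟨μ, hK⟩
          · rcases Finset.mem_insert.1 hμ with rfl | hμ
            · rw [hvν]; exact Submodule.neg_mem _ hm
            · obtain ⟨⟨x, hx⟩, -, rfl⟩ := Finset.mem_map.1 hμ
              exact absurd hx hK) (by rw [hsum]; exact Submodule.zero_mem _) ν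
              (Finset.mem_insert_self _ _)
      rw [hvν] at this
      simpa using this

lemma truncO_of_injective (j : H →ₗ[k] L) (b : LieSubalgebra k L) (K : Set (Module.Dual k H))
    {M N : ModuleCat.{u} (Env k L)} (f : M ⟶ N) (hf : Function.Injective f.hom)
    (hN : truncO j b K N) : truncO j b K M := by
  classical
  obtain ⟨h1, h2, h3⟩ := hN
  refine ⟨?_, ?_, ?_⟩
  · refine eq_top_iff.2 fun m _ => ?_
    have hmem : f.hom m ∈ ⨆ μ, weightSpace j N μ := (h1 : _ = ⊤) ▸ Submodule.mem_top
    rw [Submodule.mem_iSup_iff_exists_finsupp] at hmem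
    obtain ⟨g, hg, hs⟩ := hmem
    have hr := mem_of_sum_mem j N (LinearMap.range (f.hom.restrictScalars k))
      (by rintro h _ ⟨x, rfl⟩; exact ⟨toEnv k (j h) • x, map_smul f.hom _ _⟩)
      g.support g (fun μ _ => hg μ) ⟨m, hs.symm⟩
    choose! w hw using hr
    have hm : m = ∑ μ ∈ g.support, w μ := hf <| by
      rw [map_sum, ← hs]
      exact Finset.sum_congr rfl fun μ hμ => (hw μ hμ).symm
    rw [hm]
    refine Submodule.sum_mem _ fun μ hμ => Submodule.mem_iSup_of_mem μ ?_
    refine mem_weightSpace_of_injective j f hf ?_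
    have h4 : f.hom (w μ) = g μ := hw μ hμ
    rw [h4]; exact hg μ
  · intro m
    obtain ⟨V, hm, hV, hst⟩ := h2 (f.hom m)
    refine ⟨V.comap (f.hom.restrictScalars k), hm, ?_, fun x hx v hv => ?_⟩
    · refine Module.Finite.of_injective
        ((f.hom.restrictScalars k).restrict (p := V.comap (f.hom.restrictScalars k)) (q := V)
          fun _ h => h) fun x y hxy => ?_
      exact Subtype.ext (hf (congrArg Subtype.val hxy))
    · change f.hom _ ∈ V
      rw [map_smul]; exact hst x hx _ hv
  · intro μ hμ
    refine h3 fun hbot => hμ (eq_bot_iff.2 fun m hm => ?_)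
    have h4 := map_mem_weightSpace j f hm
    rw [hbot, Submodule.mem_bot] at h4
    exact hf (h4.trans (map_zero _).symm)

lemma truncO_of_surjective (j : H →ₗ[k] L) (b : LieSubalgebra k L) (K : Set (Module.Dual k H))
    {M N : ModuleCat.{u} (Env k L)} (f : M ⟶ N) (hf : Function.Surjective f.hom)
    (hM : truncO j b K M) : truncO j b K N := by
  obtain ⟨h1, h2, h3⟩ := hM
  have hK := (weight_support_iff j M K).1 ⟨h1, h3⟩
  have hN := (weight_support_iff j N K).2 (eq_top_iff.2 fun n _ => by
    obtain ⟨m, rfl⟩ := hf n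
    exact map_mem_iSup j K f (hK ▸ Submodule.mem_top))
  refine ⟨hN.1, fun n => ?_, hN.2⟩
  obtain ⟨m, rfl⟩ := hf n
  obtain ⟨V, hm, hV, hst⟩ := h2 m
  refine ⟨V.map (f.hom.restrictScalars k), ⟨m, hm, rfl⟩, inferInstance, ?_⟩
  rintro x hx _ ⟨v, hv, rfl⟩
  exact ⟨toEnv k x • v, hst x hx v hv, map_smul f.hom _ _⟩

lemma truncO_prod (j : H →ₗ[k] L) (b : LieSubalgebra k L) (K : Set (Module.Dual k H))
    {M N : ModuleCat.{u} (Env k L)} (hM : truncO j b K M) (hN : truncO j b K N) :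
    truncO j b K (ModuleCat.of (Env k L) (M × N)) := by
  let i₁ : M ⟶ ModuleCat.of (Env k L) (M × N) := ModuleCat.ofHom (LinearMap.inl _ M N)
  let i₂ : N ⟶ ModuleCat.of (Env k L) (M × N) := ModuleCat.ofHom (LinearMap.inr _ M N)
  have e : ∀ x : M × N, x = i₁.hom x.1 + i₂.hom x.2 := fun x => by simp [i₁, i₂]
  have h1 := (weight_support_iff j M K).1 ⟨hM.1, hM.2.2⟩
  have h2 := (weight_support_iff j N K).1 ⟨hN.1, hN.2.2⟩
  have h3 := (weight_support_iff j (ModuleCat.of (Env k L) (M × N)) K).2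
    (eq_top_iff.2 fun x _ => by
      rw [e x]
      exact Submodule.add_mem _ (map_mem_iSup j K i₁ (h1 ▸ Submodule.mem_top))
        (map_mem_iSup j K i₂ (h2 ▸ Submodule.mem_top)))
  refine ⟨h3.1, fun x => ?_, h3.2⟩
  obtain ⟨V, hm, hV, hst⟩ := hM.2.1 x.1
  obtain ⟨W, hm', hW, hst'⟩ := hN.2.1 x.2
  refine ⟨V.map (i₁.hom.restrictScalars k) ⊔ W.map (i₂.hom.restrictScalars k), ?_,
    inferInstance, ?_⟩
  · rw [e x]
    exact Submodule.add_mem_sup ⟨_, hm, rfl⟩ ⟨_, hm', rfl⟩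
  · intro y hy z hz
    obtain ⟨_, ⟨v, hv, rfl⟩, _, ⟨w, hw, rfl⟩, rfl⟩ := Submodule.mem_sup.1 hz
    rw [smul_add]
    exact Submodule.add_mem_sup ⟨toEnv k y • v, hst y hy v hv, map_smul i₁.hom _ _⟩
      ⟨toEnv k y • w, hst' y hy w hw, map_smul i₂.hom _ _⟩

variable (j : H →ₗ[k] L) (b : LieSubalgebra k L) (K : Set (Module.Dual k H))

instance : (truncO j b K).IsClosedUnderSubobjects where
  prop_of_mono f _ hY := truncO_of_injective j b K f ((ModuleCat.mono_iff_injective f).1 ‹_›) hY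

instance : (truncO j b K).IsClosedUnderQuotients where
  prop_of_epi f _ hX := truncO_of_surjective j b K f ((ModuleCat.epi_iff_surjective f).1 ‹_›) hX

instance : (truncO j b K).ContainsZero where
  exists_zero := by
    refine ⟨ModuleCat.of _ PUnit, ModuleCat.isZero_of_subsingleton _, ?_, ?_, ?_⟩
    · exact eq_top_iff.2 fun x _ => by
        rw [Subsingleton.elim x 0]; exact Submodule.zero_mem _
    · intro m
      refine ⟨⊥, ?_, inferInstance, ?_⟩
      · rw [Subsingleton.elim m 0]; exact Submodule.zero_mem _
      · intro x _ v _
        rw [Subsingleton.elim (toEnv k x • v) 0]; exact Submodule.zero_mem _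
    · intro μ hμ
      exact absurd (eq_bot_iff.2 fun x _ => by
        rw [Subsingleton.elim x 0]; exact Submodule.zero_mem _) hμ

instance : (truncO j b K).IsClosedUnderBinaryProducts where
  limitsOfShape_le := by
    rintro X ⟨p⟩
    let M := p.diag.obj ⟨WalkingPair.left⟩
    let N := p.diag.obj ⟨WalkingPair.right⟩
    let f : X ⟶ ModuleCat.of (Env k L) (M × N) := ModuleCat.ofHom
      ((p.π.app ⟨WalkingPair.left⟩).hom.prod (p.π.app ⟨WalkingPair.right⟩).hom)
    have : Mono f := by
      refine ⟨fun {Z} a c hac => p.isLimit.hom_ext ?_⟩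
      have hpt : ∀ z, f.hom (a.hom z) = f.hom (c.hom z) := fun z => by
        have := congrArg (fun t => t.hom z) hac
        simpa using this
      rintro ⟨_ | _⟩
      · ext z; exact congrArg Prod.fst (hpt z)
      · ext z; exact congrArg Prod.snd (hpt z)
    exact (truncO j b K).prop_of_mono f
      (truncO_prod j b K (p.prop_diag_obj _) (p.prop_diag_obj _))

instance : (truncO j b K).IsClosedUnderFiniteProducts :=
  ObjectProperty.IsClosedUnderFiniteProducts.mk'

instance : PreservesFiniteLimits (truncO j b K).ι :=
  have := (truncO j b K).preservesKernels_ι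
  Functor.preservesFiniteLimits_of_preservesKernels _

instance : PreservesFiniteColimits (truncO j b K).ι :=
  have := (truncO j b K).preservesCokernels_ι
  Functor.preservesFiniteColimits_of_preservesCokernels _

/-! ### Serre subquotients -/

/-- The objects of `ᴷO` which lie in `ᴺO`, a Serre subcategory of `ᴷO`. -/
def serreSub (K N : Set (Module.Dual k H)) : ObjectProperty (TruncO j b K) :=
  (truncO j b N).inverseImage (truncO j b K).ι

instance (N : Set (Module.Dual k H)) : (serreSub j b K N).IsClosedUnderSubobjects :=
  inferInstanceAs ((truncO j b N).inverseImage (truncO j b K).ι).IsClosedUnderSubobjects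

instance (N : Set (Module.Dual k H)) : (serreSub j b K N).IsClosedUnderQuotients :=
  inferInstanceAs ((truncO j b N).inverseImage (truncO j b K).ι).IsClosedUnderQuotients

instance (N : Set (Module.Dual k H)) : (serreSub j b K N).ContainsZero :=
  inferInstanceAs ((truncO j b N).inverseImage (truncO j b K).ι).ContainsZero

instance (N : Set (Module.Dual k H)) : (serreSub j b K N).IsClosedUnderExtensions where
  prop_X₂_of_shortExact {S} hS h₁ h₃ := by
    have hS' := hS.map_of_exact (truncO j b K).ι
    refine ⟨S.X₂.property.1, S.X₂.property.2.1, fun μ hμ => ?_⟩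
    by_contra hN
    have z₁ : weightSpace j S.X₁.obj μ = ⊥ := by
      by_contra h; exact hN (h₁.2.2 h)
    have z₃ : weightSpace j S.X₃.obj μ = ⊥ := by
      by_contra h; exact hN (h₃.2.2 h)
    refine hμ (eq_bot_iff.2 fun m hm => ?_)
    have h4 := map_mem_weightSpace j ((truncO j b K).ι.map S.g) hm
    rw [show weightSpace j ((truncO j b K).ι.obj S.X₃) μ = ⊥ from z₃, Submodule.mem_bot] at h4
    obtain ⟨x, rfl⟩ := ((ShortComplex.moduleCat_exact_iff _).1 hS'.exact) m h4
    have hinj := (ModuleCat.mono_iff_injective _).1 hS'.mono_f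
    have h5 := mem_weightSpace_of_injective j ((truncO j b K).ι.map S.f) hinj hm
    rw [show weightSpace j ((truncO j b K).ι.obj S.X₁) μ = ⊥ from z₁] at h5
    have h6 : x = 0 := h5
    subst h6
    exact map_zero (S.map (truncO j b K).ι).f.hom

instance (N : Set (Module.Dual k H)) : (serreSub j b K N).IsSerreClass where

/-- The Serre quotient `ᴷO / ᴺO`: the localization of `ᴷO` at the morphisms whose kernel and
cokernel lie in `ᴺO`. -/
abbrev SerreQuotient (K N : Set (Module.Dual k H)) :=
  (serreSub j b K N).isoModSerre.Localization

/-- The quotient functor `π : ᴷO ⥤ ᴷO / ᴺO`. -/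
abbrev quotientFunctor (K N : Set (Module.Dual k H)) : TruncO j b K ⥤ SerreQuotient j b K N :=
  (serreSub j b K N).isoModSerre.Q

instance (N : Set (Module.Dual k H)) : Abelian (SerreQuotient j b K N) :=
  ObjectProperty.SerreClassLocalization.abelian (quotientFunctor j b K N) (serreSub j b K N)

/-! ### Verma modules -/

/-- The Verma module `Δ(λ) = U(L) ⊗_{U(b)} k_λ` for `b = H ⊕ n`, where `n` acts on `k_λ` by zero:
the quotient of `U(L)` by the left ideal generated by `n` and by the elements `h - λ(h)`,
`h ∈ H`. -/
def verma (n : Submodule k L) (lam : Module.Dual k H) : ModuleCat.{u} (Env k L) :=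
  ModuleCat.of (Env k L) (Env k L ⧸ Submodule.span (Env k L)
    ({a : Env k L | ∃ x ∈ n, a = toEnv k x} ∪
      {a : Env k L | ∃ h : H, a = toEnv k (j h) - algebraMap k (Env k L) (lam h)}))

/-! ### Truncation of modules -/

/-- The largest submodule of `M` contained in the sum of the weight spaces `M_μ`, `μ ∈ S`.
For a weight module, this is the largest submodule with support in `S`. -/
def weightPart (S : Set (Module.Dual k H)) (M : ModuleCat.{u} (Env k L)) :
    Submodule (Env k L) M where
  carrier := {m | ∀ a : Env k L, a • m ∈ ⨆ μ ∈ S, weightSpace j M μ}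
  add_mem' := fun hx hy a => by rw [smul_add]; exact Submodule.add_mem _ (hx a) (hy a)
  zero_mem' := fun a => by rw [smul_zero]; exact Submodule.zero_mem _
  smul_mem' := fun c x hx a => by rw [smul_smul]; exact hx (a * c)

/-- `M ↦ weightPart j S M`, as a functor. -/
def weightPartFunctor (S : Set (Module.Dual k H)) :
    ModuleCat.{u} (Env k L) ⥤ ModuleCat.{u} (Env k L) where
  obj M := ModuleCat.of _ (weightPart j S M)
  map {M N} f := ModuleCat.ofHom (f.hom.restrict (p := weightPart j S M) (q := weightPart j S N)
    fun m hm a => by rw [← map_smul]; exact map_mem_iSup j S f (hm a))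

end Modules

/-! ## Parabolic induction and restriction -/

section IndRes

variable {k : Type u} [Field k] {g : Type u} [LieRing g] [LieAlgebra k g]

/-- The relations which define `U(g) ⊗_{U(p)} M` as a quotient of `U(g) ⊗_k M`, where
`p = l ⊕ u` and `u` acts on the `l`-module `M` by zero. -/
def indRel (l : LieSubalgebra k g) (uu : Submodule k g) (M : ModuleCat.{u} (Env k l)) :
    Submodule (Env k g) (Env k g ⊗[k] M) :=
  Submodule.span (Env k g)
    ({t | ∃ (y : l) (m : M), t = toEnv k (y : g) ⊗ₜ[k] m - 1 ⊗ₜ[k] (toEnv k y • m)} ∪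
      {t | ∃ y ∈ uu, ∃ m : M, t = toEnv k y ⊗ₜ[k] m})

lemma indRel_le_comap (l : LieSubalgebra k g) (uu : Submodule k g)
    {M N : ModuleCat.{u} (Env k l)} (f : M ⟶ N) :
    indRel l uu M ≤ (indRel l uu N).comap (TensorProduct.AlgebraTensorModule.map
      (LinearMap.id : Env k g →ₗ[Env k g] Env k g) (f.hom.restrictScalars k)) := by
  refine Submodule.span_le.2 ?_
  rintro _ (⟨y, m, rfl⟩ | ⟨y, hy, m, rfl⟩)
  · refine Submodule.subset_span (Or.inl ⟨y, f.hom m, ?_⟩)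
    simp
  · exact Submodule.subset_span (Or.inr ⟨y, hy, f.hom m, by simp⟩)

/-- Parabolic induction `Ind^g_{l,+} : l-Mod ⥤ g-Mod` for a parabolic subalgebra `p = l ⊕ u`:
an `l`-module `M` is viewed as a `p`-module with trivial action of `u`, and is sent to
`U(g) ⊗_{U(p)} M`. -/
def parabolicInd (l : LieSubalgebra k g) (uu : Submodule k g) :
    ModuleCat.{u} (Env k l) ⥤ ModuleCat.{u} (Env k g) where
  obj M := ModuleCat.of _ ((Env k g ⊗[k] M) ⧸ indRel l uu M)
  map {M N} f := ModuleCat.ofHom (Submodule.mapQ _ _ _ (indRel_le_comap l uu f))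
  map_id M := by
    refine ModuleCat.hom_ext (Submodule.linearMap_qext _ ?_)
    refine LinearMap.ext fun x => ?_
    induction x using TensorProduct.induction_on with
    | zero => simp
    | tmul a m => simp
    | add x y hx hy => rw [map_add, hx, hy, map_add]
  map_comp {M N P} f h := by
    refine ModuleCat.hom_ext (Submodule.linearMap_qext _ ?_)
    refine LinearMap.ext fun x => ?_
    induction x using TensorProduct.induction_on with
    | zero => simp
    | tmul a m => simp
    | add x y hx hy => rw [map_add, hx, hy, map_add]

attribute [local instance] LieRing.ofAssociativeRing

/-- The algebra map `U(l) → U(g)` induced by the inclusion of a subalgebra `l` of `g`. -/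
def envIncl (l : LieSubalgebra k g) : Env k l →ₐ[k] Env k g :=
  UniversalEnvelopingAlgebra.lift k ((UniversalEnvelopingAlgebra.ι k).comp l.incl)

/-- Ordinary restriction of `g`-modules to `l`. -/
def restriction (l : LieSubalgebra k g) :
    ModuleCat.{u} (Env k g) ⥤ ModuleCat.{u} (Env k l) :=
  ModuleCat.restrictScalars (envIncl l).toRingHom

end IndRes

/-! ## Root-reductive Lie algebras -/

section RootReductive

variable {k : Type u} [Field k] {g : Type u} [LieRing g] [LieAlgebra k g]

/-- The adjoint action of the subalgebra `s` on the subalgebra `t` is semisimple: every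
`s`-stable subspace of `t` has an `s`-stable complement in `t`. For finite dimensional `s = t` in
characteristic zero this means that `s` is reductive; for `s ≤ t` it means that `s` is reductive
in `t`. -/
def ActsSemisimply (s t : LieSubalgebra k g) : Prop :=
  ∀ V : Submodule k g, V ≤ t.toSubmodule → (∀ x ∈ s, ∀ v ∈ V, ⁅x, v⁆ ∈ V) →
    ∃ W : Submodule k g, (∀ x ∈ s, ∀ w ∈ W, ⁅x, w⁆ ∈ W) ∧ Disjoint V W ∧ V ⊔ W = t.toSubmodule

/-- `x` is a root vector of `t` with respect to the subalgebra `c` of `t`. -/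
def IsRootVector (t c : LieSubalgebra k g) (x : g) : Prop :=
  x ∈ t ∧ x ≠ 0 ∧ ∃ α : Module.Dual k c, α ≠ 0 ∧ ∀ h : c, ⁅(h : g), x⁆ = α h • x

end RootReductive

/-- A root-reductive Lie algebra `g`, with its exhaustion by finite dimensional reductive
subalgebras and their Cartan subalgebras. -/
structure RootReductive (k g : Type u) [Field k] [LieRing g] [LieAlgebra k g] where
  /-- The subalgebras `𝔤̃ₙ`. -/
  gt : ℕ → LieSubalgebra k g
  gt_le : ∀ n, gt n ≤ gt (n + 1)
  exhaust : ∀ x : g, ∃ n, x ∈ gt n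
  finite : ∀ n, FiniteDimensional k (gt n)
  reductive : ∀ n, ActsSemisimply (gt n) (gt n)
  reductive_in : ∀ n, ActsSemisimply (gt n) (gt (n + 1))
  /-- The Cartan subalgebra `𝔥ₙ` of `𝔤̃ₙ`. -/
  ht : ℕ → LieSubalgebra k g
  ht_le_gt : ∀ n, ht n ≤ gt n
  isCartan : ∀ n, ((ht n).comap (gt n).incl).IsCartanSubalgebra
  ht_le : ∀ n, ht n ≤ ht (n + 1)
  rootVector : ∀ n x, IsRootVector (gt n) (ht n) x → IsRootVector (gt (n + 1)) (ht (n + 1)) x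

namespace RootReductive

variable {k : Type u} [Field k] {g : Type u} [LieRing g] [LieAlgebra k g] (D : RootReductive k g)

lemma ht_mono : Monotone D.ht := monotone_nat_of_le_succ D.ht_le

/-- The Cartan subalgebra `𝔥 = ⋃ 𝔥ₙ` of `g`. -/
def cartan : LieSubalgebra k g where
  carrier := {x | ∃ n, x ∈ D.ht n}
  zero_mem' := ⟨0, (D.ht 0).zero_mem⟩
  add_mem' := by
    rintro x y ⟨m, hx⟩ ⟨n, hy⟩
    exact ⟨max m n, (D.ht _).add_mem (D.ht_mono (le_max_left m n) hx)
      (D.ht_mono (le_max_right m n) hy)⟩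
  smul_mem' := by
    rintro c x ⟨m, hx⟩
    exact ⟨m, (D.ht m).smul_mem c hx⟩
  lie_mem' := by
    rintro x y ⟨m, hx⟩ ⟨n, hy⟩
    exact ⟨max m n, (D.ht _).lie_mem (D.ht_mono (le_max_left m n) hx)
      (D.ht_mono (le_max_right m n) hy)⟩

/-- The weights, i.e. the elements of `𝔥*`. -/
abbrev Weight : Type u := Module.Dual k D.cartan

/-- The subalgebra `𝔤ₙ = 𝔤̃ₙ + 𝔥`. (The supremum is the subalgebra generated by `𝔤̃ₙ` and `𝔥`. It is
their sum, because `𝔤̃ₙ` is spanned by `𝔥ₙ` and root vectors, which `𝔥` rescales.) -/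
def gn (n : ℕ) : LieSubalgebra k g := D.gt n ⊔ D.cartan

/-- The embedding of `𝔥` in `g`. -/
def toG : D.cartan →ₗ[k] g := D.cartan.toSubmodule.subtype

/-- The embedding of `𝔥` in `𝔤ₙ`. -/
def toGn (n : ℕ) : D.cartan →ₗ[k] D.gn n :=
  Submodule.inclusion (show D.cartan.toSubmodule ≤ (D.gn n).toSubmodule from
    fun _ hx => (le_sup_right : D.cartan ≤ D.gn n) hx)

/-- The space `𝔤^α`. -/
def rootSpace (α : D.Weight) : Submodule k g where
  carrier := {x | ∀ h : D.cartan, ⁅(h : g), x⁆ = α h • x}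
  add_mem' := fun {a b} ha hb h => by rw [lie_add, smul_add, ha h, hb h]
  zero_mem' := fun h => by rw [lie_zero, smul_zero]
  smul_mem' := fun c m hm h => by rw [lie_smul, hm h, smul_comm]

/-- The set `Φ` of roots of `g`. -/
def roots : Set D.Weight := {α | α ≠ 0 ∧ D.rootSpace α ≠ ⊥}

/-- The set `Φₙ` of roots of `𝔤ₙ`. -/
def rootsN (n : ℕ) : Set D.Weight :=
  {α | α ≠ 0 ∧ D.rootSpace α ⊓ (D.gn n).toSubmodule ≠ ⊥}

/-- The coset `Λₙ = λ + ℤΦₙ`. -/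
def coset (n : ℕ) (lam : D.Weight) : Set D.Weight :=
  {μ | μ - lam ∈ AddSubgroup.closure (D.rootsN n)}

/-- The functor `Res^n_λ`: restriction of `g`-modules to `𝔤ₙ`, followed by taking the largest
submodule with support in `λ + ℤΦₙ`. -/
def res (n : ℕ) (lam : D.Weight) :
    ModuleCat.{u} (Env k g) ⥤ ModuleCat.{u} (Env k (D.gn n)) :=
  restriction (D.gn n) ⋙ weightPartFunctor (D.toGn n) (D.coset n lam)

/-- A choice of positive roots, i.e. of a splitting Borel subalgebra containing `𝔥`. -/
structure PositiveSystem where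
  /-- The set `Φ⁺`. -/
  pos : Set D.Weight
  union : D.roots = pos ∪ {α | -α ∈ pos}
  disjoint : Disjoint pos {α | -α ∈ pos}
  add_mem : ∀ α ∈ pos, ∀ β ∈ pos, α + β ∈ D.roots → α + β ∈ pos

namespace PositiveSystem

variable {D} (B : D.PositiveSystem)

/-- `𝔫⁺ = ⨁_{α ∈ Φ⁺} 𝔤^α`. -/
def nPlus : Submodule k g := ⨆ α ∈ B.pos, D.rootSpace α

lemma lie_mem_rootSpace {α β : D.Weight} {x y : g} (hx : x ∈ D.rootSpace α)
    (hy : y ∈ D.rootSpace β) : ⁅x, y⁆ ∈ D.rootSpace (α + β) := fun h => by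
  rw [leibniz_lie, hx h, hy h, smul_lie, lie_smul, LinearMap.add_apply, add_smul]

lemma lie_mem_nPlus {x y : g} (hx : x ∈ B.nPlus) (hy : y ∈ B.nPlus) : ⁅x, y⁆ ∈ B.nPlus := by
  have key : ∀ α ∈ B.pos, ∀ β ∈ B.pos, ∀ x ∈ D.rootSpace α, ∀ y ∈ D.rootSpace β,
      ⁅x, y⁆ ∈ B.nPlus := by
    intro α hα β hβ x hx y hy
    have h := lie_mem_rootSpace hx hy
    by_cases hbot : D.rootSpace (α + β) = ⊥
    · rw [hbot, Submodule.mem_bot] at h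
      rw [h]; exact Submodule.zero_mem _
    · have hne : α + β ≠ 0 := fun h0 =>
        Set.disjoint_left.1 B.disjoint hα (by
          change -α ∈ B.pos
          rwa [neg_eq_of_add_eq_zero_right h0])
      exact (le_iSup₂ (f := fun γ (_ : γ ∈ B.pos) => D.rootSpace γ) (α + β)
        (B.add_mem α hα β hβ ⟨hne, hbot⟩)) h
  have step : ∀ α ∈ B.pos, ∀ x ∈ D.rootSpace α, ∀ y ∈ B.nPlus, ⁅x, y⁆ ∈ B.nPlus := by
    intro α hα x hx y hy
    have hle : B.nPlus ≤ B.nPlus.comap (LieAlgebra.ad k g x : g →ₗ[k] g) :=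
      iSup₂_le fun β hβ y hy => key α hα β hβ x hx y hy
    exact hle hy
  have hle : B.nPlus ≤ B.nPlus.comap (LieAlgebra.ad k g y : g →ₗ[k] g) :=
    iSup₂_le fun α hα x hx => by
      change ⁅y, x⁆ ∈ B.nPlus
      rw [← lie_skew]; exact Submodule.neg_mem _ (step α hα x hx y hy)
  rw [← lie_skew]; exact Submodule.neg_mem _ (hle hx)

lemma cartan_lie_mem_nPlus {x y : g} (hx : x ∈ D.cartan) (hy : y ∈ B.nPlus) :
    ⁅x, y⁆ ∈ B.nPlus := by
  have hle : B.nPlus ≤ B.nPlus.comap (LieAlgebra.ad k g x : g →ₗ[k] g) :=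
    iSup₂_le fun β hβ y hy => by
      change ⁅x, y⁆ ∈ B.nPlus
      rw [hy ⟨x, hx⟩]
      exact Submodule.smul_mem _ _
        ((le_iSup₂ (f := fun γ (_ : γ ∈ B.pos) => D.rootSpace γ) β hβ) hy)
  exact hle hy

/-- The Borel subalgebra `𝔟 = 𝔥 ⊕ 𝔫⁺`. -/
def borel : LieSubalgebra k g where
  toSubmodule := D.cartan.toSubmodule ⊔ B.nPlus
  lie_mem' := by
    intro x y hx hy
    obtain ⟨h, hh, a, ha, rfl⟩ := Submodule.mem_sup.1 hx
    obtain ⟨h', hh', a', ha', rfl⟩ := Submodule.mem_sup.1 hy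
    rw [lie_add, add_lie, add_lie, add_assoc]
    refine Submodule.add_mem_sup (D.cartan.lie_mem hh hh') (Submodule.add_mem _ ?_
      (Submodule.add_mem _ (B.cartan_lie_mem_nPlus hh ha') (B.lie_mem_nPlus ha ha')))
    rw [← lie_skew]; exact Submodule.neg_mem _ (B.cartan_lie_mem_nPlus hh' ha)

/-- The Borel subalgebra is a Dynkin Borel subalgebra, and the exhaustion of `g` is adapted to it:
each `𝔤̃ₙ + 𝔟` is a (parabolic) subalgebra of `g`. -/
def IsDynkin : Prop :=
  ∀ n, ∃ p : LieSubalgebra k g, p.toSubmodule = (D.gt n).toSubmodule ⊔ B.borel.toSubmodule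

/-- `𝔫ₙ⁺ = 𝔫⁺ ∩ 𝔤ₙ`, as a subspace of `𝔤ₙ`. -/
def nPlusN (n : ℕ) : Submodule k (D.gn n) := B.nPlus.comap (D.gn n).toSubmodule.subtype

/-- `𝔟ₙ = 𝔟 ∩ 𝔤ₙ`, as a subalgebra of `𝔤ₙ`. -/
def borelN (n : ℕ) : LieSubalgebra k (D.gn n) := B.borel.comap (D.gn n).incl

/-- The nilradical `⨁ 𝔤^α`, `α ∈ Φ⁺ ∖ Φₙ`, of the parabolic subalgebra `𝔤ₙ + 𝔟`. -/
def uPlus (n : ℕ) : Submodule k g := ⨆ α ∈ B.pos \ D.rootsN n, D.rootSpace α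

/-- The functor `Ind^n_+`: parabolic induction from `𝔤ₙ` to `g`. -/
def ind (n : ℕ) : ModuleCat.{u} (Env k (D.gn n)) ⥤ ModuleCat.{u} (Env k g) :=
  parabolicInd (D.gn n) (B.uPlus n)

/-- The Verma module `Δ(μ)` of `g`. -/
def Δ (μ : D.Weight) : ModuleCat.{u} (Env k g) := verma D.toG B.nPlus μ

/-- The Verma module `Δₙ(μ)` of `𝔤ₙ`. -/
def Δn (n : ℕ) (μ : D.Weight) : ModuleCat.{u} (Env k (D.gn n)) :=
  verma (D.toGn n) (B.nPlusN n) μ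

/-- The objects of `ᴷO = ᴷO(g, 𝔟)`. -/
abbrev O (K : Set D.Weight) : ObjectProperty (ModuleCat.{u} (Env k g)) :=
  truncO D.toG B.borel K

/-- The objects of `ᴷO(𝔤ₙ, 𝔟ₙ)`. -/
abbrev On (n : ℕ) (K : Set D.Weight) : ObjectProperty (ModuleCat.{u} (Env k (D.gn n))) :=
  truncO (D.toGn n) (B.borelN n) K

/-- The quotient functor `π` from `ᴷO` to the Serre quotient of `ᴷO` by `ᴺO`. -/
abbrev π (K N : Set D.Weight) : (B.O K).FullSubcategory ⥤ SerreQuotient D.toG B.borel K N :=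
  quotientFunctor D.toG B.borel K N

/-- The partial order `μ ≤ λ`: the difference `λ - μ` is a finite sum of positive roots. -/
def le (μ lam : D.Weight) : Prop := lam - μ ∈ AddSubmonoid.closure B.pos

/-- The partial order `μ ≤ₙ λ`: the difference `λ - μ` is a finite sum of roots in
`Φₙ⁺ = Φₙ ∩ Φ⁺`. -/
def leN (n : ℕ) (μ lam : D.Weight) : Prop :=
  lam - μ ∈ AddSubmonoid.closure (D.rootsN n ∩ B.pos)

/-- The ideal of `(𝔥*, ≤)` generated by `E`. -/
def ideal (E : Set D.Weight) : Set D.Weight := {μ | ∃ ν ∈ E, B.le μ ν}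

/-- The ideal of `(𝔥*, ≤ₙ)` generated by `E`. -/
def idealN (n : ℕ) (E : Set D.Weight) : Set D.Weight := {μ | ∃ ν ∈ E, B.leN n μ ν}

end PositiveSystem

end RootReductive

end CatO

/-! ## Extending a module over a subalgebra to the whole Lie algebra -/

namespace CatO.PBW

variable {k : Type*} [Field k] {g : Type*} [LieRing g] [LieAlgebra k g]
  {I : Type*} [LinearOrder I] {M : Type*} [AddCommGroup M] [Module k M]

/-! Parabolic induction and `Res` form an adjoint-like pair between the truncated category of `𝔤ₙ`
and that of `g`. The unit `M → Res Ind M` is an isomorphism, and the counit `Ind Res N → N` has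
kernel and cokernel with weights in `K \ Kn`. Since `Res` inverts every morphism of the latter kind,
`equivalenceOfUnitCounit` turns the pair into an equivalence with the localization. Both parts of
the theorem are instances of `IsDynkin.exists_equivalence`, whose hypotheses on the sets of weights
are collected in `IsTruncation`.

Everything about unit and counit rests on `IsDynkin.add_notMem_closure`: a sum of positive roots,
one of which lies outside `Φₙ`, is never in `ℤΦₙ`. Consequently, in `Ind M`, which is `M` plus what
the opposite nilradical produces from it, exactly `M` has weights in the coset
(`IsDynkin.range_unitMap`). Likewise, on an object of `ᴷO` the nilradical would raise the weights of
the coset out of `K`, so it kills `Res N` (`IsDynkin.uPlus_smul_eq_zero`), which yields the counit.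
The counit is the identity on the coset part, so it is bijective on the weight spaces that survive
in the quotient.

To prove the separation of weights one evaluates at an element of `𝔥` which vanishes on `Φₙ` and is
a positive integer on the nilradical roots of a large finite level. At that level the algebra is its
center plus a semisimple ideal, and the sum of the coroots of the nilradical will do
(`exists_coweight_of_levi`), because reflections in Levi roots permute the nilradical roots.

Two further ingredients are needed. Injectivity of `M → Ind M` is of Poincaré-Birkhoff-Witt type: by
`exists_module_extension` every module of a subalgebra `p` embeds into a `g`-module, namely `S(g/p)
⊗ M` with a recursively defined action, and this embedding factors through `Ind M`. Local finiteness
under the possibly infinite dimensional `𝔟` is `Generates.isLocallyFinite`: a finite dimensional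
space of vectors killed by the nilradical of level `N` is moved by `𝔟` only through its intersection
with `𝔤_N`, which normalizes the finite dimensional `𝔤̃_N`. -/

lemma exists_min {A : Multiset I} (hA : A ≠ 0) : ∃ i ∈ A, ∀ j ∈ A, i ≤ j := by
  have hne : A.toFinset.Nonempty := by
    rw [Finset.nonempty_iff_ne_empty, Ne, Multiset.toFinset_eq_empty]; exact hA
  refine ⟨A.toFinset.min' hne, ?_, fun j hj => ?_⟩
  · exact Multiset.mem_toFinset.1 (Finset.min'_mem _ hne)
  · exact Finset.min'_le _ _ (Multiset.mem_toFinset.2 hj)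

open Classical in
/-- The least element of a nonempty multiset. -/
def least (A : Multiset I) (hA : A ≠ 0) : I := (exists_min hA).choose

lemma least_cons {i : I} {K : Multiset I} (h : ∀ j ∈ K, i ≤ j) (hA : i ::ₘ K ≠ 0) :
    least (i ::ₘ K) hA = i := by
  have h1 := (exists_min hA).choose_spec
  refine le_antisymm (h1.2 i (Multiset.mem_cons_self i K)) ?_
  rcases Multiset.mem_cons.1 h1.1 with h2 | h2
  · exact h2.ge
  · exact h _ h2

lemma exists_cons {A : Multiset I} (hA : A ≠ 0) : ∃ i K, A = i ::ₘ K ∧ ∀ j ∈ K, i ≤ j := by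
  obtain ⟨i, hi, h⟩ := exists_min hA
  exact ⟨i, A.erase i, (Multiset.cons_erase hi).symm, fun j hj => h j (Multiset.mem_of_mem_erase hj)⟩

variable (c : g →ₗ[k] I →₀ k) (v : I → g) (ρ : g →ₗ[k] Module.End k M)

/-- Multiplication by the linear form with coordinates `c x`. -/
def lead : g →ₗ[k] Module.End k (Multiset I →₀ M) :=
  (Finsupp.linearCombination k
    (fun i => Finsupp.lmapDomain M k (fun A : Multiset I => i ::ₘ A))) ∘ₗ c

omit [LinearOrder I] in
lemma lead_apply (x : g) (n : Multiset I →₀ M) :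
    lead c x n = (c x).sum fun i t => t • n.mapDomain (fun A => i ::ₘ A) := by
  simp [lead, Finsupp.linearCombination_apply, Finsupp.sum, LinearMap.sum_apply]

omit [LinearOrder I] in
lemma lead_single (x : g) (A : Multiset I) (m : M) :
    lead c x (Finsupp.single A m) = (c x).sum fun i t => t • Finsupp.single (i ::ₘ A) m := by
  simp [lead_apply, Finsupp.mapDomain_single]

/-- The component of `x` in the span of the `v j`, `j ≤ i`. -/
def lo (i : I) : g →ₗ[k] g := (Finsupp.linearCombination k fun j => if j ≤ i then v j else 0) ∘ₗ c

/-- The complementary component. -/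
def hi (i : I) : g →ₗ[k] g := LinearMap.id - lo c v i

lemma lo_add_hi (i : I) (x : g) : lo c v i x + hi c v i x = x := by simp [hi]

/-- The correction term in the recursive definition of the action. -/
def corr (T : g →ₗ[k] Module.End k (Multiset I →₀ M)) (A : Multiset I) (x : g) :
    M →ₗ[k] Multiset I →₀ M := by
  classical
  exact
  if hA : A = 0 then Finsupp.lsingle 0 ∘ₗ ρ x else
    T (v (least A hA)) ∘ₗ (T (hi c v (least A hA) x) - lead c (hi c v (least A hA) x)) ∘ₗ
        Finsupp.lsingle (A.erase (least A hA)) +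
      T ⁅hi c v (least A hA) x, v (least A hA)⁆ ∘ₗ Finsupp.lsingle (A.erase (least A hA))

lemma corr_zero (T : g →ₗ[k] Module.End k (Multiset I →₀ M)) (x : g) (m : M) :
    corr c v ρ T 0 x m = Finsupp.single 0 (ρ x m) := by simp [corr]

/-- With `y = hi c v i x` this encodes `y v_i w = v_i (y w) + ⁅y, v_i⁆ w`. The leading part of `y w`
is subtracted because its product with `v_i` is already contained in `lead`; the component `lo` is
meant to act by multiplication alone and needs no correction. -/
lemma corr_cons (T : g →ₗ[k] Module.End k (Multiset I →₀ M)) (x : g) (m : M)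
    {i : I} {K : Multiset I} (h : ∀ j ∈ K, i ≤ j) :
    corr c v ρ T (i ::ₘ K) x m =
      T (v i) (T (hi c v i x) (Finsupp.single K m) - lead c (hi c v i x) (Finsupp.single K m)) +
      T ⁅hi c v i x, v i⁆ (Finsupp.single K m) := by
  have hA : i ::ₘ K ≠ 0 := Multiset.cons_ne_zero
  simp [corr, least_cons h hA]

lemma corr_add (T : g →ₗ[k] Module.End k (Multiset I →₀ M)) (A : Multiset I) (x y : g) :
    corr c v ρ T A (x + y) = corr c v ρ T A x + corr c v ρ T A y := by
  ext1 m
  by_cases hA : A = 0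
  · subst hA; simp [corr_zero]
  · obtain ⟨i, K, rfl, h⟩ := exists_cons hA
    simp only [corr_cons c v ρ T _ m h, LinearMap.add_apply, map_add, map_sub, add_lie]
    abel

lemma corr_smul (T : g →ₗ[k] Module.End k (Multiset I →₀ M)) (A : Multiset I) (t : k) (x : g) :
    corr c v ρ T A (t • x) = t • corr c v ρ T A x := by
  ext1 m
  by_cases hA : A = 0
  · subst hA; simp [corr_zero]
  · obtain ⟨i, K, rfl, h⟩ := exists_cons hA
    simp only [corr_cons c v ρ T _ m h, LinearMap.smul_apply, map_smul, map_sub, smul_lie, smul_add,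
      smul_sub]

/-- One step of the recursive definition of the action. -/
def step (T : g →ₗ[k] Module.End k (Multiset I →₀ M)) : g →ₗ[k] Module.End k (Multiset I →₀ M) where
  toFun x := lead c x + Finsupp.lsum k fun A => corr c v ρ T A x
  map_add' x y := by
    refine Finsupp.lhom_ext' fun A => LinearMap.ext fun m => ?_
    simp [corr_add, add_add_add_comm]
  map_smul' t x := by
    refine Finsupp.lhom_ext' fun A => LinearMap.ext fun m => ?_
    simp [corr_smul]

lemma step_single (T : g →ₗ[k] Module.End k (Multiset I →₀ M)) (x : g) (A : Multiset I) (m : M) :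
    step c v ρ T x (Finsupp.single A m) =
      lead c x (Finsupp.single A m) + corr c v ρ T A x m := by
  simp [step]

/-- The approximations of the action: the `d`-th one is correct in degrees `< d`. -/
def stage : ℕ → (g →ₗ[k] Module.End k (Multiset I →₀ M))
  | 0 => 0
  | d + 1 => step c v ρ (stage d)

/-- The elements of degree `< d`. -/
def filt (k I M : Type*) [Field k] [AddCommGroup M] [Module k M] (d : ℕ) :
    Submodule k (Multiset I →₀ M) :=
  Finsupp.supported M k {A | A.card < d}

omit [LinearOrder I] in
lemma single_mem_filt {d : ℕ} {A : Multiset I} (h : A.card < d) (m : M) :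
    Finsupp.single A m ∈ filt k I M d :=
  Finsupp.single_mem_supported k m h

omit [LinearOrder I] in
lemma filt_mono {d e : ℕ} (h : d ≤ e) : filt k I M d ≤ filt k I M e :=
  Finsupp.supported_mono fun _ hA => lt_of_lt_of_le hA h

omit [LinearOrder I] in
/-- To prove that a linear condition holds in degrees `< d` it suffices to test monomials. -/
lemma filt_le {d : ℕ} {S : Submodule k (Multiset I →₀ M)}
    (h : ∀ A : Multiset I, A.card < d → ∀ m : M, Finsupp.single A m ∈ S) : filt k I M d ≤ S := by
  intro n hn
  rw [← Finsupp.sum_single n]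
  exact S.sum_mem fun A hA => h A (hn hA) _

omit [LinearOrder I] in
lemma lead_mem {d : ℕ} (x : g) {n : Multiset I →₀ M} (hn : n ∈ filt k I M d) :
    lead c x n ∈ filt k I M (d + 1) := by
  have : filt k I M d ≤ (filt k I M (d + 1)).comap (lead c x) := filt_le fun A hA m => by
    rw [Submodule.mem_comap, lead_single]
    exact Submodule.sum_mem _ fun i _ => Submodule.smul_mem _ _
      (single_mem_filt (by simpa using hA) m)
  exact this hn

/-- The recursion applies `T (v i)` to a remainder `T y w - lead c y w`. Stability of the stages
requires that this remainder has not gained degree, so the degree bound is carried through the same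
induction. -/
lemma stage_mem_and_eq (d : ℕ) :
    (∀ e ≤ d, ∀ n ∈ filt k I M e, ∀ x : g,
      stage c v ρ d x n - lead c x n ∈ filt k I M e) ∧
    (∀ n ∈ filt k I M d, ∀ x : g, stage c v ρ (d + 1) x n = stage c v ρ d x n) := by
  induction d with
  | zero =>
    have h0 : ∀ n ∈ filt k I M 0, n = 0 := by
      intro n hn
      have : n ∈ Finsupp.supported M k (∅ : Set (Multiset I)) := by
        simpa [filt] using hn
      simpa using this
    refine ⟨fun e he n hn x => ?_, fun n hn x => ?_⟩
    · obtain rfl : e = 0 := by omega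
      simp [h0 n hn]
    · simp [h0 n hn]
  | succ d ih =>
    obtain ⟨ihB, ihS⟩ := ih
    refine ⟨fun e he n hn x => ?_, fun n hn x => ?_⟩
    · have : filt k I M e ≤ (filt k I M e).comap (stage c v ρ (d + 1) x - lead c x) :=
        filt_le fun A hA m => by
          rw [Submodule.mem_comap, LinearMap.sub_apply]
          change step c v ρ (stage c v ρ d) x _ - _ ∈ _
          rw [step_single, add_sub_cancel_left]
          by_cases h0 : A = 0
          · subst h0; rw [corr_zero]; exact single_mem_filt hA _
          · obtain ⟨i, K, rfl, h⟩ := exists_cons h0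
            rw [Multiset.card_cons] at hA
            rw [corr_cons _ _ _ _ _ _ h]
            have hK : Finsupp.single K m ∈ filt k I M (K.card + 1) := single_mem_filt (by omega) m
            -- Acting raises the degree by at most one, and `K` has one element less than the given
            -- monomial.
            have key : ∀ (w : Multiset I →₀ M) (_ : w ∈ filt k I M (K.card + 1)) (y : g),
                stage c v ρ d y w ∈ filt k I M e := fun w hw y => by
              have h1 := ihB (K.card + 1) (by omega) w hw y
              have h2 := Submodule.add_mem _ (filt_mono (by omega : K.card + 1 ≤ K.card + 1 + 1) h1)
                (lead_mem c y hw)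
              rw [sub_add_cancel] at h2
              exact filt_mono (by omega) h2
            exact Submodule.add_mem _ (key _ (ihB _ (by omega) _ hK _) _) (key _ hK _)
      simpa using this hn
    · have : filt k I M (d + 1) ≤
          LinearMap.ker (stage c v ρ (d + 1 + 1) x - stage c v ρ (d + 1) x) :=
        filt_le fun A hA m => by
          rw [LinearMap.mem_ker, LinearMap.sub_apply, sub_eq_zero]
          change step c v ρ (stage c v ρ (d + 1)) x _ = step c v ρ (stage c v ρ d) x _
          rw [step_single, step_single]
          congr 1
          by_cases h0 : A = 0
          · subst h0; rw [corr_zero, corr_zero]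
          · obtain ⟨i, K, rfl, h⟩ := exists_cons h0
            rw [Multiset.card_cons] at hA
            rw [corr_cons _ _ _ _ _ _ h, corr_cons _ _ _ _ _ _ h]
            have hK : Finsupp.single K m ∈ filt k I M (K.card + 1) := single_mem_filt (by omega) m
            have hle : filt k I M (K.card + 1) ≤ filt k I M d := filt_mono (by omega)
            rw [ihS _ (hle hK), ihS _ (hle hK), ihS _ (hle (ihB _ (by omega) _ hK _))]
      have h1 := this hn
      rwa [LinearMap.mem_ker, LinearMap.sub_apply, sub_eq_zero] at h1

lemma stage_eq {d e : ℕ} (h : d ≤ e) {n : Multiset I →₀ M} (hn : n ∈ filt k I M d) (x : g) :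
    stage c v ρ e x n = stage c v ρ d x n := by
  induction e, h using Nat.le_induction with
  | base => rfl
  | succ e he ih => rw [(stage_mem_and_eq c v ρ e).2 n (filt_mono he hn) x, ih]

/-- The action of `g` on `S(V) ⊗ M`. -/
def act : g →ₗ[k] Module.End k (Multiset I →₀ M) where
  toFun x := Finsupp.lsum k fun A => stage c v ρ (A.card + 1) x ∘ₗ Finsupp.lsingle A
  map_add' x y := by
    refine Finsupp.lhom_ext' fun A => LinearMap.ext fun m => ?_
    simp
  map_smul' t x := by
    refine Finsupp.lhom_ext' fun A => LinearMap.ext fun m => ?_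
    simp

lemma act_eq_stage {d : ℕ} {n : Multiset I →₀ M} (hn : n ∈ filt k I M d) (x : g) :
    act c v ρ x n = stage c v ρ d x n := by
  have : filt k I M d ≤ LinearMap.ker (act c v ρ x - stage c v ρ d x) :=
    filt_le fun A hA m => by
      rw [LinearMap.mem_ker, LinearMap.sub_apply, sub_eq_zero,
        stage_eq c v ρ hA (single_mem_filt (Nat.lt_succ_self _) m)]
      simp [act]
  have h1 := this hn
  rwa [LinearMap.mem_ker, LinearMap.sub_apply, sub_eq_zero] at h1

lemma act_sub_lead_mem {d : ℕ} {n : Multiset I →₀ M} (hn : n ∈ filt k I M d) (x : g) :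
    act c v ρ x n - lead c x n ∈ filt k I M d := by
  rw [act_eq_stage c v ρ hn]
  exact (stage_mem_and_eq c v ρ d).1 d le_rfl n hn x

lemma act_zero (x : g) (m : M) : act c v ρ x (Finsupp.single 0 m) =
    lead c x (Finsupp.single 0 m) + Finsupp.single 0 (ρ x m) := by
  rw [act_eq_stage c v ρ (single_mem_filt (d := 1) (by simp) m)]
  change step c v ρ _ x _ = _
  rw [step_single, corr_zero]

/-- On the right everything is applied to elements of degree at most that of `K`, where a single
stage already computes `act`. -/
lemma act_cons {i : I} {K : Multiset I} (h : ∀ j ∈ K, i ≤ j) (x : g) (m : M) :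
    act c v ρ x (Finsupp.single (i ::ₘ K) m) = lead c x (Finsupp.single (i ::ₘ K) m) +
      (act c v ρ (v i) (act c v ρ (hi c v i x) (Finsupp.single K m) -
        lead c (hi c v i x) (Finsupp.single K m)) +
      act c v ρ ⁅hi c v i x, v i⁆ (Finsupp.single K m)) := by
  have hK : Finsupp.single K m ∈ filt k I M (K.card + 1) := single_mem_filt (by omega) m
  rw [act_eq_stage c v ρ (single_mem_filt (d := K.card + 1 + 1) (by simp) m),
    act_eq_stage c v ρ hK, act_eq_stage c v ρ hK,
    act_eq_stage c v ρ ((stage_mem_and_eq c v ρ _).1 _ le_rfl _ hK _)]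
  change step c v ρ _ x _ = _
  rw [step_single, corr_cons _ _ _ _ _ _ h]

variable {c v ρ}

section Relations

variable (hv : ∀ i, c (v i) = Finsupp.single i 1) (hρv : ∀ i, ρ (v i) = 0)
include hv

lemma c_hi (i j : I) (x : g) (hj : j ≤ i) : c (hi c v i x) j = 0 := by
  simp only [hi, lo, LinearMap.sub_apply, LinearMap.id_apply, LinearMap.comp_apply, map_sub,
    Finsupp.linearCombination_apply, Finsupp.sub_apply, map_finsuppSum, map_smul]
  rw [sub_eq_zero, Finsupp.sum_apply, Finsupp.sum]
  have : ∀ i' ∈ (c x).support, ((c x) i' • c (if i' ≤ i then v i' else 0)) j =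
      if i' = j then c x j else 0 := by
    intro i' _
    split_ifs with h1 h2 h2
    · simp [hv, h2]
    · simp [hv, h2]
    · exact absurd (h2 ▸ hj) h1
    · simp
  rw [Finset.sum_congr rfl this, Finset.sum_ite_eq' (c x).support j]
  simp +contextual [eq_comm]

omit hv in
lemma hi_eq_self {i : I} {x : g} (h : ∀ j ≤ i, c x j = 0) : hi c v i x = x := by
  rw [hi, LinearMap.sub_apply, LinearMap.id_apply, sub_eq_self]
  simp only [lo, LinearMap.comp_apply, Finsupp.linearCombination_apply]
  refine Finset.sum_eq_zero fun j _ => ?_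
  dsimp only
  split_ifs with hj
  · simp [h j hj]
  · simp

omit [LinearOrder I] in
lemma lead_v (i : I) (A : Multiset I) (m : M) :
    lead c (v i) (Finsupp.single A m) = Finsupp.single (i ::ₘ A) m := by
  simp [lead_single, hv]

lemma hi_v {i j : I} (h : i ≤ j) : hi c v j (v i) = 0 := by
  simp [hi, lo, hv, h]

include hρv

/-- If `j` is the least element of `J`, then `hi c v j (v i)` vanishes because `i ≤ j`, so the
correction disappears. -/
lemma act_v_of_le {i : I} {J : Multiset I} (h : ∀ j ∈ J, i ≤ j) (m : M) :
    act c v ρ (v i) (Finsupp.single J m) = Finsupp.single (i ::ₘ J) m := by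
  by_cases h0 : J = 0
  · subst h0; rw [act_zero, lead_v hv, hρv]; simp
  · obtain ⟨j, K, rfl, h1⟩ := exists_cons h0
    rw [act_cons c v ρ h1, lead_v hv, hi_v hv (h j (Multiset.mem_cons_self j K))]
    simp

/-- The elements `y` whose action commutes with that of `x` on `n` up to `⁅y, x⁆`. -/
def commSub (c : g →ₗ[k] I →₀ k) (v : I → g) (ρ : g →ₗ[k] Module.End k M) (x : g)
    (n : Multiset I →₀ M) : Submodule k g where
  carrier := {y | act c v ρ y (act c v ρ x n) = act c v ρ x (act c v ρ y n) + act c v ρ ⁅y, x⁆ n}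
  add_mem' := fun {y z} hy hz => by
    simp only [Set.mem_ofPred_eq, map_add, LinearMap.add_apply, add_lie] at *
    rw [hy, hz]; abel
  zero_mem' := by simp
  smul_mem' := fun t y hy => by
    simp only [Set.mem_ofPred_eq, map_smul, LinearMap.smul_apply, smul_lie] at *
    rw [hy, smul_add]

omit hv hρv in
lemma mem_commSub {x y : g} {n : Multiset I →₀ M} : y ∈ commSub c v ρ x n ↔
    act c v ρ y (act c v ρ x n) = act c v ρ x (act c v ρ y n) + act c v ρ ⁅y, x⁆ n := Iff.rfl

omit hv hρv in
lemma commSub_symm {x y : g} {n : Multiset I →₀ M} (h : y ∈ commSub c v ρ x n) :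
    x ∈ commSub c v ρ y n := by
  rw [mem_commSub] at *
  rw [h, ← lie_skew y x, map_neg]; simp

/-- This is the recursive definition read backwards: here `hi c v i y = y`, and `v i` times the
leading part of `y` on `J` is the leading part on `i ::ₘ J`. -/
lemma mem_commSub_of_le_of_hi {i : I} {J : Multiset I} (h : ∀ j ∈ J, i ≤ j) {y : g}
    (hy : ∀ j ≤ i, c y j = 0) (m : M) : y ∈ commSub c v ρ (v i) (Finsupp.single J m) := by
  have hlead : act c v ρ (v i) (lead c y (Finsupp.single J m)) =
      lead c y (Finsupp.single (i ::ₘ J) m) := by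
    rw [lead_single, lead_single, map_finsuppSum]
    refine Finset.sum_congr rfl fun j hj => ?_
    have hij : i ≤ j := by
      by_contra hc
      exact (Finsupp.mem_support_iff.1 hj) (hy j (not_le.1 hc).le)
    dsimp only
    rw [map_smul, act_v_of_le hv hρv (fun l hl => ?_), Multiset.cons_swap]
    rcases Multiset.mem_cons.1 hl with rfl | hl
    · exact hij
    · exact h l hl
  rw [mem_commSub, act_v_of_le hv hρv h, act_cons c v ρ h, hi_eq_self hy, map_sub, hlead]
  abel

omit hv hρv in
lemma lo_mem {S : Submodule k g} {i : I} (h : ∀ j ≤ i, v j ∈ S) (x : g) : lo c v i x ∈ S := by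
  simp only [lo, LinearMap.comp_apply, Finsupp.linearCombination_apply]
  refine S.sum_mem fun j _ => S.smul_mem _ ?_
  split_ifs with hj
  · exact h j hj
  · exact S.zero_mem

/-- The `hi` component of `y` is the previous case. For `v j` with `j < i` the same case applies
with `v i` and `v j` exchanged, since `j` is then below all of `J`; for `j = i` the bracket is zero.
-/
lemma mem_commSub_of_le {i : I} {J : Multiset I} (h : ∀ j ∈ J, i ≤ j) (y : g) (m : M) :
    y ∈ commSub c v ρ (v i) (Finsupp.single J m) := by
  rw [← lo_add_hi c v i y]
  refine Submodule.add_mem _ (lo_mem (fun j hj => ?_) y)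
    (mem_commSub_of_le_of_hi hv hρv h (fun j hj => c_hi hv i j y hj) m)
  rcases hj.eq_or_lt with rfl | hlt
  · simp [mem_commSub]
  · refine commSub_symm (mem_commSub_of_le_of_hi hv hρv (fun l hl => hlt.le.trans (h l hl)) ?_ m)
    intro l hl
    rw [hv, Finsupp.single_eq_of_ne (hl.trans_lt hlt).ne]

omit hv hρv in
lemma commSub_add {x y : g} {n n' : Multiset I →₀ M} (h : y ∈ commSub c v ρ x n)
    (h' : y ∈ commSub c v ρ x n') : y ∈ commSub c v ρ x (n + n') := by
  rw [mem_commSub] at *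
  rw [map_add, map_add, h, h', map_add, map_add, map_add]
  abel

omit hv hρv in
lemma commSub_smul {x y : g} {n : Multiset I →₀ M} (t : k) (h : y ∈ commSub c v ρ x n) :
    y ∈ commSub c v ρ x (t • n) := by
  rw [mem_commSub] at *
  rw [map_smul, map_smul, h, map_smul, map_smul, map_smul, smul_add]

/-- All monomials that occur are `j ::ₘ K` with `j > i`, so `i` is still a lower bound. This handles
the top degree part which the induction on degree does not reach. -/
lemma mem_commSub_lead {i : I} {K : Multiset I} (h : ∀ j ∈ K, i ≤ j) {x : g}
    (hx : ∀ j ≤ i, c x j = 0) (y : g) (m : M) :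
    y ∈ commSub c v ρ (v i) (lead c x (Finsupp.single K m)) := by
  rw [lead_single, Finsupp.sum]
  refine Finset.sum_induction _ (fun n => y ∈ commSub c v ρ (v i) n)
    (fun _ _ => commSub_add) (by simp [mem_commSub]) fun j hj => commSub_smul _ ?_
  have hij : i ≤ j := by
    by_contra hc
    exact (Finsupp.mem_support_iff.1 hj) (hx j (not_le.1 hc).le)
  refine mem_commSub_of_le hv hρv (fun l hl => ?_) y m
  rcases Multiset.mem_cons.1 hl with rfl | hl
  · exact hij
  · exact h l hl

variable (hrep : ∀ x y, c x = 0 → c y = 0 → c ⁅x, y⁆ = 0 ∧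
  ∀ m, ρ ⁅x, y⁆ m = ρ x (ρ y m) - ρ y (ρ x m))
include hrep

/-- As `g` is the span of the `v i` plus the kernel of `c`, the only new case has both elements in
the kernel. There the action in degree zero is `ρ`, and `hrep` applies. -/
lemma mem_commSub_zero (x y : g) (m : M) : y ∈ commSub c v ρ x (Finsupp.single 0 m) := by
  have hspl : ∀ (x : g) (S : Submodule k g), (∀ i, v i ∈ S) → (∀ z, c z = 0 → z ∈ S) → x ∈ S := by
    intro x S h1 h2
    have h3 : Finsupp.linearCombination k v (c x) ∈ S :=
      S.sum_mem fun i _ => S.smul_mem _ (h1 i)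
    have h4 : c (x - Finsupp.linearCombination k v (c x)) = 0 := by
      rw [map_sub, Finsupp.linearCombination_apply, map_finsuppSum]
      simp [hv]
    have := S.add_mem (h2 _ h4) h3
    rwa [sub_add_cancel] at this
  refine hspl y _ (fun i => commSub_symm (mem_commSub_of_le hv hρv (by simp) x m)) fun y hy => ?_
  refine commSub_symm (hspl x _ (fun i => commSub_symm (mem_commSub_of_le hv hρv (by simp) y m))
    fun x hx => ?_)
  obtain ⟨h1, h2⟩ := hrep x y hx hy
  have h0 : ∀ z, c z = 0 → ∀ m : M, act c v ρ z (Finsupp.single 0 m) =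
      Finsupp.single 0 (ρ z m) := by
    intro z hz m
    rw [act_zero, lead_single, hz]; simp
  rw [mem_commSub, h0 _ hy, h0 _ hx, h0 _ hx, h0 _ hy, h0 _ h1, h2, Finsupp.single_sub]
  abel

/-- On `i ::ₘ K` the components along `v j`, `j ≤ i`, are covered by `mem_commSub_of_le`. For two
elements with coordinates above `i`, `key` moves `v i` to the front; after antisymmetrizing, the
mixed terms cancel and the Jacobi identity gives the rest. -/
lemma mem_commSub_all (d : ℕ) : ∀ n ∈ filt k I M d, ∀ x y : g, y ∈ commSub c v ρ x n := by
  induction d with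
  | zero =>
    intro n hn x y
    have : n ∈ Finsupp.supported M k (∅ : Set (Multiset I)) := by simpa [filt] using hn
    have h0 : n = 0 := by simpa using this
    simp [mem_commSub, h0]
  | succ d ih =>
    intro n hn x y
    have hext : ∀ (e : ℕ) (x y : g), (∀ A : Multiset I, A.card < e → ∀ m : M,
        y ∈ commSub c v ρ x (Finsupp.single A m)) → ∀ n ∈ filt k I M e, y ∈ commSub c v ρ x n := by
      intro e x y h n hn
      have : filt k I M e ≤ LinearMap.ker (act c v ρ y ∘ₗ act c v ρ x -
          act c v ρ x ∘ₗ act c v ρ y - act c v ρ ⁅y, x⁆) := filt_le fun A hA m => by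
        have := h A hA m
        rw [mem_commSub] at this
        simp [this]
      have h1 := this hn
      rw [LinearMap.mem_ker, LinearMap.sub_apply, LinearMap.sub_apply, sub_sub, sub_eq_zero] at h1
      exact h1
    refine hext (d + 1) x y (fun A hA m => ?_) n hn
    by_cases h0 : A = 0
    · subst h0; exact mem_commSub_zero hv hρv hrep x y m
    obtain ⟨i, K, rfl, h⟩ := exists_cons h0
    rw [Multiset.card_cons] at hA
    have hJ : ∀ j ∈ i ::ₘ K, i ≤ j := fun j hj => by
      rcases Multiset.mem_cons.1 hj with rfl | hj
      · exact le_rfl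
      · exact h j hj
    have hlow : ∀ j ≤ i, ∀ z, v j ∈ commSub c v ρ z (Finsupp.single (i ::ₘ K) m) :=
      fun j hj z => commSub_symm
        (mem_commSub_of_le hv hρv (fun l hl => hj.trans (hJ l hl)) z m)
    have key : ∀ x y, (∀ j ≤ i, c x j = 0) → (∀ j ≤ i, c y j = 0) →
        act c v ρ y (act c v ρ x (Finsupp.single (i ::ₘ K) m)) =
          act c v ρ (v i) (act c v ρ y (act c v ρ x (Finsupp.single K m))) +
          act c v ρ ⁅y, v i⁆ (act c v ρ x (Finsupp.single K m)) +
          (act c v ρ ⁅x, v i⁆ (act c v ρ y (Finsupp.single K m)) +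
           act c v ρ ⁅y, ⁅x, v i⁆⁆ (Finsupp.single K m)) := by
      intro x y hx hy
      have hK : Finsupp.single K m ∈ filt k I M (K.card + 1) := single_mem_filt (by omega) m
      have hK' : Finsupp.single K m ∈ filt k I M d := single_mem_filt (by omega) m
      have e1 := mem_commSub.1 (ih _ hK' (v i) x)
      have e2 := mem_commSub.1 (ih _ hK' ⁅x, v i⁆ y)
      -- The element `x K` may have degree `d`, which is beyond the induction hypothesis. Its
      -- remainder `x K - lead c x K` has the degree of `K` and is covered; the leading part is
      -- covered by `mem_commSub_lead`.
      have e3 : act c v ρ y (act c v ρ (v i) (act c v ρ x (Finsupp.single K m))) =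
          act c v ρ (v i) (act c v ρ y (act c v ρ x (Finsupp.single K m))) +
          act c v ρ ⁅y, v i⁆ (act c v ρ x (Finsupp.single K m)) := by
        have h1 := ih _ (filt_mono (by omega : K.card + 1 ≤ d) (act_sub_lead_mem c v ρ hK x))
          (v i) y
        have h2 := mem_commSub_lead hv hρv h hx y m
        have h3 := mem_commSub.1 (commSub_add h1 h2)
        rwa [sub_add_cancel] at h3
      rw [← act_v_of_le hv hρv h, e1, map_add, e2, e3]
    have hhi : ∀ x y, (∀ j ≤ i, c x j = 0) → (∀ j ≤ i, c y j = 0) →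
        y ∈ commSub c v ρ x (Finsupp.single (i ::ₘ K) m) := by
      intro x y hx hy
      have hK' : Finsupp.single K m ∈ filt k I M d := single_mem_filt (by omega) m
      have e1 := mem_commSub.1 (ih _ hK' x y)
      have e2 := mem_commSub.1 (ih _ hK' (v i) ⁅y, x⁆)
      rw [mem_commSub, key x y hx hy, key y x hy hx, ← act_v_of_le hv hρv h, e2, e1]
      have e3 : ⁅y, ⁅x, v i⁆⁆ = ⁅x, ⁅y, v i⁆⁆ + ⁅⁅y, x⁆, v i⁆ := by
        rw [leibniz_lie y x (v i)]; abel
      rw [e3]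
      simp only [map_add, LinearMap.add_apply]
      abel
    rw [← lo_add_hi c v i y]
    refine Submodule.add_mem _ (lo_mem (fun j hj => hlow j hj x) y) (commSub_symm ?_)
    rw [← lo_add_hi c v i x]
    exact Submodule.add_mem _ (lo_mem (fun j hj => hlow j hj _) x)
      (hhi _ _ (fun j hj => c_hi hv i j y hj) (fun j hj => c_hi hv i j x hj))

lemma act_lie (x y : g) (n : Multiset I →₀ M) :
    act c v ρ ⁅x, y⁆ n = act c v ρ x (act c v ρ y n) - act c v ρ y (act c v ρ x n) := by
  have hn : n ∈ filt k I M (n.support.sup Multiset.card + 1) := fun A hA =>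
    Nat.lt_succ_of_le (Finset.le_sup (f := Multiset.card) hA)
  have := mem_commSub.1 (mem_commSub_all hv hρv hrep _ n hn y x)
  rw [this]; abel

end Relations

end CatO.PBW

namespace CatO

/-- Every module over a subalgebra `p` of `g` embeds `p`-equivariantly into a `g`-module. -/
theorem exists_module_extension {k : Type u} [Field k] {g : Type u} [LieRing g] [LieAlgebra k g]
    (p : LieSubalgebra k g) {M : Type u} [AddCommGroup M] [Module k M]
    (ρ : g →ₗ[k] Module.End k M)
    (hρ : ∀ x ∈ p, ∀ y ∈ p, ∀ m, ρ ⁅x, y⁆ m = ρ x (ρ y m) - ρ y (ρ x m)) :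
    ∃ (N : Type u) (_ : AddCommGroup N) (_ : Module k N) (T : g →ₗ[k] Module.End k N)
      (i : M →ₗ[k] N), (∀ x y n, T ⁅x, y⁆ n = T x (T y n) - T y (T x n)) ∧
        Function.Injective i ∧ ∀ x ∈ p, ∀ m, T x (i m) = i (ρ x m) := by
  classical
  -- The module is `S(q) ⊗ M` for a vector space complement `q` of `p`: multisets are the monomials
  -- in a basis of `q`, which may be ordered arbitrarily.
  obtain ⟨q, hq⟩ := p.toSubmodule.exists_isCompl
  let b := Module.Basis.ofVectorSpace k q
  let I := Module.Basis.ofVectorSpaceIndex k q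
  let _ : LinearOrder I := linearOrderOfSTO WellOrderingRel
  let c : g →ₗ[k] I →₀ k := b.repr.toLinearMap ∘ₗ q.projectionOnto _ hq.symm
  let v : I → g := fun i => b i
  -- Only the values of `ρ` on `p` are meaningful; on the complement the action is reset to zero, as
  -- `PBW.act_lie` requires.
  let ρ' : g →ₗ[k] Module.End k M := ρ ∘ₗ p.toSubmodule.subtype ∘ₗ p.toSubmodule.projectionOnto q hq
  have hc : ∀ x, c x = 0 ↔ x ∈ p := by
    intro x
    simp [c]
  have hv : ∀ i, c (v i) = Finsupp.single i 1 := by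
    intro i
    simp [c, v]
  have hρv : ∀ i, ρ' (v i) = 0 := by
    intro i
    simp [ρ', v]
  have hρp : ∀ x ∈ p, ρ' x = ρ x := by
    intro x hx
    have := Submodule.projectionOnto_apply_left hq ⟨x, hx⟩
    simp only [ρ', LinearMap.comp_apply]
    rw [show x = ((⟨x, hx⟩ : p.toSubmodule) : g) from rfl, this]
    rfl
  refine ⟨Multiset I →₀ M, inferInstance, inferInstance, PBW.act c v ρ', Finsupp.lsingle 0,
    PBW.act_lie hv hρv fun x y hx hy => ?_, Finsupp.single_injective 0, fun x hx m => ?_⟩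
  · rw [hc] at hx hy ⊢
    refine ⟨p.lie_mem hx hy, fun m => ?_⟩
    rw [hρp _ hx, hρp _ hy, hρp _ (p.lie_mem hx hy), hρ x hx y hy]
  · rw [Finsupp.lsingle_apply, PBW.act_zero, PBW.lead_single, (hc x).2 hx, hρp x hx]
    simp

end CatO

/-! ## Root systems and reductive Lie algebras -/

namespace RootPairing

variable {ι R M N : Type*} [Finite ι] [CommRing R] [CharZero R] [IsDomain R]
  [AddCommGroup M] [Module R M] [AddCommGroup N] [Module R N]
  (P : RootPairing ι R M N) [P.IsCrystallographic] [P.IsReduced]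

/-- A set of roots which is closed under adding the root `i` contains the reflection in `i` of
each of its members that pairs nonpositively with `i`. -/
lemma reflectionPerm_mem_of_closed {S : Set ι} {i j : ι}
    (hS : ∀ j ∈ S, ∀ l, P.root l = P.root i + P.root j → l ∈ S) (hj : j ∈ S)
    (hne : i ≠ j) (hne' : P.root i ≠ -P.root j) (hneg : P.pairingIn ℤ j i ≤ 0) :
    P.reflectionPerm i j ∈ S := by
  have hli : LinearIndependent R ![P.root i, P.root j] :=
    RootPairing.IsReduced.linearIndependent P hne hne'
  obtain ⟨n, hn⟩ := Int.eq_ofNat_of_zero_le (neg_nonneg.2 hneg)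
  have hroot : P.root (P.reflectionPerm i j) = P.root j + n • P.root i := by
    rw [P.root_reflectionPerm, P.reflection_apply_root' ℤ, sub_eq_add_neg, ← neg_smul, hn,
      natCast_zsmul]
  have htop : n ≤ P.chainTopCoeff i j :=
    (P.root_add_nsmul_mem_range_iff_le_chainTopCoeff hli).1 (hroot ▸ Set.mem_range_self _)
  -- Root strings are unbroken, so each `j + m i` with `m ≤ n` is a root and the closure condition
  -- climbs step by step from `j` to its reflection.
  have key : ∀ m ≤ n, ∀ l, P.root l = P.root j + m • P.root i → l ∈ S := by
    intro m
    induction m with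
    | zero =>
      intro _ l hl
      have : l = j := P.root.injective (by simpa using hl)
      rwa [this]
    | succ m ih =>
      intro hm l hl
      obtain ⟨l', hl'⟩ := (P.root_add_nsmul_mem_range_iff_le_chainTopCoeff hli (n := m)).2 (by omega)
      refine hS l' (ih (by omega) l' hl') l ?_
      rw [hl, hl', succ_nsmul]; abel
  exact key n le_rfl _ hroot

/-- For a Levi subset `Sl` and the associated nilradical `Su`, the sum of the coroots of `Su` is
orthogonal to `Sl` and positive on `Su`. -/
lemma exists_coweight_of_levi [P.IsRootSystem] (Sl Su : Set ι)
    (hneg : ∀ i ∈ Sl, P.reflectionPerm i i ∈ Sl)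
    (hlu : ∀ i ∈ Sl, ∀ j ∈ Su, ∀ l, P.root l = P.root i + P.root j → l ∈ Su)
    (huu : ∀ i ∈ Su, ∀ j ∈ Su, ∀ l, P.root l = P.root i + P.root j → l ∈ Su)
    (hu : ∀ i ∈ Su, P.reflectionPerm i i ∉ Su) (hdis : Disjoint Sl Su) :
    ∃ n : N, (∀ i ∈ Sl, P.toLinearMap (P.root i) n = 0) ∧
      ∀ i ∈ Su, ∃ c : ℕ, 0 < c ∧ P.toLinearMap (P.root i) n = c := by
  classical
  have := Fintype.ofFinite ι
  have negroot : ∀ i j, P.root i = -P.root j → i = P.reflectionPerm j j := by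
    intro i j h
    apply P.root.injective
    rw [P.root_reflectionPerm, P.reflection_apply_self, h]
  let T : Finset ι := Finset.univ.filter (· ∈ Su)
  have hT : ∀ j, j ∈ T ↔ j ∈ Su := fun j => by simp [T]
  have hsum : ∀ i, P.toLinearMap (P.root i) (∑ j ∈ T, P.coroot j) =
      ((∑ j ∈ T, P.pairingIn ℤ i j : ℤ) : R) := by
    intro i
    rw [map_sum, Int.cast_sum]
    refine Finset.sum_congr rfl fun j _ => ?_
    rw [P.root_coroot_eq_pairing, ← P.algebraMap_pairingIn ℤ]; rfl
  have hflip : ∀ i j, P.pairingIn ℤ i (P.reflectionPerm i j) = -P.pairingIn ℤ i j := by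
    intro i j
    apply (algebraMap ℤ R).injective_int
    rw [map_neg, P.algebraMap_pairingIn, P.algebraMap_pairingIn, P.pairing_reflectionPerm,
      P.pairing_reflectionPerm_self_left]
  refine ⟨∑ j ∈ T, P.coroot j, fun i hi => ?_, fun i hi => ?_⟩
  · rw [hsum]
    have hst : ∀ i ∈ Sl, ∀ j ∈ T, P.pairingIn ℤ j i ≤ 0 → P.reflectionPerm i j ∈ T := by
      intro i hi j hj hle
      rw [hT] at *
      refine P.reflectionPerm_mem_of_closed (hlu i hi) hj ?_ ?_ hle
      · rintro rfl; exact Set.disjoint_left.1 hdis hi hj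
      · intro h
        have h' : P.root j = -P.root i := by rw [h, neg_neg]
        rw [negroot _ _ h'] at hj
        exact Set.disjoint_left.1 hdis (hneg i hi) hj
    -- If `j` pairs positively with `i`, use `-i` instead: it also lies in `Sl` and defines the same
    -- reflection.
    have hst' : ∀ j ∈ T, P.reflectionPerm i j ∈ T := by
      intro j hj
      rcases le_total (P.pairingIn ℤ j i) 0 with h | h
      · exact hst i hi j hj h
      · have h1 := hst _ (hneg i hi) j hj (by
          rw [P.pairingIn_reflectionPerm_self_right]; omega)
        convert h1 using 1
        apply P.root.injective
        rw [P.root_reflectionPerm, P.root_reflectionPerm, P.reflection_apply_root,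
          P.reflection_apply_root, P.pairing_reflectionPerm_self_right, P.root_reflectionPerm,
          P.reflection_apply_self, smul_neg, neg_smul, neg_neg]
    -- Reindexing by the reflection in `i`, which permutes `T`, changes the sign of every term.
    have h1 : ∑ j ∈ T, P.pairingIn ℤ i j = ∑ j ∈ T, -P.pairingIn ℤ i j := by
      refine Finset.sum_nbij' (P.reflectionPerm i) (P.reflectionPerm i) hst' hst' ?_ ?_ ?_
      · simp
      · simp
      · intro j _; rw [hflip, neg_neg]
    rw [Finset.sum_neg_distrib] at h1
    have h2 : ∑ j ∈ T, P.pairingIn ℤ i j = 0 := by omega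
    rw [h2, Int.cast_zero]
  · have hpos : 0 < ∑ j ∈ T, P.pairingIn ℤ i j := by
      let A := T.filter fun j => P.pairingIn ℤ i j < 0
      let A' := A.image (P.reflectionPerm i)
      have hA' : ∀ j ∈ A', j ∈ T ∧ 0 < P.pairingIn ℤ i j ∧ j ≠ i := by
        intro j hj
        obtain ⟨l, hl, rfl⟩ := Finset.mem_image.1 hj
        obtain ⟨hlT, hl0⟩ := Finset.mem_filter.1 hl
        refine ⟨?_, by rw [hflip]; omega, ?_⟩
        · rw [hT] at *
          refine P.reflectionPerm_mem_of_closed (huu i hi) hlT ?_ ?_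
            ((P.pairingIn_lt_zero_iff ℤ).1 hl0).le
          · rintro rfl
            rw [P.pairingIn_same] at hl0; omega
          · intro h
            have h' : P.root l = -P.root i := by rw [h, neg_neg]
            rw [negroot _ _ h'] at hlT
            exact hu i hi hlT
        · intro h
          have : l = P.reflectionPerm i i := by rw [← P.reflectionPerm_self i l, h]
          rw [hT] at hlT
          exact hu i hi (this ▸ hlT)
      have hsub : insert i A' ⊆ T.filter fun j => ¬ P.pairingIn ℤ i j < 0 := by
        intro j hj
        rcases Finset.mem_insert.1 hj with rfl | hj
        · exact Finset.mem_filter.2 ⟨(hT _).2 hi, by rw [P.pairingIn_same]; omega⟩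
        · exact Finset.mem_filter.2 ⟨(hA' j hj).1, by have := (hA' j hj).2.1; omega⟩
      have h1 := Finset.sum_le_sum_of_subset_of_nonneg (f := fun j => P.pairingIn ℤ i j) hsub
        fun j hj _ => not_lt.1 (Finset.mem_filter.1 hj).2
      have h2 : ∑ j ∈ A', P.pairingIn ℤ i j = -∑ j ∈ A, P.pairingIn ℤ i j := by
        rw [Finset.sum_image fun a _ b _ h => (P.reflectionPerm i).injective h,
          ← Finset.sum_neg_distrib]
        exact Finset.sum_congr rfl fun j _ => hflip i j
      rw [Finset.sum_insert fun h => (hA' i h).2.2 rfl, h2, P.pairingIn_same] at h1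
      have h3 := Finset.sum_filter_add_sum_filter_not T (fun j => P.pairingIn ℤ i j < 0)
        (fun j => P.pairingIn ℤ i j)
      change ∑ j ∈ A, _ + _ = _ at h3
      omega
    refine ⟨(∑ j ∈ T, P.pairingIn ℤ i j).toNat, by omega, ?_⟩
    rw [hsum, ← Int.cast_natCast, Int.toNat_of_nonneg hpos.le]

end RootPairing

namespace LieAlgebra.IsKilling

open LieModule Module

variable {K L : Type*} [Field K] [CharZero K] [LieRing L] [LieAlgebra K L]
  [IsKilling K L] [FiniteDimensional K L]
  {H : LieSubalgebra K L} [H.IsCartanSubalgebra] [IsTriangularizable K H L]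

/-- The bracket of two root spaces is nonzero if the sum of the roots is a root. -/
lemma lie_ne_zero_of_rootSpace_add_ne_bot {α β : Weight K H L} (hα : α.IsNonZero)
    (hβ : β.IsNonZero) (hαβ : rootSpace H (α + β : H → K) ≠ ⊥) {x y : L}
    (hx : x ∈ rootSpace H α) (hy : y ∈ rootSpace H β) (hx0 : x ≠ 0) (hy0 : y ≠ 0) :
    ⁅x, y⁆ ≠ 0 := by
  -- A vector at the top of the `α`-string through `β` is primitive for the `sl₂`-triple of `α`.
  -- Lowering it `chainTopCoeff α β = t + 1` times reaches weight `β`, and raising the result once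
  -- multiplies the preceding vector by `(t + 1) (chainLength α β - t)`, which is nonzero. Root
  -- spaces are lines, so this decides the bracket of `x` and `y`.
  obtain ⟨z, hz, z_ne0⟩ := (chainTop α β).exists_ne_zero
  obtain ⟨h, e, f, isSl2, he, hf⟩ := exists_isSl2Triple_of_weight_isNonZero hα
  obtain rfl := isSl2.h_eq_coroot hα he hf
  have prim : isSl2.HasPrimitiveVectorWith z (chainLength α β : K) :=
    have := lie_mem_genWeightSpace_of_mem_genWeightSpace he hz
    ⟨z_ne0, (chainLength_smul _ _ hz).symm, by rwa [genWeightSpace_add_chainTop _ _ hα] at this⟩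
  have htop : 1 ≤ chainTopCoeff α β := by
    have := ((rootSpace_zsmul_add_ne_bot_iff α β hα 1).1 (by rwa [one_smul])).1
    exact_mod_cast this
  obtain ⟨t, ht⟩ := Nat.exists_eq_add_of_le' htop
  have hlen : t + 1 ≤ chainLength α β := ht ▸ chainTopCoeff_le_chainLength α β
  have hw : ((toEnd K L L f) ^ (t + 1)) z ∈ rootSpace H β := by
    have := toEnd_pow_apply_mem hf hz (t + 1)
    rwa [coe_chainTop', ht, smul_neg, neg_add_cancel_left] at this
  have hline : ∀ (γ : Weight K H L) (_ : γ.IsNonZero) (a b : L) (_ : a ∈ rootSpace H γ)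
      (_ : b ∈ rootSpace H γ) (_ : a ≠ 0), ∃ c : K, c • a = b := by
    intro γ hγ a b ha hb ha0
    obtain ⟨c, hc⟩ := (finrank_eq_one_iff_of_nonzero' (⟨a, ha⟩ : rootSpace H γ)
      (by simpa using ha0)).1 (finrank_rootSpace_eq_one γ hγ) ⟨b, hb⟩
    exact ⟨c, congrArg Subtype.val hc⟩
  obtain ⟨c, hc⟩ := hline β hβ y _ hy hw hy0
  obtain ⟨d, hd⟩ := hline α hα x e hx he hx0
  intro h0
  have h1 : ⁅e, ((toEnd K L L f) ^ (t + 1)) z⁆ = 0 := by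
    rw [← hc, ← hd, smul_lie, lie_smul, h0, smul_zero, smul_zero]
  rw [prim.lie_e_pow_succ_toEnd_f, smul_eq_zero] at h1
  rcases h1 with h1 | h1
  · rw [mul_eq_zero, sub_eq_zero] at h1
    rcases h1 with h1 | h1
    · exact Nat.cast_add_one_ne_zero t h1
    · have : chainLength α β = t := by exact_mod_cast h1
      omega
  · exact prim.pow_toEnd_f_ne_zero_of_eq_nat rfl (by omega) h1

end LieAlgebra.IsKilling

namespace CatO

open LieAlgebra LieModule

/-! ### Reductive Lie algebras: reduction to a semisimple ideal complementary to the center -/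

section Reductive

variable {K L : Type*} [Field K] [LieRing L] [LieAlgebra K L]

/-- The simultaneous eigenspace of `H` on `L` with eigenvalue `α`. -/
def eigen (H : LieSubalgebra K L) (α : Module.Dual K H) : Submodule K L where
  carrier := {x | ∀ h : H, ⁅(h : L), x⁆ = α h • x}
  add_mem' := fun {a b} ha hb h => by rw [lie_add, smul_add, ha h, hb h]
  zero_mem' := fun h => by rw [lie_zero, smul_zero]
  smul_mem' := fun c m hm h => by rw [lie_smul, hm h, smul_comm]

/-- Every ideal has a complementary ideal. -/
def AdSemisimple (K L : Type*) [Field K] [LieRing L] [LieAlgebra K L] : Prop :=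
  ∀ I : LieIdeal K L, ∃ J : LieIdeal K L, IsCompl I J

lemma lie_center_eq_zero {z : L} (hz : z ∈ center K L) (x : L) : ⁅x, z⁆ = 0 :=
  (LieModule.mem_maxTrivSubmodule K L L z).1 hz x

lemma center_lie_eq_zero {z : L} (hz : z ∈ center K L) (x : L) : ⁅z, x⁆ = 0 := by
  rw [← lie_skew, lie_center_eq_zero hz, neg_zero]

lemma mem_cartan_of_lie_mem {H : LieSubalgebra K L} [hH : H.IsCartanSubalgebra] {x : L}
    (hx : ∀ y ∈ H, ⁅y, x⁆ ∈ H) : x ∈ H := by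
  have : x ∈ H.normalizer := (LieSubalgebra.mem_normalizer_iff' H x).2 hx
  rwa [hH.self_normalizing] at this

/-- A complement of the center in a reductive Lie algebra is semisimple. -/
lemma hasTrivialRadical_of_isCompl_center [FiniteDimensional K L] (hss : AdSemisimple K L)
    {I : LieIdeal K L} (hI : IsCompl (center K L) I) : HasTrivialRadical K I := by
  rw [hasTrivialRadical_iff_no_abelian_ideals]
  intro A hA
  have hdec : ∀ x : L, ∃ z ∈ center K L, ∃ y ∈ I, z + y = x := by
    intro x
    have : x ∈ center K L ⊔ I := by rw [hI.sup_eq_top]; trivial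
    obtain ⟨z, hz, y, hy, h⟩ := (LieSubmodule.mem_sup _ _ _).1 this
    exact ⟨z, hz, y, hy, h⟩
  -- An ideal of `I` is an ideal of `L`, since the center acts on it by zero.
  let A' : LieIdeal K L :=
    { toSubmodule := A.toSubmodule.map (I.incl : I →ₗ[K] L)
      lie_mem := by
        rintro x _ ⟨a, ha, rfl⟩
        obtain ⟨z, hz, y, hy, rfl⟩ := hdec x
        refine ⟨⁅(⟨y, hy⟩ : I), a⁆, A.lie_mem ha, ?_⟩
        have hz0 : ⁅z, (a : L)⁆ = 0 := center_lie_eq_zero hz _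
        change ⁅y, (a : L)⁆ = ⁅z + y, (a : L)⁆
        rw [add_lie, hz0, zero_add] }
  obtain ⟨J, hJ⟩ := hss A'
  rw [eq_bot_iff]
  intro a ha
  -- The abelian ideal commutes with itself, and with a complementary ideal `J` because such
  -- brackets lie in `A' ⊓ J`. So it is central, and the center meets `I` trivially.
  have hcen : (a : L) ∈ center K L := by
    rw [center, LieModule.mem_maxTrivSubmodule]
    intro l
    have : l ∈ A' ⊔ J := by rw [hJ.sup_eq_top]; trivial
    obtain ⟨a1, ⟨b, hb, rfl⟩, j, hj, rfl⟩ := (LieSubmodule.mem_sup _ _ _).1 this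
    have h1 : ⁅b, a⁆ = 0 := by
      have := trivial_lie_zero A A ⟨b, hb⟩ ⟨a, ha⟩
      exact congrArg Subtype.val this
    have h2 : ⁅j, (a : L)⁆ = 0 := by
      have h3 : ⁅j, (a : L)⁆ ∈ A' ⊓ J := by
        refine (LieSubmodule.mem_inf _ _ _).2 ⟨A'.lie_mem ⟨a, ha, rfl⟩, ?_⟩
        rw [← lie_skew]; exact J.neg_mem (J.lie_mem hj)
      rwa [hJ.inf_eq_bot, LieSubmodule.mem_bot] at h3
    rw [add_lie, h2, add_zero]
    exact congrArg Subtype.val h1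
  have h4 : (a : L) ∈ center K L ⊓ I := (LieSubmodule.mem_inf _ _ _).2 ⟨hcen, a.2⟩
  rw [hI.inf_eq_bot, LieSubmodule.mem_bot] at h4
  rw [LieSubmodule.mem_bot]
  exact Subtype.ext h4

variable {H : LieSubalgebra K L}

lemma center_le_cartan [H.IsCartanSubalgebra] {z : L} (hz : z ∈ center K L) : z ∈ H := by
  refine mem_cartan_of_lie_mem fun y _ => ?_
  rw [lie_center_eq_zero hz]
  exact H.zero_mem

/-- The trace of `H` on an ideal. -/
def cartanOf (H : LieSubalgebra K L) (I : LieIdeal K L) : LieSubalgebra K I := H.comap I.incl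

/-- `H` is the sum of the center and `H ∩ I`, so an element normalizing `H ∩ I` normalizes `H`. -/
lemma isCartan_cartanOf [H.IsCartanSubalgebra] {I : LieIdeal K L} (hI : IsCompl (center K L) I) :
    (cartanOf H I).IsCartanSubalgebra where
  nilpotent := by
    let f : cartanOf H I →ₗ⁅K⁆ H :=
      { toFun := fun x => ⟨((x : I) : L), x.2⟩
        map_add' := fun _ _ => rfl
        map_smul' := fun _ _ => rfl
        map_lie' := rfl }
    have hf : Function.Injective f := fun x y h => by
      have : ((x : I) : L) = ((y : I) : L) := congrArg (fun t : H => (t : L)) h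
      exact Subtype.ext (Subtype.ext this)
    exact hf.lieAlgebra_isNilpotent
  self_normalizing := by
    refine le_antisymm ?_ (LieSubalgebra.le_normalizer _)
    intro x hx
    rw [LieSubalgebra.mem_normalizer_iff'] at hx
    change (x : L) ∈ H
    refine mem_cartan_of_lie_mem fun y hy => ?_
    have : y ∈ center K L ⊔ I := by rw [hI.sup_eq_top]; trivial
    obtain ⟨z, hz, w, hw, rfl⟩ := (LieSubmodule.mem_sup _ _ _).1 this
    rw [add_lie, center_lie_eq_zero hz, zero_add]
    have hwH : w ∈ H := by simpa using H.sub_mem hy (center_le_cartan hz)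
    exact hx ⟨w, hw⟩ hwH

lemma mem_of_mem_eigen_zero [H.IsCartanSubalgebra] {x : L} (hx : x ∈ eigen H 0) : x ∈ H := by
  refine mem_cartan_of_lie_mem fun y hy => ?_
  have : ⁅y, x⁆ = (0 : K) • x := hx ⟨y, hy⟩
  rw [this, zero_smul]
  exact H.zero_mem

/-- Restriction of weights to the trace of `H` on an ideal. -/
def restr (H : LieSubalgebra K L) (I : LieIdeal K L) (α : Module.Dual K H) :
    Module.Dual K (cartanOf H I) where
  toFun h := α ⟨((h : I) : L), h.2⟩
  map_add' x y := by rw [← map_add]; rfl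
  map_smul' c x := by rw [RingHom.id_apply, ← map_smul]; rfl

lemma restr_add (I : LieIdeal K L) (α β : Module.Dual K H) :
    restr H I (α + β) = restr H I α + restr H I β := rfl

lemma restr_neg (I : LieIdeal K L) (α : Module.Dual K H) :
    restr H I (-α) = -restr H I α := rfl

variable {I : LieIdeal K L} (hI : IsCompl (center K L) I)
include hI

omit hI in
lemma apply_center_eq_zero {α : Module.Dual K H} {x : L} (hx : x ∈ eigen H α) (hx0 : x ≠ 0)
    {z : H} (hz : (z : L) ∈ center K L) : α z = 0 := by
  have h1 := hx z
  rw [center_lie_eq_zero hz] at h1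
  exact (smul_eq_zero.1 h1.symm).resolve_right hx0

lemma exists_decomp [H.IsCartanSubalgebra] (h : H) : ∃ (z : H) (w : cartanOf H I),
    (z : L) ∈ center K L ∧ h = z + ⟨((w : I) : L), w.2⟩ := by
  have : (h : L) ∈ center K L ⊔ I := by rw [hI.sup_eq_top]; trivial
  obtain ⟨z, hz, w, hw, hzw⟩ := (LieSubmodule.mem_sup _ _ _).1 this
  have hwH : w ∈ H := by
    rw [← add_sub_cancel_left z w, hzw]
    exact H.sub_mem h.2 (center_le_cartan hz)
  exact ⟨⟨z, center_le_cartan hz⟩, ⟨⟨w, hw⟩, hwH⟩, hz, Subtype.ext hzw.symm⟩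

/-- Weights that vanish on the center, as all roots do, are determined on `H ∩ I`, since `H` is the
center plus `H ∩ I`. -/
lemma eq_of_restr_eq [H.IsCartanSubalgebra] {α β : Module.Dual K H}
    (hα : ∀ z : H, (z : L) ∈ center K L → α z = 0)
    (hβ : ∀ z : H, (z : L) ∈ center K L → β z = 0)
    (h : restr H I α = restr H I β) : α = β := by
  ext x
  obtain ⟨z, w, hz, rfl⟩ := exists_decomp (H := H) hI x
  rw [map_add, map_add, hα z hz, hβ z hz]
  exact congrArg (0 + ·) (LinearMap.congr_fun h w)

lemma restr_ne_zero [H.IsCartanSubalgebra] {α : Module.Dual K H} (hα : α ≠ 0) {x : L}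
    (hx : x ∈ eigen H α) (hx0 : x ≠ 0) : restr H I α ≠ 0 := fun h =>
  hα (eq_of_restr_eq hI (fun _ hz => apply_center_eq_zero hx hx0 hz) (fun _ _ => rfl) h)

/-- Some `h` in `H ∩ I` acts on `x` by a nonzero scalar, so `x` is a multiple of `⁅h, x⁆`, which
lies in the ideal. -/
lemma mem_ideal_of_mem_eigen [H.IsCartanSubalgebra] {α : Module.Dual K H} (hα : α ≠ 0) {x : L}
    (hx : x ∈ eigen H α) : x ∈ I := by
  by_cases hx0 : x = 0
  · rw [hx0]; exact I.zero_mem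
  obtain ⟨h, hh⟩ : ∃ h, restr H I α h ≠ 0 := by
    by_contra! hc
    exact restr_ne_zero hI hα hx hx0 (LinearMap.ext hc)
  have h1 : ⁅((h : I) : L), x⁆ = (restr H I α h) • x := hx ⟨((h : I) : L), h.2⟩
  have h2 : ⁅((h : I) : L), x⁆ ∈ I := by
    rw [← lie_skew]; exact I.neg_mem (I.lie_mem (h : I).2)
  rw [h1] at h2
  have := I.smul_mem (restr H I α h)⁻¹ h2
  rwa [smul_smul, inv_mul_cancel₀ hh, one_smul] at this

omit hI in
-- The weight is pulled back along the projection onto `I` whose kernel is the center; it maps `H`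
-- into `H ∩ I`.
lemma exists_restr_eq [H.IsCartanSubalgebra] (hI : IsCompl (center K L) I)
    (γ : Module.Dual K (cartanOf H I)) :
    ∃ α : Module.Dual K H, restr H I α = γ ∧ ∀ z : H, (z : L) ∈ center K L → α z = 0 := by
  have hIs : IsCompl I.toSubmodule (center K L).toSubmodule :=
    (LieSubmodule.isCompl_toSubmodule.2 hI).symm
  let pr : L →ₗ[K] I := Submodule.projectionOnto I.toSubmodule (center K L).toSubmodule hIs
  have hmem : ∀ h : H, pr (h : L) ∈ cartanOf H I := by
    intro h
    obtain ⟨z, w, hz, rfl⟩ := exists_decomp hI h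
    have h1 : pr (z : L) = 0 :=
      (Submodule.projectionOnto_apply_eq_zero_iff hIs).2 hz
    have h2 : pr ((w : I) : L) = (w : I) := Submodule.projectionOnto_apply_left hIs (w : I)
    change pr ((z : L) + ((w : I) : L)) ∈ _
    rw [map_add, h1, h2, zero_add]
    exact w.2
  refine ⟨⟨⟨fun h => γ ⟨pr (h : L), hmem h⟩, fun x y => ?_⟩, fun c x => ?_⟩, ?_, ?_⟩
  · rw [← map_add]; congr 1; exact Subtype.ext (map_add pr _ _)
  · rw [RingHom.id_apply, ← map_smul]
    exact congrArg γ (Subtype.ext (map_smul pr c (x : L)))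
  · ext h
    change γ _ = γ h
    congr 1
    exact Subtype.ext (Submodule.projectionOnto_apply_left hIs (h : I))
  · intro z hz
    have h1 : pr (z : L) = 0 :=
      (Submodule.projectionOnto_apply_eq_zero_iff hIs).2 hz
    change γ _ = 0
    rw [← map_zero γ]; congr 1
    exact Subtype.ext h1

section CharZero

omit hI in
lemma mem_rootSpace_of_mem_eigen [(cartanOf H I).IsCartanSubalgebra] {α : Module.Dual K H} {x : L}
    (hx : x ∈ eigen H α) (hxI : x ∈ I) :
    (⟨x, hxI⟩ : I) ∈ rootSpace (cartanOf H I) (restr H I α) := by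
  refine weightSpace_le_genWeightSpace _ _ ?_
  rw [mem_weightSpace]
  intro h
  apply Subtype.ext
  exact hx ⟨((h : I) : L), h.2⟩

variable [CharZero K] [IsAlgClosed K] [FiniteDimensional K L] [H.IsCartanSubalgebra]
variable [(cartanOf H I).IsCartanSubalgebra]

variable [IsKilling K I]

lemma mem_eigen_of_mem_rootSpace {α : Module.Dual K H}
    (hα : ∀ z : H, (z : L) ∈ center K L → α z = 0) {x : I}
    (hx : x ∈ rootSpace (cartanOf H I) (restr H I α)) : (x : L) ∈ eigen H α := by
  intro h
  obtain ⟨z, w, hz, rfl⟩ := exists_decomp hI h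
  have h1 : ⁅(w : I), x⁆ = restr H I α w • x := IsKilling.lie_eq_smul_of_mem_rootSpace hx w
  have h2 : ⁅((w : I) : L), (x : L)⁆ = restr H I α w • (x : L) := congrArg Subtype.val h1
  have h3 : ⁅(z : L), (x : L)⁆ = 0 :=
     center_lie_eq_zero hz _
  change ⁅(z : L) + ((w : I) : L), (x : L)⁆ = _
  rw [add_lie, h3, h2, map_add, hα z hz, zero_add, zero_add]
  rfl

omit [CharZero K] [IsAlgClosed K] in
lemma isLieAbelian_cartan_of_isCompl (x y : L) (hx : x ∈ H) (hy : y ∈ H) : ⁅x, y⁆ = 0 := by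
  obtain ⟨z, w, hz, h1⟩ := exists_decomp hI ⟨x, hx⟩
  obtain ⟨z', w', hz', h2⟩ := exists_decomp hI ⟨y, hy⟩
  have h1' : x = (z : L) + ((w : I) : L) := congrArg Subtype.val h1
  have h2' : y = (z' : L) + ((w' : I) : L) := congrArg Subtype.val h2
  have h4 : ⁅(w : I), (w' : I)⁆ = 0 := by
    have := trivial_lie_zero (cartanOf H I) (cartanOf H I) w w'
    exact congrArg Subtype.val this
  have h5 : ⁅((w : I) : L), ((w' : I) : L)⁆ = 0 := congrArg Subtype.val h4
  rw [h1', h2', add_lie, lie_add, lie_add, center_lie_eq_zero hz, center_lie_eq_zero hz,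
    lie_center_eq_zero hz', h5]
  simp

/-- `H` is abelian and hence sits in the eigenspace of zero. The ideal `I` is the sum of its root
spaces, which are genuine eigenspaces because its Killing form is nondegenerate. -/
lemma iSup_eigen_of_isCompl : ⨆ α, eigen H α = ⊤ := by
  have hH : ∀ x ∈ H, x ∈ ⨆ α, eigen H α := by
    intro x hx
    refine Submodule.mem_iSup_of_mem 0 fun h => ?_
    rw [isLieAbelian_cartan_of_isCompl hI _ _ h.2 hx]; simp
  rw [eq_top_iff]
  intro x _
  have : x ∈ center K L ⊔ I := by rw [hI.sup_eq_top]; trivial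
  obtain ⟨z, hz, w, hw, rfl⟩ := (LieSubmodule.mem_sup _ _ _).1 this
  refine Submodule.add_mem _ (hH z (center_le_cartan hz)) ?_
  have htop : (⊤ : Submodule K I) ≤ (⨆ α, eigen H α).comap I.toSubmodule.subtype := by
    rw [← LieSubmodule.top_toSubmodule (R := K) (L := cartanOf H I),
      ← iSup_genWeightSpace_eq_top' K (cartanOf H I) I, LieSubmodule.iSup_toSubmodule]
    refine iSup_le fun χ y hy => ?_
    obtain ⟨α, h1, h2⟩ := exists_restr_eq hI χ.toLinear
    refine Submodule.mem_iSup_of_mem α (mem_eigen_of_mem_rootSpace hI h2 ?_)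
    rw [h1]; exact hy
  exact htop (x := (⟨w, hw⟩ : I)) trivial

/-- The weight of the semisimple part attached to a root. -/
def toWeight (α : Module.Dual K H) {x : L} (hx : x ∈ eigen H α) (hxI : x ∈ I) (hx0 : x ≠ 0) :
    Weight K (cartanOf H I) I where
  toFun := restr H I α
  genWeightSpace_ne_bot' := fun h => by
    have := mem_rootSpace_of_mem_eigen hx hxI
    change _ ∈ genWeightSpace I _ at this
    rw [h, LieSubmodule.mem_bot] at this
    exact hx0 (congrArg Subtype.val this)

omit [CharZero K] [IsAlgClosed K] [FiniteDimensional K L] [IsKilling K I] in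
lemma toWeight_isNonZero {α : Module.Dual K H} (hα : α ≠ 0) {x : L} (hx : x ∈ eigen H α) (hxI : x ∈ I) (hx0 : x ≠ 0) :
    (toWeight α hx hxI hx0).IsNonZero := fun h =>
  restr_ne_zero hI hα hx hx0 (LinearMap.ext fun t => congrFun h t)

lemma eigen_line_of_isCompl {α : Module.Dual K H} (hα : α ≠ 0) {x y : L} (hx : x ∈ eigen H α)
    (hy : y ∈ eigen H α) (hx0 : x ≠ 0) : ∃ c : K, c • x = y := by
  have hxI := mem_ideal_of_mem_eigen hI hα hx
  have hyI := mem_ideal_of_mem_eigen hI hα hy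
  have h1 := IsKilling.finrank_rootSpace_eq_one _ (toWeight_isNonZero hI hα hx hxI hx0)
  obtain ⟨c, hc⟩ := (finrank_eq_one_iff_of_nonzero'
    (⟨⟨x, hxI⟩, mem_rootSpace_of_mem_eigen hx hxI⟩ :
      rootSpace (cartanOf H I) (toWeight α hx hxI hx0)) (fun h => hx0
        (congrArg (fun t : rootSpace (cartanOf H I) (toWeight α hx hxI hx0) =>
          ((t : I) : L)) h))).1 h1
    ⟨⟨y, hyI⟩, mem_rootSpace_of_mem_eigen hy hyI⟩
  exact ⟨c, congrArg (fun t : rootSpace (cartanOf H I) (toWeight α hx hxI hx0) =>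
    ((t : I) : L)) hc⟩

lemma lie_ne_zero_of_isCompl {α β : Module.Dual K H} (hα : α ≠ 0) (hβ : β ≠ 0) (hαβ : α + β ≠ 0)
    {x y z : L} (hx : x ∈ eigen H α) (hy : y ∈ eigen H β) (hz : z ∈ eigen H (α + β))
    (hx0 : x ≠ 0) (hy0 : y ≠ 0) (hz0 : z ≠ 0) : ⁅x, y⁆ ≠ 0 := by
  have hxI := mem_ideal_of_mem_eigen hI hα hx
  have hyI := mem_ideal_of_mem_eigen hI hβ hy
  have hzI := mem_ideal_of_mem_eigen hI hαβ hz
  intro h0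
  refine IsKilling.lie_ne_zero_of_rootSpace_add_ne_bot (toWeight_isNonZero hI hα hx hxI hx0)
    (toWeight_isNonZero hI hβ hy hyI hy0) ?_ (mem_rootSpace_of_mem_eigen hx hxI)
    (mem_rootSpace_of_mem_eigen hy hyI) (fun h => hx0 (congrArg Subtype.val h))
    (fun h => hy0 (congrArg Subtype.val h)) (Subtype.ext h0)
  exact (toWeight _ hz hzI hz0).genWeightSpace_ne_bot

/-- Take the lowering element of an `sl₂`-triple for `α`. Its raising element is a multiple of `x`,
and their bracket is the nonzero element `h`. -/
lemma exists_mem_eigen_neg_of_isCompl {α : Module.Dual K H} (hα : α ≠ 0) {x : L}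
    (hx : x ∈ eigen H α) (hx0 : x ≠ 0) : ∃ y ∈ eigen H (-α), ⁅x, y⁆ ≠ 0 := by
  have hxI := mem_ideal_of_mem_eigen hI hα hx
  have hneg : ∀ z : H, (z : L) ∈ center K L → (-α) z = 0 := fun z hz => by
    rw [LinearMap.neg_apply, apply_center_eq_zero hx hx0 hz, neg_zero]
  obtain ⟨h, e, f, t, he, hf⟩ := IsKilling.exists_isSl2Triple_of_weight_isNonZero
    (toWeight_isNonZero hI hα hx hxI hx0)
  refine ⟨f, mem_eigen_of_mem_rootSpace (α := -α) hI hneg hf, fun h0 => t.h_ne_zero ?_⟩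
  have he' : (e : L) ∈ eigen H α :=
    mem_eigen_of_mem_rootSpace hI (fun z hz => apply_center_eq_zero hx hx0 hz) he
  obtain ⟨c, hc⟩ := eigen_line_of_isCompl hI hα hx he' hx0
  apply Subtype.ext
  rw [← t.lie_e_f]
  change ⁅(e : L), (f : L)⁆ = 0
  rw [← hc, smul_lie, h0, smul_zero]

omit hI in
/-- `α` is a root with respect to `H`. -/
def IsRoot (H : LieSubalgebra K L) (α : Module.Dual K H) : Prop := α ≠ 0 ∧ eigen H α ≠ ⊥

omit [CharZero K] [IsAlgClosed K] [FiniteDimensional K L] [H.IsCartanSubalgebra]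
  [(cartanOf H I).IsCartanSubalgebra] [IsKilling K I] hI in
lemma IsRoot.apply_center {α : Module.Dual K H} (hα : IsRoot H α) (z : H)
    (hz : (z : L) ∈ center K L) : α z = 0 := by
  obtain ⟨x, hx, hx0⟩ := (Submodule.ne_bot_iff _).1 hα.2
  exact apply_center_eq_zero hx hx0 hz

lemma IsRoot.exists_root {α : Module.Dual K H} (hα : IsRoot H α) :
    ∃ i : (cartanOf H I).root, (IsKilling.rootSystem (cartanOf H I)).root i = restr H I α := by
  obtain ⟨x, hx, hx0⟩ := (Submodule.ne_bot_iff _).1 hα.2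
  have hxI := mem_ideal_of_mem_eigen hI hα.1 hx
  exact ⟨⟨toWeight α hx hxI hx0, by
    simpa using toWeight_isNonZero hI hα.1 hx hxI hx0⟩, rfl⟩

lemma isRoot_of_root_eq {α : Module.Dual K H} (hα : ∀ z : H, (z : L) ∈ center K L → α z = 0)
    {i : (cartanOf H I).root}
    (hi : (IsKilling.rootSystem (cartanOf H I)).root i = restr H I α) : IsRoot H α := by
  refine ⟨fun h => (IsKilling.rootSystem (cartanOf H I)).ne_zero i ?_, ?_⟩
  · rw [hi, h]; rfl
  · obtain ⟨y, hy, hy0⟩ := i.1.exists_ne_zero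
    refine (Submodule.ne_bot_iff _).2 ⟨y, mem_eigen_of_mem_rootSpace hI hα ?_,
      fun h => hy0 (Subtype.ext h)⟩
    rw [← hi]; exact hy

/-- Restriction to `H ∩ I` identifies the roots with respect to `H` with the root system of `I`, so
`exists_coweight_of_levi` applies; the coweight that it produces is an element of `H ∩ I`. -/
lemma exists_coweight_of_isCompl (Sl Su : Set (Module.Dual K H))
    (hl : ∀ α ∈ Sl, IsRoot H α) (hu : ∀ α ∈ Su, IsRoot H α)
    (hneg : ∀ α ∈ Sl, -α ∈ Sl)
    (hlu : ∀ α ∈ Sl, ∀ β ∈ Su, IsRoot H (α + β) → α + β ∈ Su)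
    (huu : ∀ α ∈ Su, ∀ β ∈ Su, IsRoot H (α + β) → α + β ∈ Su)
    (hnu : ∀ α ∈ Su, -α ∉ Su) (hdis : Disjoint Sl Su) :
    ∃ h : H, (∀ α ∈ Sl, α h = 0) ∧ ∀ α ∈ Su, ∃ c : ℕ, 0 < c ∧ α h = c := by
  let P := IsKilling.rootSystem (cartanOf H I)
  have inj : ∀ α β : Module.Dual K H, IsRoot H α → IsRoot H β → restr H I α = restr H I β → α = β :=
    fun α β hα hβ h => eq_of_restr_eq hI hα.apply_center hβ.apply_center h
  have negroot : ∀ i, P.root (P.reflectionPerm i i) = -P.root i := fun i => by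
    rw [P.root_reflectionPerm, P.reflection_apply_self]
  have negR : ∀ α, IsRoot H α → IsRoot H (-α) := by
    intro α hα
    obtain ⟨i, hi⟩ := hα.exists_root hI
    refine isRoot_of_root_eq hI (i := P.reflectionPerm i i) (fun z hz => ?_) ?_
    · rw [LinearMap.neg_apply, hα.apply_center z hz, neg_zero]
    · rw [restr_neg, ← hi]; exact negroot i
  have hadd : ∀ (S T : Set (Module.Dual K H)), (∀ α ∈ S, IsRoot H α) → (∀ α ∈ T, IsRoot H α) →
      (∀ α ∈ S, ∀ β ∈ T, IsRoot H (α + β) → α + β ∈ T) →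
      ∀ i ∈ {i | ∃ α ∈ S, P.root i = restr H I α}, ∀ j ∈ {i | ∃ α ∈ T, P.root i = restr H I α},
      ∀ l, P.root l = P.root i + P.root j → l ∈ {i | ∃ α ∈ T, P.root i = restr H I α} := by
    rintro S T hS hT hST i ⟨α, hα, hi⟩ j ⟨β, hβ, hj⟩ l hl
    have h1 : P.root l = restr H I (α + β) := by rw [hl, hi, hj, restr_add]
    refine ⟨α + β, hST α hα β hβ (isRoot_of_root_eq hI (fun z hz => ?_) h1), h1⟩
    rw [LinearMap.add_apply, (hS α hα).apply_center z hz, (hT β hβ).apply_center z hz, add_zero]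
  obtain ⟨n, h1, h2⟩ := P.exists_coweight_of_levi {i | ∃ α ∈ Sl, P.root i = restr H I α}
    {i | ∃ α ∈ Su, P.root i = restr H I α}
    (by
      rintro i ⟨α, hα, hi⟩
      exact ⟨-α, hneg α hα, by rw [negroot, hi, restr_neg]⟩)
    (hadd Sl Su hl hu hlu) (hadd Su Su hu hu huu)
    (by
      rintro i ⟨α, hα, hi⟩ ⟨β, hβ, hi'⟩
      rw [negroot, hi, ← restr_neg] at hi'
      have := inj _ _ (negR α (hu α hα)) (hu β hβ) hi'
      exact hnu α hα (this ▸ hβ))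
    (by
      rw [Set.disjoint_left]
      rintro i ⟨α, hα, hi⟩ ⟨β, hβ, hi'⟩
      have := inj _ _ (hl α hα) (hu β hβ) (hi.symm.trans hi')
      exact Set.disjoint_left.1 hdis hα (this ▸ hβ))
  refine ⟨⟨((n : I) : L), n.2⟩, fun α hα => ?_, fun α hα => ?_⟩
  · obtain ⟨i, hi⟩ := (hl α hα).exists_root hI
    have := h1 i ⟨α, hα, hi⟩
    have hi' : P.root i = restr H I α := hi
    rw [hi'] at this
    exact this
  · obtain ⟨i, hi⟩ := (hu α hα).exists_root hI
    obtain ⟨c, hc, this⟩ := h2 i ⟨α, hα, hi⟩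
    have hi' : P.root i = restr H I α := hi
    rw [hi'] at this
    exact ⟨c, hc, this⟩

end CharZero

end Reductive

section Main

variable {K L : Type*} [Field K] [LieRing L] [LieAlgebra K L] [CharZero K] [IsAlgClosed K]
  [FiniteDimensional K L] (hss : AdSemisimple K L) {H : LieSubalgebra K L} [H.IsCartanSubalgebra]
include hss

omit [IsAlgClosed K] in
lemma exists_killing_complement : ∃ I : LieIdeal K L, IsCompl (center K L) I ∧
    (cartanOf H I).IsCartanSubalgebra ∧ IsKilling K I := by
  obtain ⟨I, hI⟩ := hss (center K L)
  have := hasTrivialRadical_of_isCompl_center hss hI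
  exact ⟨I, hI, isCartan_cartanOf hI, inferInstance⟩

omit [IsAlgClosed K] in
lemma isLieAbelian_cartan (x y : L) (hx : x ∈ H) (hy : y ∈ H) : ⁅x, y⁆ = 0 := by
  obtain ⟨I, hI, _, _⟩ := exists_killing_complement (H := H) hss
  exact isLieAbelian_cartan_of_isCompl hI x y hx hy

lemma iSup_eigen : ⨆ α, eigen H α = ⊤ := by
  obtain ⟨I, hI, _, _⟩ := exists_killing_complement (H := H) hss
  exact iSup_eigen_of_isCompl hI

lemma eigen_line {α : Module.Dual K H} (hα : α ≠ 0) {x y : L} (hx : x ∈ eigen H α)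
    (hy : y ∈ eigen H α) (hx0 : x ≠ 0) : ∃ c : K, c • x = y := by
  obtain ⟨I, hI, _, _⟩ := exists_killing_complement (H := H) hss
  exact eigen_line_of_isCompl hI hα hx hy hx0

lemma eigen_lie_ne_zero {α β : Module.Dual K H} (hα : α ≠ 0) (hβ : β ≠ 0) (hαβ : α + β ≠ 0)
    {x y z : L} (hx : x ∈ eigen H α) (hy : y ∈ eigen H β) (hz : z ∈ eigen H (α + β))
    (hx0 : x ≠ 0) (hy0 : y ≠ 0) (hz0 : z ≠ 0) : ⁅x, y⁆ ≠ 0 := by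
  obtain ⟨I, hI, _, _⟩ := exists_killing_complement (H := H) hss
  exact lie_ne_zero_of_isCompl hI hα hβ hαβ hx hy hz hx0 hy0 hz0

lemma exists_mem_eigen_neg {α : Module.Dual K H} (hα : α ≠ 0) {x : L}
    (hx : x ∈ eigen H α) (hx0 : x ≠ 0) : ∃ y ∈ eigen H (-α), ⁅x, y⁆ ≠ 0 := by
  obtain ⟨I, hI, _, _⟩ := exists_killing_complement (H := H) hss
  exact exists_mem_eigen_neg_of_isCompl hI hα hx hx0

lemma exists_coweight (Sl Su : Set (Module.Dual K H))
    (hl : ∀ α ∈ Sl, IsRoot H α) (hu : ∀ α ∈ Su, IsRoot H α)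
    (hneg : ∀ α ∈ Sl, -α ∈ Sl)
    (hlu : ∀ α ∈ Sl, ∀ β ∈ Su, IsRoot H (α + β) → α + β ∈ Su)
    (huu : ∀ α ∈ Su, ∀ β ∈ Su, IsRoot H (α + β) → α + β ∈ Su)
    (hnu : ∀ α ∈ Su, -α ∉ Su) (hdis : Disjoint Sl Su) :
    ∃ h : H, (∀ α ∈ Sl, α h = 0) ∧ ∀ α ∈ Su, ∃ c : ℕ, 0 < c ∧ α h = c := by
  obtain ⟨I, hI, _, _⟩ := exists_killing_complement (H := H) hss
  exact exists_coweight_of_isCompl hI Sl Su hl hu hneg hlu huu hnu hdis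

end Main

end CatO

/-! ### Root spaces of a root-reductive Lie algebra, from its finite levels -/

namespace CatO

/-- Simultaneous eigenspaces of a family of operators are independent. -/
lemma iSupIndep_of_forall_eq_smul {k V H : Type*} [Field k] [AddCommGroup V] [Module k V]
    [AddCommGroup H] [Module k H] (T : H → Module.End k V) (W : Module.Dual k H → Submodule k V)
    (hW : ∀ μ, ∀ m ∈ W μ, ∀ h, T h m = μ h • m) : iSupIndep W := by
  classical
  rw [iSupIndep_iff_finsetSum_eq_zero_imp_eq_zero]
  intro s
  induction s using Finset.induction_on with
  | empty => simp
  | insert a s ha ih =>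
    intro v hv hsum
    have key : ∀ μ ∈ s, v μ = 0 := by
      intro μ hμ
      obtain ⟨h, hh⟩ : ∃ h, μ h ≠ a h := by
        by_contra! hc
        exact ha ((LinearMap.ext hc : μ = a) ▸ hμ)
      have h1 : ∑ ν ∈ s, (ν h - a h) • v ν = 0 := by
        have h2 := congrArg (T h) hsum
        rw [map_sum, map_zero, Finset.sum_congr rfl fun ν hν => hW ν (v ν) (hv ν hν) h] at h2
        have h3 := congrArg (fun t => a h • t) hsum
        rw [Finset.smul_sum, smul_zero] at h3
        have h4 := congrArg₂ (· - ·) h2 h3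
        rw [← Finset.sum_sub_distrib, sub_zero, Finset.sum_insert ha, sub_self, zero_add] at h4
        rw [← h4]
        exact Finset.sum_congr rfl fun ν _ => sub_smul _ _ _
      have h2 := ih (fun ν => (ν h - a h) • v ν)
        (fun ν hν => Submodule.smul_mem _ _ (hv ν (Finset.mem_insert_of_mem hν))) h1 μ hμ
      exact (smul_eq_zero.1 h2).resolve_left (sub_ne_zero.2 hh)
    intro μ hμ
    rcases Finset.mem_insert.1 hμ with rfl | hμ
    · rw [Finset.sum_insert ha, Finset.sum_eq_zero key, add_zero] at hsum
      exact hsum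
    · exact key μ hμ

namespace RootReductive

variable {k : Type u} [Field k] {g : Type u} [LieRing g] [LieAlgebra k g] (D : RootReductive k g)

lemma gt_mono : Monotone D.gt := monotone_nat_of_le_succ D.gt_le

instance (n : ℕ) : FiniteDimensional k (D.gt n) := D.finite n

/-- The Cartan subalgebra `𝔥ₙ`, as a subalgebra of `𝔤̃ₙ`. -/
def hh (n : ℕ) : LieSubalgebra k (D.gt n) := (D.ht n).comap (D.gt n).incl

instance (n : ℕ) : (D.hh n).IsCartanSubalgebra := D.isCartan n

lemma ht_le_cartan (n : ℕ) : D.ht n ≤ D.cartan := fun _ hx => ⟨n, hx⟩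

lemma adSemisimple (n : ℕ) : AdSemisimple k (D.gt n) := by
  intro I
  obtain ⟨W, hW, hdis, hsup⟩ := D.reductive n (I.toSubmodule.map (D.gt n).toSubmodule.subtype)
    (by rintro _ ⟨x, _, rfl⟩; exact x.2)
    (by
      rintro x hx _ ⟨v, hv, rfl⟩
      exact ⟨⁅(⟨x, hx⟩ : D.gt n), v⁆, I.lie_mem hv, rfl⟩)
  let J : LieIdeal k (D.gt n) :=
    { toSubmodule := W.comap (D.gt n).toSubmodule.subtype
      lie_mem := fun {x m} hm => hW x x.2 _ hm }
  refine ⟨J, ?_⟩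
  rw [← LieSubmodule.isCompl_toSubmodule]
  refine ⟨?_, ?_⟩
  · rw [Submodule.disjoint_def] at hdis ⊢
    intro x hx hx'
    exact Subtype.ext (hdis x ⟨x, hx, rfl⟩ hx')
  · rw [codisjoint_iff, eq_top_iff]
    intro x _
    have hx : (x : g) ∈ I.toSubmodule.map (D.gt n).toSubmodule.subtype ⊔ W := by
      rw [hsup]; exact x.2
    obtain ⟨_, ⟨a, ha, rfl⟩, w, hw, haw⟩ := Submodule.mem_sup.1 hx
    have hw' : w ∈ D.gt n := by
      have : w = (x : g) - (a : g) := by rw [← haw]; simp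
      rw [this]; exact (D.gt n).sub_mem x.2 a.2
    exact Submodule.mem_sup.2 ⟨a, ha, ⟨w, hw'⟩, hw, Subtype.ext haw⟩

/-- The restriction of a weight to `𝔥ₙ`. -/
def res' (n : ℕ) (α : D.Weight) : Module.Dual k (D.hh n) where
  toFun h := α ⟨((h : D.gt n) : g), D.ht_le_cartan n h.2⟩
  map_add' x y := by rw [← map_add]; rfl
  map_smul' c x := by rw [RingHom.id_apply, ← map_smul]; rfl

lemma mem_eigen {n : ℕ} {α : D.Weight} {x : g} (hx : x ∈ D.rootSpace α) (hn : x ∈ D.gt n) :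
    (⟨x, hn⟩ : D.gt n) ∈ eigen (D.hh n) (D.res' n α) := fun h =>
  Subtype.ext (hx ⟨((h : D.gt n) : g), D.ht_le_cartan n h.2⟩)

lemma isRootVector_mono {n m : ℕ} (h : n ≤ m) {x : g} (hx : IsRootVector (D.gt n) (D.ht n) x) :
    IsRootVector (D.gt m) (D.ht m) x := by
  induction m, h using Nat.le_induction with
  | base => exact hx
  | succ m _ ih => exact D.rootVector m x ih

/-- Root vectors of `𝔤̃ₙ` are weight vectors for the whole of `𝔥`. -/
lemma exists_mem_rootSpace_of_isRootVector {n : ℕ} {x : g}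
    (hx : IsRootVector (D.gt n) (D.ht n) x) : ∃ α : D.Weight, x ∈ D.rootSpace α := by
  have hx0 : x ≠ 0 := hx.2.1
  -- Every `h` lies in some `𝔥ₘ`, and `x` is still a root vector at that level. The eigenvalues are
  -- unique as `x ≠ 0`, which forces them to be linear in `h`.
  have hex : ∀ h : D.cartan, ∃ c : k, ⁅(h : g), x⁆ = c • x := by
    rintro ⟨h, m, hm⟩
    obtain ⟨_, _, α, _, hα⟩ := D.isRootVector_mono (le_max_left n m) hx
    exact ⟨α ⟨h, D.ht_mono (le_max_right n m) hm⟩, hα ⟨h, D.ht_mono (le_max_right n m) hm⟩⟩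
  choose c hc using hex
  have inj : ∀ a b : k, a • x = b • x → a = b := fun a b h => smul_left_injective k hx0 h
  refine ⟨⟨⟨c, fun a b => inj _ _ ?_⟩, fun t a => inj _ _ ?_⟩, hc⟩
  · rw [← hc, add_smul, ← hc, ← hc, ← add_lie]; rfl
  · rw [← hc, RingHom.id_apply, smul_eq_mul, mul_smul, ← hc, ← smul_lie]; rfl

lemma exists_mem_rootSpace {n : ℕ} {γ : Module.Dual k (D.hh n)} (hγ : γ ≠ 0) {x : D.gt n}
    (hx : x ∈ eigen (D.hh n) γ) : ∃ α : D.Weight, (x : g) ∈ D.rootSpace α := by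
  by_cases hx0 : x = 0
  · exact ⟨0, by rw [hx0]; exact Submodule.zero_mem _⟩
  refine D.exists_mem_rootSpace_of_isRootVector (n := n) ⟨x.2, fun h => hx0 (Subtype.ext h), ?_⟩
  let α : Module.Dual k (D.ht n) :=
    { toFun := fun h => γ ⟨⟨h, D.ht_le_gt n h.2⟩, h.2⟩
      map_add' := fun a b => by rw [← map_add]; rfl
      map_smul' := fun t a => by rw [RingHom.id_apply, ← map_smul]; rfl }
  refine ⟨α, fun h => hγ (LinearMap.ext fun t => ?_), fun h => ?_⟩
  · exact LinearMap.congr_fun h ⟨((t : D.gt n) : g), t.2⟩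
  · exact congrArg Subtype.val (hx ⟨⟨h, D.ht_le_gt n h.2⟩, h.2⟩)

lemma iSupIndep_rootSpace : iSupIndep D.rootSpace :=
  iSupIndep_of_forall_eq_smul (fun h : D.cartan => (LieAlgebra.ad k g (h : g) : g →ₗ[k] g)) _
    fun _ _ hm h => hm h

lemma mem_of_mem_iSup_rootSpace {S : Set D.Weight} {α : D.Weight} {x : g}
    (hx : x ∈ D.rootSpace α) (hS : x ∈ ⨆ β ∈ S, D.rootSpace β) (hx0 : x ≠ 0) : α ∈ S := by
  by_contra h
  exact hx0 (Submodule.disjoint_def.1 (D.iSupIndep_rootSpace.disjoint_biSup h) x hx hS)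

lemma eq_of_mem_rootSpace {α β : D.Weight} {x : g} (hx : x ∈ D.rootSpace α)
    (hx' : x ∈ D.rootSpace β) (hx0 : x ≠ 0) : α = β := by
  have := D.mem_of_mem_iSup_rootSpace (S := {β}) hx (by simpa using hx') hx0
  simpa using this

section CharZero

variable [CharZero k] [IsAlgClosed k]

omit [IsAlgClosed k] in
lemma cartan_abelian {x y : g} (hx : x ∈ D.cartan) (hy : y ∈ D.cartan) : ⁅x, y⁆ = 0 := by
  obtain ⟨m, hm⟩ := hx
  obtain ⟨n, hn⟩ := hy
  have hm' := D.ht_mono (le_max_left m n) hm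
  have hn' := D.ht_mono (le_max_right m n) hn
  exact congrArg Subtype.val (isLieAbelian_cartan (H := D.hh (max m n)) (D.adSemisimple _)
    ⟨x, D.ht_le_gt _ hm'⟩ ⟨y, D.ht_le_gt _ hn'⟩ hm' hn')

omit [IsAlgClosed k] in
lemma cartan_le_rootSpace_zero {x : g} (hx : x ∈ D.cartan) : x ∈ D.rootSpace 0 := fun h => by
  rw [D.cartan_abelian h.2 hx]; simp

omit [CharZero k] [IsAlgClosed k] in
lemma mem_cartan_of_mem_rootSpace_zero {x : g} (hx : x ∈ D.rootSpace 0) : x ∈ D.cartan := by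
  obtain ⟨n, hn⟩ := D.exhaust x
  exact ⟨n, mem_of_mem_eigen_zero (H := D.hh n) (D.mem_eigen hx hn)⟩

/-- Eigenvectors of `𝔥ₙ` with nonzero eigenvalue are root vectors, hence weight vectors for all of
`𝔥`. Those with eigenvalue zero belong to `𝔥ₙ`, and `𝔥` is abelian. -/
lemma gt_le_iSup (n : ℕ) : (D.gt n).toSubmodule ≤
    ⨆ α, D.rootSpace α ⊓ (D.gt n).toSubmodule := by
  have h1 : (⊤ : Submodule k (D.gt n)) ≤ (⨆ α, D.rootSpace α ⊓ (D.gt n).toSubmodule).comap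
      (D.gt n).toSubmodule.subtype := by
    rw [← iSup_eigen (H := D.hh n) (D.adSemisimple n)]
    refine iSup_le fun γ x hx => ?_
    by_cases hγ : γ = 0
    · subst hγ
      exact Submodule.mem_iSup_of_mem 0
        ⟨D.cartan_le_rootSpace_zero ⟨n, mem_of_mem_eigen_zero (H := D.hh n) hx⟩, x.2⟩
    · obtain ⟨α, hα⟩ := D.exists_mem_rootSpace hγ hx
      exact Submodule.mem_iSup_of_mem α ⟨hα, x.2⟩
  intro x hx
  exact h1 (x := ⟨x, hx⟩) trivial

lemma cartan_lie_mem_gt {n : ℕ} {h x : g} (hh : h ∈ D.cartan) (hx : x ∈ D.gt n) :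
    ⁅h, x⁆ ∈ D.gt n := by
  have : (D.gt n).toSubmodule ≤
      (D.gt n).toSubmodule.comap (LieAlgebra.ad k g h : g →ₗ[k] g) := by
    refine (D.gt_le_iSup n).trans (iSup_le fun α y hy => ?_)
    change ⁅h, y⁆ ∈ D.gt n
    rw [hy.1 ⟨h, hh⟩]
    exact (D.gt n).smul_mem _ hy.2
  exact this hx

lemma mem_gn {n : ℕ} {x : g} : x ∈ D.gn n ↔ ∃ y ∈ D.gt n, ∃ h ∈ D.cartan, y + h = x := by
  constructor
  · let S : LieSubalgebra k g :=
      { toSubmodule := (D.gt n).toSubmodule ⊔ D.cartan.toSubmodule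
        lie_mem' := by
          intro a b ha hb
          obtain ⟨y, hy, h, hh, rfl⟩ := Submodule.mem_sup.1 ha
          obtain ⟨y', hy', h', hh', rfl⟩ := Submodule.mem_sup.1 hb
          refine Submodule.mem_sup_left ?_
          rw [lie_add, add_lie, add_lie, D.cartan_abelian hh hh', ← lie_skew y h']
          exact (D.gt n).add_mem ((D.gt n).add_mem ((D.gt n).lie_mem hy hy')
            (D.cartan_lie_mem_gt hh hy')) ((D.gt n).add_mem
            ((D.gt n).neg_mem (D.cartan_lie_mem_gt hh' hy)) (D.gt n).zero_mem) }
    intro hx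
    have hle : D.gn n ≤ S := sup_le (fun a ha => Submodule.mem_sup_left ha)
      (fun a ha => Submodule.mem_sup_right ha)
    exact Submodule.mem_sup.1 (hle hx)
  · rintro ⟨y, hy, h, hh, rfl⟩
    exact (D.gn n).add_mem ((le_sup_left : D.gt n ≤ D.gn n) hy)
      ((le_sup_right : D.cartan ≤ D.gn n) hh)

omit [CharZero k] [IsAlgClosed k] in
lemma gt_le_gn (n : ℕ) : D.gt n ≤ D.gn n := le_sup_left

omit [CharZero k] [IsAlgClosed k] in
lemma cartan_le_gn (n : ℕ) : D.cartan ≤ D.gn n := le_sup_right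

omit [CharZero k] [IsAlgClosed k] in
lemma gn_mono {n m : ℕ} (h : n ≤ m) : D.gn n ≤ D.gn m := sup_le_sup_right (D.gt_mono h) _

lemma gn_lie_mem_gt {n : ℕ} {x y : g} (hx : x ∈ D.gn n) (hy : y ∈ D.gt n) : ⁅x, y⁆ ∈ D.gt n := by
  obtain ⟨a, ha, h, hh, rfl⟩ := D.mem_gn.1 hx
  rw [add_lie]
  exact (D.gt n).add_mem ((D.gt n).lie_mem ha hy) (D.cartan_lie_mem_gt hh hy)

/-- Choose `h` with `α h ≠ 0`. Bracketing with `h` kills the `𝔥`-part of `x` and keeps the rest in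
`𝔤̃ₙ`, while it only rescales `x`. -/
lemma mem_gt_of_mem_gn {n : ℕ} {α : D.Weight} (hα : α ≠ 0) {x : g} (hx : x ∈ D.rootSpace α)
    (hn : x ∈ D.gn n) : x ∈ D.gt n := by
  obtain ⟨h, hh⟩ : ∃ h, α h ≠ 0 := by
    by_contra! hc
    exact hα (LinearMap.ext hc)
  obtain ⟨y, hy, t, ht, rfl⟩ := D.mem_gn.1 hn
  have h1 := hx h
  rw [lie_add, D.cartan_abelian h.2 ht, add_zero] at h1
  have h2 : α h • (y + t) ∈ D.gt n := h1 ▸ D.cartan_lie_mem_gt h.2 hy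
  exact ((D.gt n).toSubmodule.smul_mem_iff hh).1 h2

lemma iSup_rootSpace : ⨆ α, D.rootSpace α = ⊤ := by
  rw [eq_top_iff]
  intro x _
  obtain ⟨n, hn⟩ := D.exhaust x
  exact (iSup_mono fun α => inf_le_left :
    ⨆ α, D.rootSpace α ⊓ (D.gt n).toSubmodule ≤ ⨆ α, D.rootSpace α) (D.gt_le_iSup n hn)

omit [CharZero k] [IsAlgClosed k] in
lemma exists_level (t : Finset g) : ∃ m, ∀ x ∈ t, x ∈ D.gt m := by
  classical
  induction t using Finset.induction_on with
  | empty => exact ⟨0, by simp⟩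
  | insert a s _ ih =>
    obtain ⟨m, hm⟩ := ih
    obtain ⟨m', hm'⟩ := D.exhaust a
    refine ⟨max m m', fun h hh => ?_⟩
    rcases Finset.mem_insert.1 hh with rfl | hh
    · exact D.gt_mono (le_max_right m m') hm'
    · exact D.gt_mono (le_max_left m m') (hm h hh)

omit [IsAlgClosed k] in
-- A vector of `𝔤̃ₙ` killed by `𝔥ₙ` lies in `𝔥ₙ`, which is its own normalizer, and would therefore
-- have weight zero for all of `𝔥`.
lemma res'_ne_zero {n : ℕ} {α : D.Weight} (hα : α ≠ 0) {x : g} (hx : x ∈ D.rootSpace α)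
    (hn : x ∈ D.gt n) (hx0 : x ≠ 0) : D.res' n α ≠ 0 := fun h0 => by
  have h1 := D.mem_eigen hx hn
  rw [h0] at h1
  have h2 : x ∈ D.cartan := ⟨n, mem_of_mem_eigen_zero (H := D.hh n) h1⟩
  exact hα (D.eq_of_mem_rootSpace hx (D.cartan_le_rootSpace_zero h2) hx0)

end CharZero

end RootReductive

end CatO

/-! ### Brackets of root vectors and the root sets `Φₙ` -/

namespace CatO

namespace RootReductive

variable {k : Type u} [Field k] {g : Type u} [LieRing g] [LieAlgebra k g] (D : RootReductive k g)

lemma rootsN_subset_roots (n : ℕ) : D.rootsN n ⊆ D.roots := fun _ h =>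
  ⟨h.1, fun h0 => h.2 (by rw [h0, bot_inf_eq])⟩

lemma exists_of_mem_roots {α : D.Weight} (h : α ∈ D.roots) : ∃ x ∈ D.rootSpace α, x ≠ 0 :=
  (Submodule.ne_bot_iff _).1 h.2

lemma mem_roots_of {α : D.Weight} (hα : α ≠ 0) {x : g} (hx : x ∈ D.rootSpace α) (hx0 : x ≠ 0) :
    α ∈ D.roots :=
  ⟨hα, (Submodule.ne_bot_iff _).2 ⟨x, hx, hx0⟩⟩

lemma mem_rootsN_of {n : ℕ} {α : D.Weight} (hα : α ≠ 0) {x : g} (hx : x ∈ D.rootSpace α)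
    (hn : x ∈ D.gt n) (hx0 : x ≠ 0) : α ∈ D.rootsN n :=
  ⟨hα, (Submodule.ne_bot_iff _).2 ⟨x, ⟨hx, D.gt_le_gn n hn⟩, hx0⟩⟩

lemma rootsN_mono {n m : ℕ} (h : n ≤ m) : D.rootsN n ⊆ D.rootsN m := fun _ hα =>
  ⟨hα.1, fun h0 => hα.2 (eq_bot_iff.2 (h0 ▸ inf_le_inf_left _ (D.gn_mono h)))⟩

lemma exists_mem_rootsN {α : D.Weight} (h : α ∈ D.roots) : ∃ n, α ∈ D.rootsN n := by
  obtain ⟨x, hx, hx0⟩ := D.exists_of_mem_roots h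
  obtain ⟨n, hn⟩ := D.exhaust x
  exact ⟨n, D.mem_rootsN_of h.1 hx hn hx0⟩

variable [CharZero k] [IsAlgClosed k]

lemma exists_of_mem_rootsN {n : ℕ} {α : D.Weight} (h : α ∈ D.rootsN n) :
    ∃ x ∈ D.rootSpace α, x ∈ D.gt n ∧ x ≠ 0 := by
  obtain ⟨x, ⟨hx, hx'⟩, hx0⟩ := (Submodule.ne_bot_iff _).1 h.2
  exact ⟨x, hx, D.mem_gt_of_mem_gn h.1 hx hx', hx0⟩

/-- Root spaces are at most one-dimensional. -/
lemma exists_smul_eq {α : D.Weight} (hα : α ≠ 0) {x y : g} (hx : x ∈ D.rootSpace α)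
    (hy : y ∈ D.rootSpace α) (hx0 : x ≠ 0) : ∃ c : k, c • x = y := by
  classical
  obtain ⟨m, hm⟩ := D.exists_level {x, y}
  have hxm := hm x (by simp)
  have hym := hm y (by simp)
  obtain ⟨c, hc⟩ := eigen_line (H := D.hh m) (D.adSemisimple m) (D.res'_ne_zero hα hx hxm hx0)
    (D.mem_eigen hx hxm) (D.mem_eigen hy hym) (fun h => hx0 (congrArg Subtype.val h))
  exact ⟨c, congrArg Subtype.val hc⟩

/-- A root space is a line, so `𝔤̃ₙ` contains all of it once it contains a nonzero vector. -/
lemma rootSpace_le_gt {n : ℕ} {α : D.Weight} (hα : α ∈ D.rootsN n) :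
    D.rootSpace α ≤ (D.gt n).toSubmodule := by
  obtain ⟨x, hx, hxn, hx0⟩ := D.exists_of_mem_rootsN hα
  intro y hy
  obtain ⟨c, rfl⟩ := D.exists_smul_eq hα.1 hx hy hx0
  exact (D.gt n).smul_mem c hxn

/-- Only the restriction of `α + β` to `𝔥ₘ` is asked to be a root, because this is what the root
system of a finite level provides. -/
lemma lie_ne_zero_of_level {m : ℕ} {α β : D.Weight} (hα : α ≠ 0) (hβ : β ≠ 0)
    {x y : g} (hx : x ∈ D.rootSpace α) (hy : y ∈ D.rootSpace β) (hxm : x ∈ D.gt m)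
    (hym : y ∈ D.gt m) (hx0 : x ≠ 0) (hy0 : y ≠ 0)
    (h : IsRoot (D.hh m) (D.res' m α + D.res' m β)) : ⁅x, y⁆ ≠ 0 := by
  obtain ⟨z, hz, hz0⟩ := (Submodule.ne_bot_iff _).1 h.2
  intro h0
  exact eigen_lie_ne_zero (H := D.hh m) (D.adSemisimple m) (D.res'_ne_zero hα hx hxm hx0)
    (D.res'_ne_zero hβ hy hym hy0) h.1
    (D.mem_eigen hx hxm) (D.mem_eigen hy hym) hz (fun h => hx0 (congrArg Subtype.val h))
    (fun h => hy0 (congrArg Subtype.val h)) hz0 (Subtype.ext h0)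

lemma lie_ne_zero {α β : D.Weight} (hα : α ≠ 0) (hβ : β ≠ 0) (hαβ : α + β ∈ D.roots)
    {x y : g} (hx : x ∈ D.rootSpace α) (hy : y ∈ D.rootSpace β)
    (hx0 : x ≠ 0) (hy0 : y ≠ 0) : ⁅x, y⁆ ≠ 0 := by
  classical
  obtain ⟨z, hz, hz0⟩ := D.exists_of_mem_roots hαβ
  obtain ⟨m, hm⟩ := D.exists_level {x, y, z}
  have hzm := hm z (by simp)
  exact D.lie_ne_zero_of_level hα hβ hx hy (hm x (by simp)) (hm y (by simp)) hx0 hy0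
    ⟨D.res'_ne_zero hαβ.1 hz hzm hz0, (Submodule.ne_bot_iff _).2 ⟨⟨z, hzm⟩, D.mem_eigen hz hzm,
      fun h => hz0 (congrArg Subtype.val h)⟩⟩

/-- At level `n` there is an opposite eigenvector `y` with `⁅x, y⁆ ≠ 0`. It is a weight vector for
all of `𝔥`, of weight `β` say, and the bracket lies in `𝔥`; so `α + β = 0`. -/
lemma neg_mem_rootsN {n : ℕ} {α : D.Weight} (hα : α ∈ D.rootsN n) : -α ∈ D.rootsN n := by
  obtain ⟨x, hx, hxn, hx0⟩ := D.exists_of_mem_rootsN hα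
  have h0 := D.res'_ne_zero hα.1 hx hxn hx0
  obtain ⟨y, hy, hxy⟩ := exists_mem_eigen_neg (H := D.hh n) (D.adSemisimple n) h0
    (D.mem_eigen hx hxn) (fun h => hx0 (congrArg Subtype.val h))
  obtain ⟨β, hβ⟩ := D.exists_mem_rootSpace (neg_ne_zero.2 h0) hy
  have h1 := PositiveSystem.lie_mem_rootSpace hx hβ
  have h2 : ⁅(⟨x, hxn⟩ : D.gt n), y⁆ ∈ eigen (D.hh n) 0 := fun h => by
    rw [leibniz_lie, D.mem_eigen hx hxn h, hy h, smul_lie, lie_smul]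
    simp
  have h3 : ⁅x, (y : g)⁆ ∈ D.cartan := ⟨n, mem_of_mem_eigen_zero (H := D.hh n) h2⟩
  have h4 := D.eq_of_mem_rootSpace h1 (D.cartan_le_rootSpace_zero h3)
    (fun h => hxy (Subtype.ext h))
  rw [neg_eq_of_add_eq_zero_right h4]
  refine D.mem_rootsN_of (fun h => hα.1 ?_) hβ y.2 (fun h => hxy ?_)
  · rwa [h, add_zero] at h4
  · rw [show y = 0 from Subtype.ext h, lie_zero]

/-- The bracket of two root vectors of `𝔤̃ₙ` stays in `𝔤̃ₙ`, and it is nonzero because the sum is a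
root of `g`. -/
lemma add_mem_rootsN {n : ℕ} {α β : D.Weight} (hα : α ∈ D.rootsN n) (hβ : β ∈ D.rootsN n)
    (h : α + β ∈ D.roots) : α + β ∈ D.rootsN n := by
  obtain ⟨x, hx, hxn, hx0⟩ := D.exists_of_mem_rootsN hα
  obtain ⟨y, hy, hyn, hy0⟩ := D.exists_of_mem_rootsN hβ
  exact D.mem_rootsN_of h.1 (PositiveSystem.lie_mem_rootSpace hx hy) ((D.gt n).lie_mem hxn hyn)
    (D.lie_ne_zero hα.1 hβ.1 h hx hy hx0 hy0)

/-- Restriction of weights to `𝔥ₘ` is injective on the roots of `𝔤̃ₘ`. -/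
lemma res'_injOn (m : ℕ) : Set.InjOn (D.res' m) (D.rootsN m) := by
  intro α hα β hβ h
  obtain ⟨x, hx, hxn, hx0⟩ := D.exists_of_mem_rootsN hα
  obtain ⟨y, hy, hyn, hy0⟩ := D.exists_of_mem_rootsN hβ
  have hy' := D.mem_eigen hy hyn
  rw [← h] at hy'
  obtain ⟨c, hc⟩ := eigen_line (H := D.hh m) (D.adSemisimple m) (D.res'_ne_zero hα.1 hx hxn hx0)
    (D.mem_eigen hx hxn) hy' (fun h => hx0 (congrArg Subtype.val h))
  have hc' : c • x = y := congrArg Subtype.val hc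
  exact D.eq_of_mem_rootSpace (hc' ▸ Submodule.smul_mem _ c hx) hy hy0

lemma isRoot_res' {m : ℕ} {α : D.Weight} (hα : α ∈ D.rootsN m) :
    IsRoot (D.hh m) (D.res' m α) := by
  obtain ⟨x, hx, hxn, hx0⟩ := D.exists_of_mem_rootsN hα
  exact ⟨D.res'_ne_zero hα.1 hx hxn hx0, (Submodule.ne_bot_iff _).2 ⟨⟨x, hxn⟩,
    D.mem_eigen hx hxn, fun h => hx0 (congrArg Subtype.val h)⟩⟩

lemma add_mem_rootsN_of_isRoot {m : ℕ} {α β : D.Weight} (hα : α ∈ D.rootsN m)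
    (hβ : β ∈ D.rootsN m) (h : IsRoot (D.hh m) (D.res' m α + D.res' m β)) (h0 : α + β ≠ 0) :
    α + β ∈ D.rootsN m := by
  obtain ⟨x, hx, hxn, hx0⟩ := D.exists_of_mem_rootsN hα
  obtain ⟨y, hy, hyn, hy0⟩ := D.exists_of_mem_rootsN hβ
  exact D.mem_rootsN_of h0 (PositiveSystem.lie_mem_rootSpace hx hy) ((D.gt m).lie_mem hxn hyn)
    (D.lie_ne_zero_of_level hα.1 hβ.1 hx hy hxn hyn hx0 hy0 h)

/-- `𝔤̃ₙ` is the sum of `𝔥ₙ` and of root spaces. -/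
lemma gt_le_roots (n : ℕ) : (D.gt n).toSubmodule ≤
    D.cartan.toSubmodule ⊔ ⨆ α ∈ D.rootsN n, D.rootSpace α := by
  refine (D.gt_le_iSup n).trans (iSup_le fun α => ?_)
  by_cases h0 : α = 0
  · subst h0
    exact fun x hx => Submodule.mem_sup_left (D.mem_cartan_of_mem_rootSpace_zero hx.1)
  · by_cases h : D.rootSpace α ⊓ (D.gt n).toSubmodule = ⊥
    · rw [h]; exact bot_le
    · obtain ⟨x, hx, hx0⟩ := (Submodule.ne_bot_iff _).1 h
      exact inf_le_left.trans (le_sup_of_le_right (le_iSup₂ (f := fun γ (_ : γ ∈ D.rootsN n) =>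
        D.rootSpace γ) α (D.mem_rootsN_of h0 hx.1 hx.2 hx0)))

lemma gn_eq (n : ℕ) : (D.gn n).toSubmodule =
    D.cartan.toSubmodule ⊔ ⨆ α ∈ D.rootsN n, D.rootSpace α := by
  refine le_antisymm (fun x hx => ?_) (sup_le (D.cartan_le_gn n) (iSup₂_le fun α hα =>
    (D.rootSpace_le_gt hα).trans (D.gt_le_gn n)))
  obtain ⟨y, hy, h, hh, rfl⟩ := D.mem_gn.1 hx
  exact Submodule.add_mem _ (D.gt_le_roots n hy) (Submodule.mem_sup_left hh)

lemma gn_le_iSup (n : ℕ) : (D.gn n).toSubmodule ≤ ⨆ α ∈ insert 0 (D.rootsN n), D.rootSpace α := by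
  rw [D.gn_eq]
  refine sup_le (fun x hx => ?_) (biSup_mono fun _ h => Set.mem_insert_of_mem _ h)
  exact (le_iSup₂ (f := fun γ (_ : γ ∈ insert 0 (D.rootsN n)) => D.rootSpace γ) 0
    (Set.mem_insert _ _)) (D.cartan_le_rootSpace_zero hx)

omit [CharZero k] [IsAlgClosed k] in
/-- To check that `x` maps the sum of some root spaces into a subspace, it is enough to check it
on root vectors. -/
lemma lie_mem_of_mem_iSup {S T : Set D.Weight} {W : Submodule k g}
    (h : ∀ α ∈ S, ∀ β ∈ T, ∀ x ∈ D.rootSpace α, ∀ y ∈ D.rootSpace β, ⁅x, y⁆ ∈ W) {x y : g}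
    (hx : x ∈ ⨆ α ∈ S, D.rootSpace α) (hy : y ∈ ⨆ β ∈ T, D.rootSpace β) : ⁅x, y⁆ ∈ W := by
  have step : ∀ α ∈ S, ∀ x ∈ D.rootSpace α, ∀ y ∈ ⨆ β ∈ T, D.rootSpace β, ⁅x, y⁆ ∈ W := by
    intro α hα x hx y hy
    have hle : (⨆ β ∈ T, D.rootSpace β) ≤ W.comap (LieAlgebra.ad k g x : g →ₗ[k] g) :=
      iSup₂_le fun β hβ y hy => h α hα β hβ x hx y hy
    exact hle hy
  have hle : (⨆ α ∈ S, D.rootSpace α) ≤ W.comap (LieAlgebra.ad k g y : g →ₗ[k] g) :=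
    iSup₂_le fun α hα x hx => by
      change ⁅y, x⁆ ∈ W
      rw [← lie_skew]; exact Submodule.neg_mem _ (step α hα x hx y hy)
  rw [← lie_skew]; exact Submodule.neg_mem _ (hle hx)

/-! ### Positive systems, nilradicals and the separation of their roots from `ℤΦₙ` -/

namespace PositiveSystem

variable {D} (B : D.PositiveSystem)

omit [CharZero k] [IsAlgClosed k] in
lemma pos_subset_roots : B.pos ⊆ D.roots := by
  rw [B.union]; exact Set.subset_union_left

omit [CharZero k] [IsAlgClosed k] in
lemma neg_notMem {α : D.Weight} (h : α ∈ B.pos) : -α ∉ B.pos :=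
  Set.disjoint_left.1 B.disjoint h

omit [CharZero k] [IsAlgClosed k] in
lemma neg_mem_roots (B : D.PositiveSystem) {α : D.Weight} (h : α ∈ D.roots) : -α ∈ D.roots := by
  rw [B.union] at h ⊢
  rcases h with h | h
  · exact Or.inr (show - -α ∈ B.pos by rwa [neg_neg])
  · exact Or.inl h

omit [CharZero k] [IsAlgClosed k] in
lemma add_ne_zero_of_pos {α β : D.Weight} (hα : α ∈ B.pos) (hβ : β ∈ B.pos) : α + β ≠ 0 :=
  fun h => B.neg_notMem hα (by rwa [neg_eq_of_add_eq_zero_right h])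

/-- The roots `Φ⁺ ∖ Φₙ` of the nilradical of `𝔤ₙ + 𝔟`. -/
def uRoots (n : ℕ) : Set D.Weight := B.pos \ D.rootsN n

omit [CharZero k] [IsAlgClosed k] in
lemma rootSpace_le_uPlus {n : ℕ} {α : D.Weight} (h : α ∈ B.uRoots n) :
    D.rootSpace α ≤ B.uPlus n :=
  le_iSup₂ (f := fun γ (_ : γ ∈ B.uRoots n) => D.rootSpace γ) α h

omit [CharZero k] [IsAlgClosed k] in
lemma uPlus_le_nPlus (n : ℕ) : B.uPlus n ≤ B.nPlus :=
  biSup_mono fun _ h => h.1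

omit [CharZero k] [IsAlgClosed k] in
lemma nPlus_le_borel : B.nPlus ≤ B.borel.toSubmodule := le_sup_right

omit [CharZero k] [IsAlgClosed k] in
lemma cartan_le_borel : D.cartan.toSubmodule ≤ B.borel.toSubmodule := le_sup_left

variable {B}

/-- The bracket of root vectors is a nonzero vector of weight `α + β` in the subalgebra `𝔤̃ₙ + 𝔟`,
and the weights of the latter are zero, `Φₙ` and `Φ⁺`. -/
lemma IsDynkin.add_mem (hB : B.IsDynkin) {n : ℕ} {α β : D.Weight} (hα : α ∈ D.rootsN n)
    (hβ : β ∈ B.pos) (h : α + β ∈ D.roots) : α + β ∈ D.rootsN n ∪ B.pos := by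
  obtain ⟨x, hx, hxn, hx0⟩ := D.exists_of_mem_rootsN hα
  obtain ⟨y, hy, hy0⟩ := D.exists_of_mem_roots (B.pos_subset_roots hβ)
  obtain ⟨p, hp⟩ := hB n
  have hxp : x ∈ p := by
    change x ∈ p.toSubmodule
    rw [hp]; exact Submodule.mem_sup_left hxn
  have hyp : y ∈ p := by
    change y ∈ p.toSubmodule
    rw [hp]
    exact Submodule.mem_sup_right (B.nPlus_le_borel
      ((le_iSup₂ (f := fun γ (_ : γ ∈ B.pos) => D.rootSpace γ) β hβ) hy))
  have hxy : ⁅x, y⁆ ∈ p.toSubmodule := p.lie_mem hxp hyp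
  rw [hp] at hxy
  have hle : (D.gt n).toSubmodule ⊔ B.borel.toSubmodule ≤
      ⨆ γ ∈ insert 0 (D.rootsN n) ∪ B.pos, D.rootSpace γ := by
    have hl : (D.gn n).toSubmodule ≤ ⨆ γ ∈ insert 0 (D.rootsN n) ∪ B.pos, D.rootSpace γ :=
      (D.gn_le_iSup n).trans (biSup_mono fun _ h => Set.mem_union_left _ h)
    refine sup_le (le_trans (D.gt_le_gn n) hl) (sup_le (le_trans (D.cartan_le_gn n) hl) ?_)
    exact biSup_mono fun _ h => Set.mem_union_right _ h
  rcases D.mem_of_mem_iSup_rootSpace (lie_mem_rootSpace hx hy) (hle hxy)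
    (D.lie_ne_zero hα.1 (B.pos_subset_roots hβ).1 h hx hy hx0 hy0) with (h0 | h1) | h2
  · exact absurd h0 h.1
  · exact Or.inl h1
  · exact Or.inr h2

/-- If `α + β` were in `Φₙ`, then so would be `β = -α + (α + β)`. -/
lemma IsDynkin.add_mem_uRoots (hB : B.IsDynkin) {n : ℕ} {α β : D.Weight} (hα : α ∈ D.rootsN n)
    (hβ : β ∈ B.uRoots n) (h : α + β ∈ D.roots) : α + β ∈ B.uRoots n := by
  have hn : α + β ∉ D.rootsN n := fun hc => hβ.2 <| by
    have := D.add_mem_rootsN (D.neg_mem_rootsN hα) hc (by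
      rw [neg_add_cancel_left]; exact B.pos_subset_roots hβ.1)
    rwa [neg_add_cancel_left] at this
  exact ⟨(hB.add_mem hα hβ.1 h).resolve_left hn, hn⟩

/-- If `α + β` were in `Φₙ`, adding its negative to `α` would put `-β` among the nilradical roots,
which are positive. -/
lemma IsDynkin.uRoots_add_mem (hB : B.IsDynkin) {n : ℕ} {α β : D.Weight} (hα : α ∈ B.uRoots n)
    (hβ : β ∈ B.uRoots n) (h : α + β ∈ D.roots) : α + β ∈ B.uRoots n := by
  refine ⟨B.add_mem α hα.1 β hβ.1 h, fun hc => ?_⟩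
  have e : -(α + β) + α = -β := by abel
  have h1 := hB.add_mem_uRoots (D.neg_mem_rootsN hc) hα
    (by rw [e]; exact B.neg_mem_roots (B.pos_subset_roots hβ.1))
  rw [e] at h1
  exact B.neg_notMem hβ.1 h1.1

/-- The functionals which separate the nilradical from the Levi subalgebra, at a finite level. -/
lemma IsDynkin.exists_grading (hB : B.IsDynkin) {n m : ℕ} (hnm : n ≤ m) :
    ∃ h : D.cartan, (∀ α ∈ D.rootsN n, α h = 0) ∧
      ∀ β ∈ B.uRoots n ∩ D.rootsN m, ∃ c : ℕ, 0 < c ∧ β h = c := by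
  -- The Levi and nilradical roots of level `m` are restricted to `𝔥ₘ`. Restriction is injective on
  -- `Φₘ`, so disjointness and positivity survive, and sums that are roots at level `m` come from
  -- roots of `g`.
  obtain ⟨h, h1, h2⟩ := exists_coweight (H := D.hh m) (D.adSemisimple m)
    (D.res' m '' D.rootsN n) (D.res' m '' (B.uRoots n ∩ D.rootsN m))
    (by rintro _ ⟨α, hα, rfl⟩; exact D.isRoot_res' (D.rootsN_mono hnm hα))
    (by rintro _ ⟨α, hα, rfl⟩; exact D.isRoot_res' hα.2)
    (by rintro _ ⟨α, hα, rfl⟩; exact ⟨-α, D.neg_mem_rootsN hα, rfl⟩)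
    (by
      rintro _ ⟨α, hα, rfl⟩ _ ⟨β, hβ, rfl⟩ h
      have h3 := D.add_mem_rootsN_of_isRoot (D.rootsN_mono hnm hα) hβ.2 h (fun h0 => hβ.1.2 (by
        rw [← neg_eq_of_add_eq_zero_right h0]; exact D.neg_mem_rootsN hα))
      exact ⟨α + β, ⟨hB.add_mem_uRoots hα hβ.1 (D.rootsN_subset_roots m h3), h3⟩, rfl⟩)
    (by
      rintro _ ⟨α, hα, rfl⟩ _ ⟨β, hβ, rfl⟩ h
      have h3 := D.add_mem_rootsN_of_isRoot hα.2 hβ.2 h (B.add_ne_zero_of_pos hα.1.1 hβ.1.1)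
      exact ⟨α + β, ⟨hB.uRoots_add_mem hα.1 hβ.1 (D.rootsN_subset_roots m h3), h3⟩, rfl⟩)
    (by
      rintro _ ⟨α, hα, rfl⟩ ⟨β, hβ, h⟩
      have := D.res'_injOn m hβ.2 (D.neg_mem_rootsN hα.2) h
      exact B.neg_notMem hα.1.1 (this ▸ hβ.1.1))
    (by
      rw [Set.disjoint_left]
      rintro _ ⟨α, hα, rfl⟩ ⟨β, hβ, h⟩
      have := D.res'_injOn m hβ.2 (D.rootsN_mono hnm hα) h
      exact hβ.1.2 (this ▸ hα))
  refine ⟨⟨((h : D.gt m) : g), D.ht_le_cartan m h.2⟩, fun α hα => h1 _ ⟨α, hα, rfl⟩,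
    fun β hβ => h2 _ ⟨β, hβ, rfl⟩⟩

/-- A sum of positive roots, at least one of which is not in `Φₙ`, is not in `ℤΦₙ`. -/
lemma IsDynkin.add_notMem_closure (hB : B.IsDynkin) {n : ℕ} {β σ : D.Weight}
    (hβ : β ∈ B.uRoots n) (hσ : σ ∈ AddSubmonoid.closure B.pos) :
    β + σ ∉ AddSubgroup.closure (D.rootsN n) := by
  -- Separating elements of `𝔥` are available one finite level at a time. The threshold `m₀` is
  -- chosen so that all the roots occurring in `σ` have appeared.
  have key : ∃ m₀, ∀ m ≥ m₀, ∀ h : D.cartan, (∀ α ∈ D.rootsN n, α h = 0) →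
      (∀ β ∈ B.uRoots n ∩ D.rootsN m, ∃ c : ℕ, 0 < c ∧ β h = c) → ∃ c : ℕ, σ h = c := by
    induction hσ using AddSubmonoid.closure_induction with
    | zero => exact ⟨0, fun _ _ _ _ _ => ⟨0, by simp⟩⟩
    | mem x hx =>
      obtain ⟨m₀, hm₀⟩ := D.exists_mem_rootsN (B.pos_subset_roots hx)
      refine ⟨m₀, fun m hm h h1 h2 => ?_⟩
      by_cases hxn : x ∈ D.rootsN n
      · exact ⟨0, by rw [h1 x hxn]; simp⟩
      · obtain ⟨c, -, hc⟩ := h2 x ⟨⟨hx, hxn⟩, D.rootsN_mono hm hm₀⟩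
        exact ⟨c, hc⟩
    | add x y _ _ hx hy =>
      obtain ⟨m₁, h1⟩ := hx
      obtain ⟨m₂, h2⟩ := hy
      refine ⟨max m₁ m₂, fun m hm h h3 h4 => ?_⟩
      obtain ⟨c, hc⟩ := h1 m (le_trans (le_max_left _ _) hm) h h3 h4
      obtain ⟨c', hc'⟩ := h2 m (le_trans (le_max_right _ _) hm) h h3 h4
      exact ⟨c + c', by rw [LinearMap.add_apply, hc, hc']; push_cast; rfl⟩
  intro hmem
  obtain ⟨m₀, hm₀⟩ := key
  obtain ⟨m₁, hm₁⟩ := D.exists_mem_rootsN (B.pos_subset_roots hβ.1)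
  have hle : n ≤ max n (max m₀ m₁) := le_max_left _ _
  obtain ⟨h, h1, h2⟩ := hB.exists_grading hle
  obtain ⟨c, hc⟩ := hm₀ _ ((le_max_left _ _).trans (le_max_right _ _)) h h1 h2
  obtain ⟨c', hc0, hc'⟩ := h2 β ⟨hβ, D.rootsN_mono ((le_max_right _ _).trans (le_max_right _ _)) hm₁⟩
  have h0 : ∀ γ ∈ AddSubgroup.closure (D.rootsN n), γ h = 0 := by
    intro γ hγ
    induction hγ using AddSubgroup.closure_induction with
    | zero => simp
    | mem x hx => exact h1 x hx
    | add x y _ _ hx hy => rw [LinearMap.add_apply, hx, hy, add_zero]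
    | neg x _ hx => rw [LinearMap.neg_apply, hx, neg_zero]
  -- Elements of `ℤΦₙ` vanish at `h`, whereas `β + σ` takes a positive integer value there, nonzero
  -- in characteristic zero.
  have h3 := h0 _ hmem
  rw [LinearMap.add_apply, hc, hc', ← Nat.cast_add, Nat.cast_eq_zero] at h3
  omega

omit [CharZero k] [IsAlgClosed k] in
lemma mem_closure_pos_cases (n : ℕ) {σ : D.Weight} (hσ : σ ∈ AddSubmonoid.closure B.pos) :
    σ ∈ AddSubmonoid.closure (D.rootsN n ∩ B.pos) ∨
      ∃ β ∈ B.uRoots n, ∃ τ ∈ AddSubmonoid.closure B.pos, σ = β + τ := by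
  induction hσ using AddSubmonoid.closure_induction with
  | zero => exact Or.inl (zero_mem _)
  | mem x hx =>
    by_cases hxn : x ∈ D.rootsN n
    · exact Or.inl (AddSubmonoid.subset_closure ⟨hxn, hx⟩)
    · exact Or.inr ⟨x, ⟨hx, hxn⟩, 0, zero_mem _, by simp⟩
  | add x y hx' hy' hx hy =>
    rcases hx with hx | ⟨β, hβ, τ, hτ, rfl⟩
    · rcases hy with hy | ⟨β, hβ, τ, hτ, rfl⟩
      · exact Or.inl (AddMemClass.add_mem hx hy)
      · exact Or.inr ⟨β, hβ, x + τ, AddMemClass.add_mem hx' hτ, by abel⟩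
    · exact Or.inr ⟨β, hβ, τ + y, AddMemClass.add_mem hτ hy', by abel⟩

variable (B)

/-- The opposite nilradical. -/
def uMinus (n : ℕ) : Submodule k g := ⨆ α ∈ B.uRoots n, D.rootSpace (-α)

/-- `𝔫⁻ = ⨁_{α ∈ Φ⁺} 𝔤^{-α}`. -/
def nMinus : Submodule k g := ⨆ α ∈ B.pos, D.rootSpace (-α)

/-- The triangular decomposition relative to `𝔤ₙ + 𝔟`. `Generates.sup_eq_top` needs only that the
summands span, not that the sum is direct. -/
lemma top_le_uMinus (n : ℕ) : ⊤ ≤ B.uMinus n ⊔ ((D.gn n).toSubmodule ⊔ B.uPlus n) := by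
  rw [← D.iSup_rootSpace]
  refine iSup_le fun α => ?_
  by_cases h0 : α = 0
  · subst h0
    exact fun x hx => Submodule.mem_sup_right (Submodule.mem_sup_left
      (D.cartan_le_gn n (D.mem_cartan_of_mem_rootSpace_zero hx)))
  by_cases hb : D.rootSpace α = ⊥
  · rw [hb]; exact bot_le
  by_cases hn : α ∈ D.rootsN n
  · exact ((D.rootSpace_le_gt hn).trans (D.gt_le_gn n)).trans (le_sup_left.trans le_sup_right)
  have hα : α ∈ D.roots := ⟨h0, hb⟩
  rw [B.union] at hα
  rcases hα with h | h
  · exact (B.rootSpace_le_uPlus ⟨h, hn⟩).trans (le_sup_right.trans le_sup_right)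
  · have h1 : -α ∈ B.uRoots n := ⟨h, fun hc => hn (by simpa using D.neg_mem_rootsN hc)⟩
    have := le_iSup₂ (f := fun γ (_ : γ ∈ B.uRoots n) => D.rootSpace (-γ)) (-α) h1
    rw [neg_neg] at this
    exact this.trans le_sup_left

lemma top_le_nMinus : ⊤ ≤ B.nMinus ⊔ B.borel.toSubmodule := by
  rw [← D.iSup_rootSpace]
  refine iSup_le fun α => ?_
  by_cases h0 : α = 0
  · subst h0
    exact fun x hx => Submodule.mem_sup_right (B.cartan_le_borel
      (D.mem_cartan_of_mem_rootSpace_zero hx))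
  by_cases hb : D.rootSpace α = ⊥
  · rw [hb]; exact bot_le
  have hα : α ∈ D.roots := ⟨h0, hb⟩
  rw [B.union] at hα
  rcases hα with h | h
  · exact (le_iSup₂ (f := fun γ (_ : γ ∈ B.pos) => D.rootSpace γ) α h).trans
      (B.nPlus_le_borel.trans le_sup_right)
  · have := le_iSup₂ (f := fun γ (_ : γ ∈ B.pos) => D.rootSpace (-γ)) (-α) h
    rw [neg_neg] at this
    exact this.trans le_sup_left

lemma gn_le_nMinus (n : ℕ) : (D.gn n).toSubmodule ≤
    (⨆ α ∈ D.rootsN n ∩ B.pos, D.rootSpace (-α)) ⊔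
      (B.borel.toSubmodule ⊓ (D.gn n).toSubmodule) := by
  conv_lhs => rw [D.gn_eq]
  refine sup_le (le_sup_of_le_right (le_inf B.cartan_le_borel (D.cartan_le_gn n)))
    (iSup₂_le fun α hα => ?_)
  have hα' := D.rootsN_subset_roots n hα
  rw [B.union] at hα'
  rcases hα' with h | h
  · exact le_sup_of_le_right (le_inf
      ((le_iSup₂ (f := fun γ (_ : γ ∈ B.pos) => D.rootSpace γ) α h).trans B.nPlus_le_borel)
      ((D.rootSpace_le_gt hα).trans (D.gt_le_gn n)))
  · have := le_iSup₂ (f := fun γ (_ : γ ∈ D.rootsN n ∩ B.pos) => D.rootSpace (-γ)) (-α)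
      ⟨D.neg_mem_rootsN hα, h⟩
    rw [neg_neg] at this
    exact this.trans le_sup_left

lemma nPlus_le_sup (n : ℕ) : B.nPlus ≤
    (B.nPlus ⊓ (D.gn n).toSubmodule) ⊔ B.uPlus n := by
  refine iSup₂_le fun α hα => ?_
  by_cases hn : α ∈ D.rootsN n
  · exact le_sup_of_le_left (le_inf
      (le_iSup₂ (f := fun γ (_ : γ ∈ B.pos) => D.rootSpace γ) α hα)
      ((D.rootSpace_le_gt hn).trans (D.gt_le_gn n)))
  · exact le_sup_of_le_right (B.rootSpace_le_uPlus ⟨hα, hn⟩)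

lemma borel_le_sup (n : ℕ) : B.borel.toSubmodule ≤
    (B.borel.toSubmodule ⊓ (D.gn n).toSubmodule) ⊔ B.uPlus n :=
  sup_le (le_sup_of_le_left (le_inf B.cartan_le_borel (D.cartan_le_gn n)))
    ((B.nPlus_le_sup n).trans (sup_le_sup_right (inf_le_inf_right _ B.nPlus_le_borel) _))

lemma disjoint_gn_uPlus (n : ℕ) : Disjoint (D.gn n).toSubmodule (B.uPlus n) := by
  refine (D.iSupIndep_rootSpace.disjoint_biSup_biSup ?_).mono_left (D.gn_le_iSup n)
  rw [Set.disjoint_left]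
  rintro α (rfl | h) h'
  · exact (B.pos_subset_roots h'.1).1 rfl
  · exact h'.2 h

variable {B}

lemma IsDynkin.gn_lie_mem_uPlus (hB : B.IsDynkin) {n : ℕ} {x y : g} (hx : x ∈ D.gn n)
    (hy : y ∈ B.uPlus n) : ⁅x, y⁆ ∈ B.uPlus n := by
  refine D.lie_mem_of_mem_iSup ?_ (D.gn_le_iSup n hx) hy
  rintro α hα β hβ x hx y hy
  have h := lie_mem_rootSpace hx hy
  rcases hα with rfl | hα
  · rw [zero_add] at h
    exact B.rootSpace_le_uPlus hβ h
  by_cases h0 : ⁅x, y⁆ = 0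
  · rw [h0]; exact Submodule.zero_mem _
  refine B.rootSpace_le_uPlus (hB.add_mem_uRoots hα hβ (D.mem_roots_of (fun hc => hβ.2 ?_) h h0)) h
  rw [← neg_eq_of_add_eq_zero_right hc]; exact D.neg_mem_rootsN hα

lemma IsDynkin.uPlus_lie_mem_uPlus (hB : B.IsDynkin) {n : ℕ} {x y : g} (hx : x ∈ B.uPlus n)
    (hy : y ∈ B.uPlus n) : ⁅x, y⁆ ∈ B.uPlus n := by
  refine D.lie_mem_of_mem_iSup ?_ hx hy
  rintro α hα β hβ x hx y hy
  have h := lie_mem_rootSpace hx hy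
  by_cases h0 : ⁅x, y⁆ = 0
  · rw [h0]; exact Submodule.zero_mem _
  exact B.rootSpace_le_uPlus (hB.uRoots_add_mem hα hβ (D.mem_roots_of
    (B.add_ne_zero_of_pos hα.1 hβ.1) h h0)) h

end PositiveSystem

end RootReductive

end CatO

namespace CatO

/-! ## Generalities on modules over enveloping algebras -/

section Env

variable {k : Type u} [Field k] {L : Type u} [LieRing L] [LieAlgebra k L]

attribute [local instance] LieRing.ofAssociativeRing

lemma toEnv_lie (x y : L) : toEnv k ⁅x, y⁆ = toEnv k x * toEnv k y - toEnv k y * toEnv k x :=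
  LieHom.map_lie _ x y

lemma lie_smul_eq (M : ModuleCat.{u} (Env k L)) (x y : L) (m : M) :
    toEnv k ⁅x, y⁆ • m = toEnv k x • toEnv k y • m - toEnv k y • toEnv k x • m := by
  rw [toEnv_lie, sub_smul, mul_smul, mul_smul]

lemma smul_smul_lie (M : ModuleCat.{u} (Env k L)) (x y : L) (m : M) :
    toEnv k x • toEnv k y • m = toEnv k y • toEnv k x • m + toEnv k ⁅x, y⁆ • m := by
  rw [lie_smul_eq]; abel

lemma toEnv_add_smul (M : ModuleCat.{u} (Env k L)) (x y : L) (m : M) :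
    toEnv k (x + y) • m = toEnv k x • m + toEnv k y • m := by
  rw [toEnv, map_add, add_smul]

lemma toEnv_smul_smul (M : ModuleCat.{u} (Env k L)) (c : k) (x : L) (m : M) :
    toEnv k (c • x) • m = c • toEnv k x • m := by
  rw [toEnv, map_smul, smul_assoc]

/-- The inclusion of `L` in `T` lifts to `U(L) → T`. Followed by the inclusion of `T`, it is the
identity by the universal property. -/
lemma env_eq_top (T : Subalgebra k (Env k L)) (hT : ∀ x : L, toEnv k x ∈ T) (a : Env k L) :
    a ∈ T := by
  let φ : L →ₗ⁅k⁆ T :=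
    { toFun := fun x => ⟨toEnv k x, hT x⟩
      map_add' := fun x y => Subtype.ext (map_add _ x y)
      map_smul' := fun c x => Subtype.ext (map_smul _ c x)
      map_lie' := fun {x y} => Subtype.ext (toEnv_lie x y) }
  have h : T.val.comp (UniversalEnvelopingAlgebra.lift k φ) = AlgHom.id k _ := by
    apply UniversalEnvelopingAlgebra.hom_ext
    ext x
    simp [φ]
  have := DFunLike.congr_fun h a
  rw [AlgHom.id_apply] at this
  rw [← this]
  exact (UniversalEnvelopingAlgebra.lift k φ a).2

/-- A subspace which is stable under `L` is stable under `U(L)`. -/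
lemma env_smul_mem {M : ModuleCat.{u} (Env k L)} (S : Submodule k M)
    (hS : ∀ x : L, ∀ m ∈ S, toEnv k x • m ∈ S) (a : Env k L) {m : M} (hm : m ∈ S) : a • m ∈ S := by
  let T : Subalgebra k (Env k L) :=
    { carrier := {a | ∀ m ∈ S, a • m ∈ S}
      mul_mem' := fun {a b} ha hb m hm => by rw [mul_smul]; exact ha _ (hb m hm)
      add_mem' := fun {a b} ha hb m hm => by rw [add_smul]; exact S.add_mem (ha m hm) (hb m hm)
      algebraMap_mem' := fun c m hm => by rw [algebraMap_smul]; exact S.smul_mem c hm }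
  exact env_eq_top T (fun x m hm => hS x m hm) a m hm

/-- A linear map commuting with `L` is a morphism of `U(L)`-modules. -/
def homOfLie {M N : ModuleCat.{u} (Env k L)} (f : M →ₗ[k] N)
    (hf : ∀ (x : L) (m : M), f (toEnv k x • m) = toEnv k x • f m) : M ⟶ N :=
  ModuleCat.ofHom
    { toFun := f
      map_add' := f.map_add
      map_smul' := fun a => by
        let T : Subalgebra k (Env k L) :=
          { carrier := {a | ∀ m, f (a • m) = a • f m}
            mul_mem' := fun {a b} ha hb m => by rw [mul_smul, ha, hb, mul_smul]
            add_mem' := fun {a b} ha hb m => by rw [add_smul, map_add, ha, hb, add_smul]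
            algebraMap_mem' := fun c m => by rw [algebraMap_smul, map_smul, algebraMap_smul] }
        exact env_eq_top T (fun x m => hf x m) a }

/-- A representation of `L` is a `U(L)`-module. -/
lemma exists_moduleCat {N : Type u} [AddCommGroup N] [Module k N] (T : L →ₗ[k] Module.End k N)
    (hT : ∀ x y n, T ⁅x, y⁆ n = T x (T y n) - T y (T x n)) :
    ∃ (X : ModuleCat.{u} (Env k L)) (e : N ≃ₗ[k] X), ∀ x n, e (T x n) = toEnv k x • e n := by
  let φ : L →ₗ⁅k⁆ Module.End k N :=
    { T with map_lie' := fun {x y} => LinearMap.ext fun n => hT x y n }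
  let F : Env k L →ₐ[k] Module.End k N := UniversalEnvelopingAlgebra.lift k φ
  obtain ⟨X, e, he⟩ : ∃ (X : ModuleCat.{u} (Env k L)) (e : N ≃+ X), ∀ a n, e (F a n) = a • e n :=
    let _ : Module (Env k L) N := Module.compHom N F.toRingHom
    ⟨ModuleCat.of (Env k L) N, AddEquiv.refl N, fun _ _ => rfl⟩
  refine ⟨X, e.toLinearEquiv fun c n => ?_, fun x n => ?_⟩
  · rw [← algebraMap_smul (Env k L) c (e n), ← he, AlgHom.commutes]; rfl
  · have h := he (toEnv k x) n
    rw [UniversalEnvelopingAlgebra.lift_ι_apply] at h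
    exact h

/-- The action of an element of `L`, as a linear map. -/
def act (M : ModuleCat.{u} (Env k L)) (x : L) : M →ₗ[k] M where
  toFun m := toEnv k x • m
  map_add' := smul_add _
  map_smul' c m := by rw [smul_algebra_smul_comm]; rfl

/-- `M` is generated by the subspace `W`. -/
def Generates {M : ModuleCat.{u} (Env k L)} (W : Submodule k M) : Prop :=
  ∀ S : Submodule k M, (∀ x : L, ∀ m ∈ S, toEnv k x • m ∈ S) → W ≤ S → S = ⊤

lemma generates_of_span {M : ModuleCat.{u} (Env k L)} (W : Submodule k M)
    (hW : Submodule.span (Env k L) (W : Set M) = ⊤) : Generates W := fun S hS hWS => by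
  rw [eq_top_iff]
  intro m _
  have hm : m ∈ Submodule.span (Env k L) (W : Set M) := hW ▸ Submodule.mem_top
  induction hm using Submodule.span_induction with
  | mem x hx => exact hWS hx
  | zero => exact S.zero_mem
  | add x y _ _ hx hy => exact S.add_mem (hx trivial) (hy trivial)
  | smul a x _ hx => exact env_smul_mem S hS a (hx trivial)

lemma Generates.hom_ext {M N : ModuleCat.{u} (Env k L)} {W : Submodule k M} (hW : Generates W)
    {f f' : M ⟶ N} (h : ∀ m ∈ W, f.hom m = f'.hom m) : f = f' := by
  have := hW (LinearMap.eqLocus (f.hom.restrictScalars k) (f'.hom.restrictScalars k))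
    (fun x m hm => by
      change f.hom _ = f'.hom _
      rw [map_smul, map_smul]
      exact congrArg _ hm) h
  ext m
  have hm : m ∈ LinearMap.eqLocus (f.hom.restrictScalars k) (f'.hom.restrictScalars k) :=
    this ▸ Submodule.mem_top
  exact hm

/-- If `L = A + P` and the `P`-stable subspace `W` generates `M`, then `M` is the sum of `W` and of
an `A`-stable subspace which contains `A W`. -/
lemma Generates.sup_eq_top {M : ModuleCat.{u} (Env k L)} {W : Submodule k M} (hW : Generates W)
    (A P : Submodule k L) (hAP : ⊤ ≤ A ⊔ P) (hP : ∀ p ∈ P, ∀ w ∈ W, toEnv k p • w ∈ W)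
    (Z : Submodule k M) (hZ₁ : ∀ a ∈ A, ∀ w ∈ W, toEnv k a • w ∈ Z)
    (hZ₂ : ∀ a ∈ A, ∀ z ∈ Z, toEnv k a • z ∈ Z) : W ⊔ Z = ⊤ := by
  -- This takes the place of a factorization `U(L) = U(A) U(P)`. `Y` is the `A`-stable hull of `W`,
  -- and `Y'` consists of its vectors that `P` sends back into `Y`. From `p a s = a p s + ⁅p, a⁆ s`,
  -- with the bracket split along `A + P`, the subspace `Y'` is `A`-stable; hence `Y` is `L`-stable.
  let Y : Submodule k M := sInf {S | W ≤ S ∧ ∀ a ∈ A, ∀ s ∈ S, toEnv k a • s ∈ S}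
  have hYW : W ≤ Y := le_sInf fun S hS => hS.1
  have hYA : ∀ a ∈ A, ∀ s ∈ Y, toEnv k a • s ∈ Y := fun a ha s hs => by
    rw [Submodule.mem_sInf] at hs ⊢
    exact fun S hS => hS.2 a ha s (hs S hS)
  have hdec : ∀ x : L, ∀ m ∈ Y, (∀ p ∈ P, toEnv k p • m ∈ Y) → toEnv k x • m ∈ Y := by
    intro x m hm hp
    obtain ⟨a, ha, p, hp', rfl⟩ := Submodule.mem_sup.1 (hAP (x := x) trivial)
    rw [toEnv_add_smul]
    exact Y.add_mem (hYA a ha m hm) (hp p hp')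
  let Y' : Submodule k M := Y ⊓ ⨅ p ∈ P, Y.comap (act M p)
  have hY'mem : ∀ m, m ∈ Y' ↔ m ∈ Y ∧ ∀ p ∈ P, toEnv k p • m ∈ Y := fun m => by
    simp [Y', act]
  have hYY' : Y ≤ Y' := sInf_le ⟨fun w hw => (hY'mem w).2 ⟨hYW hw, fun p hp => hYW (hP p hp w hw)⟩,
    fun a ha s hs => by
      rw [hY'mem] at hs ⊢
      refine ⟨hYA a ha s hs.1, fun p hp => ?_⟩
      rw [smul_smul_lie]
      exact Y.add_mem (hYA a ha _ (hs.2 p hp)) (hdec _ s hs.1 hs.2)⟩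
  have htop : Y = ⊤ := hW Y (fun x m hm => hdec x m hm ((hY'mem m).1 (hYY' hm)).2) hYW
  rw [eq_top_iff, ← htop]
  refine sInf_le ⟨le_sup_left, fun a ha s hs => ?_⟩
  obtain ⟨w, hw, z, hz, rfl⟩ := Submodule.mem_sup.1 hs
  rw [smul_add]
  exact Submodule.mem_sup_right (Z.add_mem (hZ₁ a ha w hw) (hZ₂ a ha z hz))

/-- A vector is good if it lies in a finite dimensional `b`-stable subspace which is killed by
almost all of the spaces `U N`. -/
def IsGood (b : LieSubalgebra k L) (U : ℕ → Submodule k L) {M : ModuleCat.{u} (Env k L)} (m : M) :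
    Prop :=
  ∃ W : Submodule k M, m ∈ W ∧ FiniteDimensional k W ∧ (∀ x ∈ b, ∀ w ∈ W, toEnv k x • w ∈ W) ∧
    ∃ N, ∀ x ∈ U N, ∀ w ∈ W, toEnv k x • w = 0

/-- Good vectors form a submodule. Goodness keeps an infinite dimensional `b` under control:
brackets of `b` with `F N` stay in the finite dimensional `F N`, up to elements of `U N` that kill
the chosen subspace. -/
lemma Generates.isLocallyFinite {M : ModuleCat.{u} (Env k L)} {W : Submodule k M}
    (hW : Generates W) (b : LieSubalgebra k L) (F U : ℕ → Submodule k L)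
    [∀ N, FiniteDimensional k (F N)] (hU : Antitone U)
    (hbF : ∀ N, ∀ x ∈ b, ∀ y ∈ F N, ⁅x, y⁆ ∈ F N ⊔ U N)
    (hUF : ∀ N, ∀ x ∈ U N, ∀ y ∈ F N, ⁅x, y⁆ ∈ U N)
    (hex : ∀ (y : L) (N₀ : ℕ), ∃ N ≥ N₀, y ∈ F N ⊔ b.toSubmodule)
    (hgood : ∀ w ∈ W, IsGood b U w) : IsLocallyFinite b M := by
  let S : Submodule k M :=
    { carrier := {m | IsGood b U m}
      zero_mem' := ⟨⊥, Submodule.zero_mem _, inferInstance,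
        fun x _ w hw => by rw [(Submodule.mem_bot k).1 hw, smul_zero]; exact Submodule.zero_mem _,
        0, fun x _ w hw => by rw [(Submodule.mem_bot k).1 hw, smul_zero]⟩
      add_mem' := by
        rintro m m' ⟨V, hm, hV, hb, N, hN⟩ ⟨V', hm', hV', hb', N', hN'⟩
        refine ⟨V ⊔ V', Submodule.add_mem_sup hm hm', inferInstance, ?_, max N N', ?_⟩
        · intro x hx w hw
          obtain ⟨v, hv, v', hv', rfl⟩ := Submodule.mem_sup.1 hw
          rw [smul_add]
          exact Submodule.add_mem_sup (hb x hx v hv) (hb' x hx v' hv')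
        · intro x hx w hw
          obtain ⟨v, hv, v', hv', rfl⟩ := Submodule.mem_sup.1 hw
          rw [smul_add, hN x (hU (le_max_left _ _) hx) v hv,
            hN' x (hU (le_max_right _ _) hx) v' hv', add_zero]
      smul_mem' := by
        rintro c m ⟨V, hm, h⟩
        exact ⟨V, V.smul_mem c hm, h⟩ }
  have hS : S = ⊤ := by
    refine hW S (fun y m hm => ?_) hgood
    obtain ⟨V, hmV, hV, hb, N₀, hN₀⟩ := hm
    -- `N` is large enough for `U N` to kill `V` and for `y` to lie in `F N + b`. Then `V + F N • V`
    -- contains `y m`, and commuting `b` and `U N` past `F N` shows that it is again `b`-stable and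
    -- killed by `U N`.
    obtain ⟨N, hN, hy⟩ := hex y N₀
    have hN' : ∀ x ∈ U N, ∀ w ∈ V, toEnv k x • w = 0 := fun x hx => hN₀ x (hU hN hx)
    let β : L →ₗ[k] M →ₗ[k] M := LinearMap.mk₂ k (fun x m => toEnv k x • m)
      (fun x x' m => toEnv_add_smul M x x' m) (fun c x m => toEnv_smul_smul M c x m)
      (fun x m m' => smul_add _ _ _) (fun c x m => (act M x).map_smul c m)
    have hmem : ∀ f ∈ F N, ∀ v ∈ V, toEnv k f • v ∈ Submodule.map₂ β (F N) V :=
      fun f hf v hv => Submodule.apply_mem_map₂ β hf hv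
    have hfin : FiniteDimensional k (Submodule.map₂ β (F N) V) := by
      refine Module.Finite.iff_fg.2 (Submodule.FG.map₂ β ?_ ?_)
      · exact Module.Finite.iff_fg.1 inferInstance
      · exact Module.Finite.iff_fg.1 hV
    have hFU : ∀ z ∈ F N ⊔ U N, ∀ v ∈ V, toEnv k z • v ∈ V ⊔ Submodule.map₂ β (F N) V := by
      intro z hz v hv
      obtain ⟨f, hf, u, hu, rfl⟩ := Submodule.mem_sup.1 hz
      rw [toEnv_add_smul, hN' u hu v hv, add_zero]
      exact Submodule.mem_sup_right (hmem f hf v hv)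
    refine ⟨V ⊔ Submodule.map₂ β (F N) V, ?_, inferInstance, ?_, N, ?_⟩
    · obtain ⟨f, hf, x, hx, rfl⟩ := Submodule.mem_sup.1 hy
      rw [toEnv_add_smul]
      exact Submodule.add_mem _ (Submodule.mem_sup_right (hmem f hf m hmV))
        (Submodule.mem_sup_left (hb x hx m hmV))
    · intro x hx
      have h1 : V ⊔ Submodule.map₂ β (F N) V ≤
          (V ⊔ Submodule.map₂ β (F N) V).comap (act M x) := by
        refine sup_le (fun v hv => Submodule.mem_sup_left (hb x hx v hv))
          (Submodule.map₂_le.2 fun f hf v hv => ?_)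
        change toEnv k x • toEnv k f • v ∈ V ⊔ Submodule.map₂ β (F N) V
        rw [smul_smul_lie]
        exact Submodule.add_mem _ (Submodule.mem_sup_right (hmem f hf _ (hb x hx v hv)))
          (hFU _ (hbF N x hx f hf) v hv)
      exact fun w hw => h1 hw
    · intro x hx
      have h1 : V ⊔ Submodule.map₂ β (F N) V ≤ LinearMap.ker (act M x) := by
        refine sup_le (fun v hv => hN' x hx v hv) (Submodule.map₂_le.2 fun f hf v hv => ?_)
        change toEnv k x • toEnv k f • v = 0
        rw [smul_smul_lie, hN' x hx v hv, smul_zero, zero_add]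
        exact hN' _ (hUF N x hx f hf) v hv
      exact fun w hw => h1 hw
  intro m
  have hm : m ∈ S := hS ▸ Submodule.mem_top
  obtain ⟨V, hmV, hV, hb, _⟩ := hm
  exact ⟨V, hmV, hV, hb⟩

section Weights

variable {H : Type u} [AddCommGroup H] [Module k H] (j : H →ₗ[k] L)

/-- The weight spaces of the adjoint representation. -/
def adWeightSpace (α : Module.Dual k H) : Submodule k L where
  carrier := {x | ∀ h : H, ⁅j h, x⁆ = α h • x}
  add_mem' := fun {a b} ha hb h => by rw [lie_add, smul_add, ha h, hb h]
  zero_mem' := fun h => by rw [lie_zero, smul_zero]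
  smul_mem' := fun c m hm h => by rw [lie_smul, hm h, smul_comm]

lemma iSupIndep_weightSpace (M : ModuleCat.{u} (Env k L)) : iSupIndep (weightSpace j M) :=
  iSupIndep_of_forall_eq_smul (fun h => act M (j h)) _ fun _ _ hm h => hm h

variable {j}

lemma smul_mem_weightSpace {M : ModuleCat.{u} (Env k L)} {α μ : Module.Dual k H} {x : L} {m : M}
    (hx : x ∈ adWeightSpace j α) (hm : m ∈ weightSpace j M μ) :
    toEnv k x • m ∈ weightSpace j M (α + μ) := fun h => by
  rw [smul_smul_lie, hm h, hx h, toEnv_smul_smul, LinearMap.add_apply, add_smul, add_comm]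
  congr 1
  exact (act M x).map_smul (μ h) m

/-- If `A` is spanned by weight vectors, then it maps a sum of weight spaces to a sum of weight
spaces. -/
lemma smul_mem_iSup_weightSpace {M : ModuleCat.{u} (Env k L)} {ι : Type*} {S : Set ι}
    {wt : ι → Module.Dual k H} {K K' : Set (Module.Dual k H)}
    (hK : ∀ α ∈ S, ∀ μ ∈ K, wt α + μ ∈ K') {x : L}
    (hx : x ∈ ⨆ α ∈ S, adWeightSpace j (wt α)) {m : M} (hm : m ∈ ⨆ μ ∈ K, weightSpace j M μ) :
    toEnv k x • m ∈ ⨆ μ ∈ K', weightSpace j M μ := by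
  have step : ∀ α ∈ S, ∀ x ∈ adWeightSpace j (wt α), ∀ m ∈ ⨆ μ ∈ K, weightSpace j M μ,
      toEnv k x • m ∈ ⨆ μ ∈ K', weightSpace j M μ := by
    intro α hα x hx m hm
    have hle : (⨆ μ ∈ K, weightSpace j M μ) ≤
        (⨆ μ ∈ K', weightSpace j M μ).comap (act M x) :=
      iSup₂_le fun μ hμ m hm => (le_iSup₂ (f := fun μ (_ : μ ∈ K') => weightSpace j M μ) _
        (hK α hα μ hμ)) (smul_mem_weightSpace hx hm)
    exact hle hm
  let actm : L →ₗ[k] M :=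
    { toFun := fun x => toEnv k x • m
      map_add' := fun x y => toEnv_add_smul M x y m
      map_smul' := fun c x => toEnv_smul_smul M c x m }
  have hle : (⨆ α ∈ S, adWeightSpace j (wt α)) ≤
      (⨆ μ ∈ K', weightSpace j M μ).comap actm :=
    iSup₂_le fun α hα x hx => step α hα x hx m hm
  exact hle hx

variable (j) in
lemma disjoint_weights (M : ModuleCat.{u} (Env k L)) {K K' : Set (Module.Dual k H)}
    (h : Disjoint K K') :
    Disjoint (⨆ μ ∈ K, weightSpace j M μ) (⨆ μ ∈ K', weightSpace j M μ) :=
  (iSupIndep_weightSpace j M).disjoint_biSup_biSup h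

variable (j) in
lemma weights_mono (M : ModuleCat.{u} (Env k L)) {K K' : Set (Module.Dual k H)} (h : K ⊆ K') :
    (⨆ μ ∈ K, weightSpace j M μ) ≤ ⨆ μ ∈ K', weightSpace j M μ :=
  biSup_mono fun _ hμ => h hμ

lemma mem_weights {M : ModuleCat.{u} (Env k L)} {K : Set (Module.Dual k H)} {μ : Module.Dual k H}
    (hμ : μ ∈ K) {m : M} (hm : m ∈ weightSpace j M μ) : m ∈ ⨆ μ ∈ K, weightSpace j M μ :=
  (le_iSup₂ (f := fun μ (_ : μ ∈ K) => weightSpace j M μ) μ hμ) hm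

/-- In a module with weights in `K`, only the weights in `K` contribute. -/
lemma weights_inter {M : ModuleCat.{u} (Env k L)} {K : Set (Module.Dual k H)}
    (hM : ⨆ μ ∈ K, weightSpace j M μ = ⊤) (K' : Set (Module.Dual k H)) :
    (⨆ μ ∈ K', weightSpace j M μ) ≤ ⨆ μ ∈ K' ∩ K, weightSpace j M μ := by
  refine iSup₂_le fun μ hμ => ?_
  by_cases h : weightSpace j M μ = ⊥
  · rw [h]; exact bot_le
  · exact fun m hm => mem_weights (show μ ∈ K' ∩ K from ⟨hμ, ((weight_support_iff j M K).2 hM).2 h⟩) hm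

end Weights

/-! ### Verma modules -/

section Verma

variable {H : Type u} [AddCommGroup H] [Module k H] (j : H →ₗ[k] L) (n : Submodule k L)
  (lam : Module.Dual k H)

/-- The canonical generator of a Verma module. -/
def vermaGen : verma j n lam := Submodule.Quotient.mk (1 : Env k L)

lemma smul_vermaGen (a : Env k L) :
    a • vermaGen j n lam = (Submodule.Quotient.mk a : verma j n lam) := by
  change (Submodule.Quotient.mk (a * 1) : verma j n lam) = _
  rw [mul_one]

lemma vermaGen_mem : vermaGen j n lam ∈ weightSpace j (verma j n lam) lam := fun h => by
  have h1 : (Submodule.Quotient.mk (toEnv k (j h)) : verma j n lam) =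
      Submodule.Quotient.mk (algebraMap k (Env k L) (lam h)) := by
    refine (Submodule.Quotient.eq _).2 (Submodule.subset_span ?_)
    exact Or.inr ⟨h, rfl⟩
  rw [smul_vermaGen, h1, ← smul_vermaGen]
  rfl

lemma smul_vermaGen_eq_zero {x : L} (hx : x ∈ n) : toEnv k x • vermaGen j n lam = 0 := by
  rw [smul_vermaGen]
  refine (Submodule.Quotient.mk_eq_zero _).2 (Submodule.subset_span ?_)
  exact Or.inl ⟨x, hx, rfl⟩

lemma generates_vermaGen : Generates (Submodule.span k {vermaGen j n lam}) := by
  refine generates_of_span _ (eq_top_iff.2 fun m _ => ?_)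
  obtain ⟨a, rfl⟩ := Submodule.Quotient.mk_surjective _ m
  rw [← smul_vermaGen]
  exact Submodule.smul_mem _ _ (Submodule.subset_span (Submodule.mem_span_singleton_self _))

variable {j n lam}

/-- The universal property of Verma modules. -/
lemma exists_vermaHom {X : ModuleCat.{u} (Env k L)} {v : X} (hv : v ∈ weightSpace j X lam)
    (hn : ∀ x ∈ n, toEnv k x • v = 0) :
    ∃ f : verma j n lam ⟶ X, f.hom (vermaGen j n lam) = v := by
  refine ⟨ModuleCat.ofHom (Submodule.liftQ _ (LinearMap.toSpanSingleton (Env k L) X v) ?_), ?_⟩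
  · refine Submodule.span_le.2 ?_
    rintro _ (⟨x, hx, rfl⟩ | ⟨h, rfl⟩)
    · exact hn x hx
    · change (toEnv k (j h) - algebraMap k (Env k L) (lam h)) • v = 0
      rw [sub_smul, hv h]
      exact sub_self _
  · exact one_smul _ v

end Verma

/-! ### Parabolic induction -/

section Ind

variable {g : Type u} [LieRing g] [LieAlgebra k g] (l : LieSubalgebra k g) (uu : Submodule k g)
  (M : ModuleCat.{u} (Env k l))

/-- The canonical map `M → Ind M`. -/
def indUnit : M →ₗ[k] (parabolicInd l uu).obj M where
  toFun m := Submodule.Quotient.mk ((1 : Env k g) ⊗ₜ[k] m)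
  map_add' m m' := by rw [TensorProduct.tmul_add]; rfl
  map_smul' c m := by
    have : (1 : Env k g) ⊗ₜ[k] (c • m) = algebraMap k (Env k g) c • ((1 : Env k g) ⊗ₜ[k] m) := by
      rw [algebraMap_smul, TensorProduct.tmul_smul]
    rw [this]; rfl

variable {M}

lemma smul_indUnit (a : Env k g) (m : M) : a • indUnit l uu M m =
    (Submodule.Quotient.mk (a ⊗ₜ[k] m) : (parabolicInd l uu).obj M) := by
  change (Submodule.Quotient.mk (a • ((1 : Env k g) ⊗ₜ[k] m)) : (parabolicInd l uu).obj M) = _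
  rw [TensorProduct.smul_tmul', smul_eq_mul, mul_one]

lemma smul_indUnit_of_mem (y : l) (m : M) :
    toEnv k (y : g) • indUnit l uu M m = indUnit l uu M (toEnv k y • m) := by
  rw [smul_indUnit]
  exact (Submodule.Quotient.eq _).2 (Submodule.subset_span (Or.inl ⟨y, m, rfl⟩))

lemma smul_indUnit_eq_zero {x : g} (hx : x ∈ uu) (m : M) :
    toEnv k x • indUnit l uu M m = 0 := by
  rw [smul_indUnit]
  exact (Submodule.Quotient.mk_eq_zero _).2 (Submodule.subset_span (Or.inr ⟨x, hx, m, rfl⟩))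

lemma generates_indUnit : Generates (LinearMap.range (indUnit l uu M)) := by
  refine generates_of_span _ (eq_top_iff.2 fun m _ => ?_)
  obtain ⟨t, rfl⟩ := Submodule.Quotient.mk_surjective _ m
  induction t using TensorProduct.induction_on with
  | zero => exact Submodule.zero_mem _
  | tmul a m =>
    rw [← smul_indUnit]
    exact Submodule.smul_mem _ _ (Submodule.subset_span ⟨m, rfl⟩)
  | add x y hx hy => exact Submodule.add_mem _ (hx trivial) (hy trivial)

variable {l uu}

/-- The universal property of parabolic induction. -/
lemma exists_indHom {X : ModuleCat.{u} (Env k g)} (f : M →ₗ[k] X)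
    (hf : ∀ (y : l) (m : M), f (toEnv k y • m) = toEnv k (y : g) • f m)
    (hu : ∀ x ∈ uu, ∀ m, toEnv k x • f m = 0) :
    ∃ F : (parabolicInd l uu).obj M ⟶ X, ∀ m, F.hom (indUnit l uu M m) = f m := by
  let F₀ : Env k g ⊗[k] M →ₗ[Env k g] X :=
    TensorProduct.AlgebraTensorModule.lift
      { toFun := fun a =>
          { toFun := fun m => a • f m
            map_add' := fun m m' => by rw [map_add, smul_add]
            map_smul' := fun c m => by
              rw [map_smul, smul_algebra_smul_comm]; rfl }
        map_add' := fun a b => LinearMap.ext fun m => add_smul a b _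
        map_smul' := fun a b => LinearMap.ext fun m => mul_smul a b _ }
  have hF₀ : ∀ a m, F₀ (a ⊗ₜ[k] m) = a • f m := fun a m => rfl
  refine ⟨ModuleCat.ofHom (Submodule.liftQ _ F₀ ?_), fun m => ?_⟩
  · refine Submodule.span_le.2 ?_
    rintro _ (⟨y, m, rfl⟩ | ⟨y, hy, m, rfl⟩)
    · change F₀ _ = 0
      rw [map_sub, hF₀, hF₀, hf, one_smul, sub_self]
    · exact hu y hy m
  · change F₀ (1 ⊗ₜ[k] m) = f m
    rw [hF₀, one_smul]

/-- `M → Ind M` is injective. -/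
lemma indUnit_injective (p : LieSubalgebra k g) (hp : p.toSubmodule = l.toSubmodule ⊔ uu)
    (hdis : Disjoint l.toSubmodule uu) (hlu : ∀ x ∈ l, ∀ y ∈ uu, ⁅x, y⁆ ∈ uu)
    (huu : ∀ x ∈ uu, ∀ y ∈ uu, ⁅x, y⁆ ∈ uu) : Function.Injective (indUnit l uu M) := by
  -- The complement of `l` is chosen to contain `uu`, so that the projection to `l` along it
  -- restricts to the Lie algebra homomorphism `p → l` with kernel `uu`.
  obtain ⟨q, huq, hq⟩ : ∃ q : Submodule k g, uu ≤ q ∧ IsCompl l.toSubmodule q := by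
    obtain ⟨q, hq⟩ := (l.toSubmodule ⊔ uu).exists_isCompl
    refine ⟨uu ⊔ q, le_sup_left, ?_, ?_⟩
    · exact Disjoint.disjoint_sup_right_of_disjoint_sup_left hdis hq.disjoint
    · rw [codisjoint_iff, ← sup_assoc, hq.sup_eq_top]
  let pr : g →ₗ[k] l := l.toSubmodule.projectionOnto q hq
  have pr_l : ∀ x : l, pr x = x := fun x => Submodule.projectionOnto_apply_left hq x
  have pr_u : ∀ x ∈ uu, pr x = 0 := fun x hx =>
    (Submodule.projectionOnto_apply_eq_zero_iff hq).2 (huq hx)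
  let ρ : g →ₗ[k] Module.End k M :=
    { toFun := fun x => act M (pr x)
      map_add' := fun x y => LinearMap.ext fun m => by
        change toEnv k (pr (x + y)) • m = _
        rw [map_add, toEnv_add_smul]; rfl
      map_smul' := fun c x => LinearMap.ext fun m => by
        change toEnv k (pr (c • x)) • m = _
        rw [map_smul, toEnv_smul_smul]; rfl }
  have hpr : ∀ x ∈ p, ∀ y ∈ p, pr ⁅x, y⁆ = ⁅pr x, pr y⁆ := by
    intro x hx y hy
    obtain ⟨a, ha, v, hv, rfl⟩ := Submodule.mem_sup.1 (hp ▸ hx : x ∈ l.toSubmodule ⊔ uu)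
    obtain ⟨a', ha', v', hv', rfl⟩ := Submodule.mem_sup.1 (hp ▸ hy : y ∈ l.toSubmodule ⊔ uu)
    rw [lie_add, add_lie, add_lie, map_add, map_add, map_add, map_add, map_add,
      pr_u _ (hlu a ha v' hv'), pr_u _ (huu v hv v' hv'), pr_u v hv, pr_u v' hv',
      ← lie_skew v a', map_neg, pr_u _ (hlu a' ha' v hv)]
    have e1 : pr ⁅a, a'⁆ = ⁅(⟨a, ha⟩ : l), (⟨a', ha'⟩ : l)⁆ := pr_l ⁅(⟨a, ha⟩ : l), (⟨a', ha'⟩ : l)⁆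
    have e2 : pr a = ⟨a, ha⟩ := pr_l ⟨a, ha⟩
    have e3 : pr a' = ⟨a', ha'⟩ := pr_l ⟨a', ha'⟩
    rw [e1, e2, e3]
    simp
  -- The `p`-module `M` embeds into a `g`-module. This embedding factors through `M → Ind M`, which
  -- is therefore injective.
  obtain ⟨N, _, _, T, i, hT, hi, hTi⟩ := exists_module_extension p ρ (fun x hx y hy m => by
    change toEnv k (pr ⁅x, y⁆) • m = toEnv k (pr x) • toEnv k (pr y) • m -
      toEnv k (pr y) • toEnv k (pr x) • m
    rw [hpr x hx y hy, lie_smul_eq])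
  obtain ⟨X, e, he⟩ := exists_moduleCat T hT
  have hlp : ∀ x ∈ l, x ∈ p := fun x hx => by
    change x ∈ p.toSubmodule
    rw [hp]; exact Submodule.mem_sup_left hx
  have hup : ∀ x ∈ uu, x ∈ p := fun x hx => by
    change x ∈ p.toSubmodule
    rw [hp]; exact Submodule.mem_sup_right hx
  obtain ⟨F, hF⟩ := exists_indHom (l := l) (uu := uu) (e.toLinearMap ∘ₗ i) (fun y m => by
      change e (i _) = _ • e (i m)
      rw [← he, hTi y (hlp y y.2)]
      change _ = e (i (toEnv k (pr y) • m))
      rw [pr_l]) (fun x hx m => by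
      change _ • e (i m) = 0
      rw [← he, hTi x (hup x hx)]
      change e (i (toEnv k (pr x) • m)) = 0
      rw [pr_u x hx, toEnv, map_zero, zero_smul, map_zero, map_zero])
  intro m m' h
  have := congrArg F.hom h
  rw [hF, hF] at this
  exact hi (e.injective this)

/-! ### Restriction -/

/-- The identity map between a module and its restriction. -/
def resId (l : LieSubalgebra k g) (X : ModuleCat.{u} (Env k g)) :
    (restriction l).obj X ≃ₗ[k] X where
  toFun x := x
  invFun x := x
  map_add' _ _ := rfl
  map_smul' c x := by
    change (envIncl l (algebraMap k (Env k l) c)) • (show X from x) = _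
    rw [AlgHom.commutes]; rfl
  left_inv _ := rfl
  right_inv _ := rfl

lemma resId_smul (X : ModuleCat.{u} (Env k g)) (y : l) (x : (restriction l).obj X) :
    resId l X (toEnv k y • x) = toEnv k (y : g) • resId l X x := by
  change (envIncl l (toEnv k y)) • (show X from x) = _
  rw [envIncl, UniversalEnvelopingAlgebra.lift_ι_apply]
  rfl

end Ind

end Env

end CatO

namespace CatO

namespace RootReductive

variable {k : Type u} [Field k] {g : Type u} [LieRing g] [LieAlgebra k g] (D : RootReductive k g)

instance (N : ℕ) : FiniteDimensional k (D.gt N).toSubmodule := D.finite N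

lemma mem_adWeightSpace_toGn {n : ℕ} {α : D.Weight} {x : D.gn n} :
    x ∈ adWeightSpace (D.toGn n) α ↔ (x : g) ∈ D.rootSpace α :=
  forall_congr' fun _ => Subtype.ext_iff

/-! ### The functor `Res` -/

section Res

variable (n : ℕ) (lam : D.Weight)

/-- The inclusion of `Res N` in `N`. -/
def resIncl (N : ModuleCat.{u} (Env k g)) : (D.res n lam).obj N →ₗ[k] N :=
  (resId (D.gn n) N).toLinearMap ∘ₗ
    (weightPart (D.toGn n) (D.coset n lam) ((restriction (D.gn n)).obj N)).subtype.restrictScalars k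

lemma resIncl_injective (N : ModuleCat.{u} (Env k g)) : Function.Injective (D.resIncl n lam N) :=
  (resId (D.gn n) N).injective.comp Subtype.val_injective

lemma resIncl_smul (N : ModuleCat.{u} (Env k g)) (y : D.gn n) (x : (D.res n lam).obj N) :
    D.resIncl n lam N (toEnv k y • x) = toEnv k (y : g) • D.resIncl n lam N x :=
  resId_smul N y _

lemma resIncl_map {M N : ModuleCat.{u} (Env k g)} (f : M ⟶ N) (x : (D.res n lam).obj M) :
    D.resIncl n lam N (((D.res n lam).map f).hom x) = f.hom (D.resIncl n lam M x) := rfl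

lemma resId_mem_weightSpace {N : ModuleCat.{u} (Env k g)} {μ : D.Weight}
    {x : (restriction (D.gn n)).obj N} :
    resId (D.gn n) N x ∈ weightSpace D.toG N μ ↔
      x ∈ weightSpace (D.toGn n) ((restriction (D.gn n)).obj N) μ := by
  refine forall_congr' fun h => ?_
  rw [← (resId (D.gn n) N).injective.eq_iff, resId_smul, map_smul]
  rfl

lemma resIncl_mem_weightSpace {N : ModuleCat.{u} (Env k g)} {μ : D.Weight}
    {x : (D.res n lam).obj N} :
    D.resIncl n lam N x ∈ weightSpace D.toG N μ ↔
      x ∈ weightSpace (D.toGn n) ((D.res n lam).obj N) μ := by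
  refine forall_congr' fun h => ?_
  rw [← (D.resIncl_injective n lam N).eq_iff, resIncl_smul, map_smul]
  rfl

variable [CharZero k] [IsAlgClosed k]

omit [CharZero k] [IsAlgClosed k] in
variable {n lam} in
lemma add_mem_coset {α μ : D.Weight} (hα : α ∈ AddSubgroup.closure (D.rootsN n))
    (hμ : μ ∈ D.coset n lam) : α + μ ∈ D.coset n lam := by
  change α + μ - lam ∈ AddSubgroup.closure (D.rootsN n)
  rw [add_sub_assoc]
  exact add_mem hα hμ

/-- The weights of `𝔤ₙ` are zero and `Φₙ`, so the sum of the weight spaces for a coset of `ℤΦₙ` is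
already `𝔤ₙ`-stable and passing to the largest submodule loses nothing. -/
lemma range_resIncl (N : ModuleCat.{u} (Env k g)) :
    LinearMap.range (D.resIncl n lam N) = ⨆ μ ∈ D.coset n lam, weightSpace D.toG N μ := by
  have h1 : (⨆ μ ∈ D.coset n lam, weightSpace D.toG N μ) =
      (⨆ μ ∈ D.coset n lam, weightSpace (D.toGn n) ((restriction (D.gn n)).obj N) μ).map
        (resId (D.gn n) N).toLinearMap := by
    simp only [Submodule.map_iSup]
    refine iSup_congr fun μ => iSup_congr fun _ => ?_
    ext x
    obtain ⟨y, rfl⟩ := (resId (D.gn n) N).surjective x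
    rw [D.resId_mem_weightSpace]
    simp
  have h2 : ∀ (y : D.gn n), ∀ x ∈ ⨆ μ ∈ D.coset n lam, weightSpace D.toG N μ,
      toEnv k (y : g) • x ∈ ⨆ μ ∈ D.coset n lam, weightSpace D.toG N μ := fun y x hx => by
    have hy : (y : g) ∈ ⨆ α ∈ insert 0 (D.rootsN n), adWeightSpace D.toG (id α) :=
      D.gn_le_iSup n y.2
    refine smul_mem_iSup_weightSpace ?_ hy hx
    rintro α (rfl | hα) μ hμ
    · simpa using hμ
    · exact D.add_mem_coset (AddSubgroup.subset_closure hα) hμ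
  refine le_antisymm ?_ fun x hx => ?_
  · rintro _ ⟨x, rfl⟩
    have hx := x.2 1
    rw [one_smul] at hx
    rw [h1]
    exact ⟨_, hx, rfl⟩
  · rw [h1] at hx h2
    obtain ⟨y, hy, rfl⟩ := hx
    refine ⟨⟨y, fun a => env_smul_mem _ (fun z m hm => ?_) a hy⟩, rfl⟩
    obtain ⟨m', hm', h⟩ := h2 z _ ⟨m, hm, rfl⟩
    have : toEnv k z • m = m' := (resId (D.gn n) N).injective ((resId_smul N z m).trans h.symm)
    rw [this]
    exact hm'

end Res

/-! ### Induction and restriction between truncated categories -/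

namespace PositiveSystem

variable {D} (B : D.PositiveSystem)

/-- The conditions on the weights under which truncated categories for `𝔤ₙ` and `g` are
compared. -/
structure IsTruncation (n : ℕ) (lam : D.Weight) (Kn K : Set D.Weight) : Prop where
  subset : Kn ⊆ D.coset n lam
  inter : ∀ μ ∈ K, μ ∈ D.coset n lam → μ ∈ Kn
  sub_mem : ∀ μ ∈ Kn, ∀ σ ∈ AddSubmonoid.closure B.pos, μ - σ ∈ K
  le : ∀ μ ∈ K, ∃ ν ∈ D.coset n lam, B.le μ ν

variable {B}

lemma closure_rootsN_pos_le (n : ℕ) {σ : D.Weight}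
    (hσ : σ ∈ AddSubmonoid.closure (D.rootsN n ∩ B.pos)) :
    σ ∈ AddSubmonoid.closure B.pos ∧ σ ∈ AddSubgroup.closure (D.rootsN n) :=
  ⟨AddSubmonoid.closure_mono Set.inter_subset_right hσ,
    (AddSubmonoid.closure_le (S := (AddSubgroup.closure (D.rootsN n)).toAddSubmonoid)).2
      (fun _ h => AddSubgroup.subset_closure h.1) hσ⟩

lemma sub_mem_coset {n : ℕ} {lam μ ν : D.Weight} (hμ : μ ∈ D.coset n lam)
    (hν : ν ∈ D.coset n lam) : ν - μ ∈ AddSubgroup.closure (D.rootsN n) := by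
  have : (ν - lam) - (μ - lam) ∈ AddSubgroup.closure (D.rootsN n) := sub_mem hν hμ
  rwa [sub_sub_sub_cancel_right] at this

lemma sub_mem_coset' {n : ℕ} {lam μ σ : D.Weight} (hμ : μ ∈ D.coset n lam)
    (hσ : σ ∈ AddSubgroup.closure (D.rootsN n)) : μ - σ ∈ D.coset n lam := by
  rw [sub_eq_neg_add]
  exact D.add_mem_coset (neg_mem hσ) hμ

lemma isTruncation_coset (n : ℕ) (lam : D.Weight) :
    B.IsTruncation n lam (D.coset n lam) (B.ideal (D.coset n lam)) where
  subset := subset_rfl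
  inter _ _ h := h
  sub_mem μ hμ σ hσ := ⟨μ, hμ, by rw [PositiveSystem.le, sub_sub_cancel]; exact hσ⟩
  le _ h := h

section CharZero

variable [CharZero k] [IsAlgClosed k]

/-- Only `inter` is not formal. If the positive roots leading from `μ` up to `ν ∈ E` involve one
outside `Φₙ`, then `ν - μ` is not in `ℤΦₙ` by `IsDynkin.add_notMem_closure`, so `μ` is not in the
coset. -/
lemma IsDynkin.isTruncation_ideal (hB : B.IsDynkin) (n : ℕ) (lam : D.Weight) (E : Set D.Weight)
    (hE : E ⊆ D.coset n lam) : B.IsTruncation n lam (B.idealN n E) (B.ideal E) where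
  subset := by
    rintro μ ⟨ν, hν, h⟩
    have := sub_mem_coset' (hE hν) (closure_rootsN_pos_le n h).2
    rwa [sub_sub_cancel] at this
  inter := by
    rintro μ ⟨ν, hν, h⟩ hμ
    rcases mem_closure_pos_cases n h with h | ⟨β, hβ, τ, hτ, h⟩
    · exact ⟨ν, hν, h⟩
    · have := sub_mem_coset hμ (hE hν)
      rw [h] at this
      exact absurd this (hB.add_notMem_closure hβ hτ)
  sub_mem := by
    rintro μ ⟨ν, hν, h⟩ σ hσ
    refine ⟨ν, hν, ?_⟩
    rw [PositiveSystem.le, ← sub_add]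
    exact AddMemClass.add_mem (closure_rootsN_pos_le n h).1 hσ
  le := by
    rintro μ ⟨ν, hν, h⟩
    exact ⟨ν, hE hν, h⟩


/-- The general criterion is applied with `F N = 𝔤̃_N` and `U N` the nilradical of level `N`. Indeed
`𝔟` is its intersection with `𝔤_N` plus that nilradical, and `𝔤_N` normalizes both spaces. -/
lemma IsDynkin.isLocallyFinite (hB : B.IsDynkin) {M : ModuleCat.{u} (Env k g)} {W : Submodule k M}
    (hW : Generates W) (hgood : ∀ w ∈ W, IsGood B.borel B.uPlus w) : IsLocallyFinite B.borel M := by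
  refine hW.isLocallyFinite B.borel (fun N => (D.gt N).toSubmodule) B.uPlus ?_ ?_ ?_ ?_ hgood
  · exact fun N N' h => biSup_mono fun α hα => ⟨hα.1, fun hc => hα.2 (D.rootsN_mono h hc)⟩
  · intro N x hx y hy
    obtain ⟨a, ha, v, hv, rfl⟩ := Submodule.mem_sup.1 (B.borel_le_sup N hx)
    rw [add_lie]
    refine Submodule.add_mem_sup (D.gn_lie_mem_gt ha.2 hy) ?_
    rw [← lie_skew]
    exact Submodule.neg_mem _ (hB.gn_lie_mem_uPlus (D.gt_le_gn N hy) hv)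
  · intro N x hx y hy
    rw [← lie_skew]
    exact Submodule.neg_mem _ (hB.gn_lie_mem_uPlus (D.gt_le_gn N hy) hx)
  · intro y N₀
    obtain ⟨m, hm⟩ := D.exhaust y
    exact ⟨max m N₀, le_max_right _ _, Submodule.mem_sup_left (D.gt_mono (le_max_left _ _) hm)⟩

/-- Here `F` is constantly `𝔤̃ₙ` and `U` is zero: what `𝔤ₙ` has beyond `𝔤̃ₙ` lies in `𝔥` and thus in
`𝔟ₙ`. -/
lemma isLocallyFinite_gn {n : ℕ} {M : ModuleCat.{u} (Env k (D.gn n))} {W : Submodule k M}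
    (hW : Generates W) (hgood : ∀ w ∈ W, IsGood (B.borelN n) (fun _ => ⊥) w) :
    IsLocallyFinite (B.borelN n) M := by
  have hfin : FiniteDimensional k ((D.gt n).toSubmodule.comap (D.gn n).toSubmodule.subtype) :=
    Module.Finite.of_injective ((D.gn n).toSubmodule.subtype.restrict
      (p := (D.gt n).toSubmodule.comap (D.gn n).toSubmodule.subtype) (q := (D.gt n).toSubmodule)
      fun _ h => h) fun x y h => by
        have h' := congrArg Subtype.val h
        exact Subtype.ext (Subtype.ext h')
  refine hW.isLocallyFinite (B.borelN n)
    (fun _ => (D.gt n).toSubmodule.comap (D.gn n).toSubmodule.subtype) (fun _ => ⊥)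
    (fun _ _ _ => le_rfl) ?_ ?_ ?_ hgood
  · intro _ x _ y hy
    exact Submodule.mem_sup_left (D.gn_lie_mem_gt x.2 hy)
  · intro _ x hx y _
    rw [(Submodule.mem_bot k).1 hx, zero_lie]
    exact Submodule.zero_mem _
  · intro y N₀
    refine ⟨N₀, le_rfl, ?_⟩
    obtain ⟨a, ha, h, hh, he⟩ := D.mem_gn.1 y.2
    exact Submodule.mem_sup.2 ⟨⟨a, D.gt_le_gn n ha⟩, ha, ⟨h, D.cartan_le_gn n hh⟩,
      B.cartan_le_borel hh, Subtype.ext he⟩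

section Ind

variable {n : ℕ} {lam : D.Weight} {Kn K : Set D.Weight}

/-- The canonical map `M → Ind M`. -/
abbrev unitMap (B : D.PositiveSystem) (n : ℕ) (M : ModuleCat.{u} (Env k (D.gn n))) :
    M →ₗ[k] (B.ind n).obj M :=
  indUnit (D.gn n) (B.uPlus n) M

omit [CharZero k] [IsAlgClosed k] in
lemma gn_smul_unitMap {M : ModuleCat.{u} (Env k (D.gn n))} (y : D.gn n) (m : M) :
    toEnv k (y : g) • unitMap B n M m = unitMap B n M (toEnv k y • m) :=
  smul_indUnit_of_mem _ _ y m

omit [CharZero k] [IsAlgClosed k] in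
lemma uPlus_smul_unitMap {M : ModuleCat.{u} (Env k (D.gn n))} {x : g} (hx : x ∈ B.uPlus n)
    (m : M) : toEnv k x • unitMap B n M m = 0 :=
  smul_indUnit_eq_zero _ _ hx m

/-- The weights which lie below `Kn`, but not in the coset of `Kn`. -/
def lowerWeights (B : D.PositiveSystem) (n : ℕ) (Kn : Set D.Weight) : Set D.Weight :=
  {μ | ∃ ν ∈ Kn, ∃ β ∈ B.uRoots n, ∃ τ ∈ AddSubmonoid.closure B.pos, μ = ν - (β + τ)}

lemma IsDynkin.disjoint_lowerWeights (hB : B.IsDynkin) (hKn : Kn ⊆ D.coset n lam) :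
    Disjoint (D.coset n lam) (lowerWeights B n Kn) := by
  rw [Set.disjoint_left]
  rintro _ hμ ⟨ν, hν, β, hβ, τ, hτ, rfl⟩
  have := sub_mem_coset hμ (hKn hν)
  rw [sub_sub_cancel] at this
  exact hB.add_notMem_closure hβ hτ this

omit [CharZero k] [IsAlgClosed k] in
lemma unitMap_mem_weightSpace {M : ModuleCat.{u} (Env k (D.gn n))} {μ : D.Weight} {m : M}
    (hm : m ∈ weightSpace (D.toGn n) M μ) :
    unitMap B n M m ∈ weightSpace D.toG ((B.ind n).obj M) μ := fun h => by
  have := gn_smul_unitMap (B := B) (D.toGn n h) m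
  rw [hm h, map_smul] at this
  exact this

omit [CharZero k] [IsAlgClosed k] in
lemma range_unitMap_le {M : ModuleCat.{u} (Env k (D.gn n))}
    (hM : ⨆ μ ∈ Kn, weightSpace (D.toGn n) M μ = ⊤) : LinearMap.range (unitMap B n M) ≤
      ⨆ μ ∈ Kn, weightSpace D.toG ((B.ind n).obj M) μ := by
  rw [LinearMap.range_eq_map, ← hM]
  simp only [Submodule.map_iSup]
  refine iSup₂_mono fun μ _ => ?_
  rintro _ ⟨m, hm, rfl⟩
  exact unitMap_mem_weightSpace hm

/-- The image of `M` is stable under `𝔤ₙ` and the nilradical. The opposite nilradical moves the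
weights in `Kn` into `lowerWeights` and keeps them there. -/
lemma range_unitMap_sup {M : ModuleCat.{u} (Env k (D.gn n))}
    (hM : ⨆ μ ∈ Kn, weightSpace (D.toGn n) M μ = ⊤) : LinearMap.range (unitMap B n M) ⊔
      ⨆ μ ∈ lowerWeights B n Kn, weightSpace D.toG ((B.ind n).obj M) μ = ⊤ := by
  refine (generates_indUnit (D.gn n) (B.uPlus n)).sup_eq_top (B.uMinus n)
    ((D.gn n).toSubmodule ⊔ B.uPlus n) (B.top_le_uMinus n) ?_ _ ?_ ?_
  · rintro p hp _ ⟨m, rfl⟩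
    obtain ⟨y, hy, v, hv, rfl⟩ := Submodule.mem_sup.1 hp
    change toEnv k (y + v) • unitMap B n M m ∈ LinearMap.range (unitMap B n M)
    rw [toEnv_add_smul, uPlus_smul_unitMap hv, add_zero]
    exact ⟨toEnv k (⟨y, hy⟩ : D.gn n) • m, (gn_smul_unitMap ⟨y, hy⟩ m).symm⟩
  · intro a ha w hw
    have ha' : a ∈ ⨆ β ∈ B.uRoots n, adWeightSpace D.toG (-β) := ha
    refine smul_mem_iSup_weightSpace ?_ ha' (range_unitMap_le hM hw)
    exact fun β hβ ν hν => ⟨ν, hν, β, hβ, 0, zero_mem _, by abel⟩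
  · intro a ha z hz
    have ha' : a ∈ ⨆ β ∈ B.uRoots n, adWeightSpace D.toG (-β) := ha
    refine smul_mem_iSup_weightSpace ?_ ha' hz
    rintro β' hβ' _ ⟨ν, hν, β, hβ, τ, hτ, rfl⟩
    exact ⟨ν, hν, β, hβ, τ + β', AddMemClass.add_mem hτ (AddSubmonoid.subset_closure hβ'.1),
      by abel⟩

/-- The summand beside the image of `M` in `range_unitMap_sup` has no weights in the coset, so the
coset part of `Ind M` is the image of `M` alone. -/
lemma IsDynkin.range_unitMap (hB : B.IsDynkin) (hKn : Kn ⊆ D.coset n lam)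
    {M : ModuleCat.{u} (Env k (D.gn n))} (hM : ⨆ μ ∈ Kn, weightSpace (D.toGn n) M μ = ⊤) :
    LinearMap.range (unitMap B n M) =
      ⨆ μ ∈ D.coset n lam, weightSpace D.toG ((B.ind n).obj M) μ := by
  have hle := (range_unitMap_le (B := B) hM).trans (weights_mono D.toG _ hKn)
  refine le_antisymm hle fun x hx => ?_
  have hx' : x ∈ LinearMap.range (unitMap B n M) ⊔
      ⨆ μ ∈ lowerWeights B n Kn, weightSpace D.toG ((B.ind n).obj M) μ := by
    rw [range_unitMap_sup hM]; trivial
  obtain ⟨y, hy, z, hz, rfl⟩ := Submodule.mem_sup.1 hx'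
  have hz' := Submodule.sub_mem _ hx (hle hy)
  rw [add_sub_cancel_left] at hz'
  rw [Submodule.disjoint_def.1 (disjoint_weights D.toG _ (hB.disjoint_lowerWeights hKn)) z hz' hz,
    add_zero]
  exact hy

lemma IsDynkin.unitMap_injective (hB : B.IsDynkin) (M : ModuleCat.{u} (Env k (D.gn n))) :
    Function.Injective (unitMap B n M) := by
  let p : LieSubalgebra k g :=
    { toSubmodule := (D.gn n).toSubmodule ⊔ B.uPlus n
      lie_mem' := by
        intro x y hx hy
        obtain ⟨a, ha, v, hv, rfl⟩ := Submodule.mem_sup.1 hx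
        obtain ⟨a', ha', v', hv', rfl⟩ := Submodule.mem_sup.1 hy
        rw [lie_add, add_lie, add_lie, add_assoc]
        refine Submodule.add_mem_sup ((D.gn n).lie_mem ha ha') (Submodule.add_mem _ ?_
          (Submodule.add_mem _ (hB.gn_lie_mem_uPlus ha hv') (hB.uPlus_lie_mem_uPlus hv hv')))
        rw [← lie_skew]
        exact Submodule.neg_mem _ (hB.gn_lie_mem_uPlus ha' hv) }
  exact indUnit_injective p rfl (B.disjoint_gn_uPlus n)
    (fun x hx y hy => hB.gn_lie_mem_uPlus hx hy) (fun x hx y hy => hB.uPlus_lie_mem_uPlus hx hy)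

/-- The weights are read off from `range_unitMap_sup`. For local finiteness, a finite dimensional
`𝔟ₙ`-stable subspace of `M` has a `𝔟`-stable image killed by the nilradical of level `n`, so the
generating vectors are good. -/
lemma IsDynkin.ind_mem (hB : B.IsDynkin) (hK : B.IsTruncation n lam Kn K)
    {M : ModuleCat.{u} (Env k (D.gn n))} (hM : B.On n Kn M) : B.O K ((B.ind n).obj M) := by
  have hM' := (weight_support_iff _ _ _).1 ⟨hM.1, hM.2.2⟩
  have h1 := (weight_support_iff D.toG ((B.ind n).obj M) K).2 (by
    rw [eq_top_iff, ← range_unitMap_sup hM']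
    refine sup_le ((range_unitMap_le hM').trans (weights_mono _ _ fun μ hμ => ?_))
      (weights_mono _ _ ?_)
    · simpa using hK.sub_mem μ hμ 0 (zero_mem _)
    · rintro _ ⟨ν, hν, β, hβ, τ, hτ, rfl⟩
      exact hK.sub_mem ν hν _ (AddMemClass.add_mem (AddSubmonoid.subset_closure hβ.1) hτ))
  refine ⟨h1.1, hB.isLocallyFinite (generates_indUnit (D.gn n) (B.uPlus n)) ?_, h1.2⟩
  rintro _ ⟨m, rfl⟩
  obtain ⟨V, hmV, hV, hb⟩ := hM.2.1 m
  refine ⟨V.map (unitMap B n M), ⟨m, hmV, rfl⟩, inferInstance, ?_, n, ?_⟩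
  · rintro x hx _ ⟨v, hv, rfl⟩
    obtain ⟨y, hy, z, hz, rfl⟩ := Submodule.mem_sup.1 (B.borel_le_sup n hx)
    rw [toEnv_add_smul, uPlus_smul_unitMap hz, add_zero]
    exact ⟨toEnv k (⟨y, hy.2⟩ : D.gn n) • v, hb ⟨y, hy.2⟩ hy.1 v hv,
      (gn_smul_unitMap ⟨y, hy.2⟩ v).symm⟩
  · rintro x hx _ ⟨v, _, rfl⟩
    exact uPlus_smul_unitMap hx v

end Ind

section Res

variable {n : ℕ} {lam : D.Weight} {Kn K : Set D.Weight}

omit [CharZero k] [IsAlgClosed k] in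
lemma weights_coset_le (hK : B.IsTruncation n lam Kn K) {N : ModuleCat.{u} (Env k g)}
    (hN : B.O K N) : (⨆ μ ∈ D.coset n lam, weightSpace D.toG N μ) ≤
      ⨆ μ ∈ Kn, weightSpace D.toG N μ :=
  (weights_inter ((weight_support_iff _ _ _).1 ⟨hN.1, hN.2.2⟩) _).trans
    (weights_mono _ _ fun μ hμ => hK.inter μ hμ.2 hμ.1)

lemma res_mem (hK : B.IsTruncation n lam Kn K) {N : ModuleCat.{u} (Env k g)} (hN : B.O K N) :
    B.On n Kn ((D.res n lam).obj N) := by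
  have h1 := (weight_support_iff (D.toGn n) ((D.res n lam).obj N) Kn).2 (by
    rw [eq_top_iff]
    intro x _
    have hx : D.resIncl n lam N x ∈ ⨆ μ ∈ Kn, weightSpace D.toG N μ :=
      weights_coset_le hK hN (D.range_resIncl n lam N ▸ ⟨x, rfl⟩)
    have hle : (⨆ μ ∈ Kn, weightSpace D.toG N μ) ≤
        (⨆ μ ∈ Kn, weightSpace (D.toGn n) ((D.res n lam).obj N) μ).map (D.resIncl n lam N) := by
      refine iSup₂_le fun μ hμ y hy => ?_
      obtain ⟨z, rfl⟩ : y ∈ LinearMap.range (D.resIncl n lam N) := by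
        rw [D.range_resIncl]; exact mem_weights (hK.subset hμ) hy
      exact ⟨z, mem_weights hμ ((D.resIncl_mem_weightSpace n lam).1 hy), rfl⟩
    obtain ⟨z, hz, h⟩ := hle hx
    rwa [← D.resIncl_injective n lam N h])
  refine ⟨h1.1, fun x => ?_, h1.2⟩
  obtain ⟨V, hxV, hV, hb⟩ := hN.2.1 (D.resIncl n lam N x)
  refine ⟨V.comap (D.resIncl n lam N), hxV, ?_, fun y hy v hv => ?_⟩
  · exact Module.Finite.of_injective ((D.resIncl n lam N).restrict
      (p := V.comap (D.resIncl n lam N)) (q := V) fun _ h => h) fun x y h => by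
        have h' := congrArg Subtype.val h
        exact Subtype.ext (D.resIncl_injective n lam N h')
  · change D.resIncl n lam N _ ∈ V
    rw [D.resIncl_smul]
    exact hb y hy _ hv

/-- The nilradical kills the weight spaces in the coset, because the weights above it do not
occur. -/
lemma IsDynkin.uPlus_smul_eq_zero (hB : B.IsDynkin) (hK : B.IsTruncation n lam Kn K)
    {N : ModuleCat.{u} (Env k g)} (hN : B.O K N) {x : g} (hx : x ∈ B.uPlus n)
    (m : (D.res n lam).obj N) : toEnv k x • D.resIncl n lam N m = 0 := by
  have hm : D.resIncl n lam N m ∈ ⨆ μ ∈ D.coset n lam, weightSpace D.toG N μ :=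
    D.range_resIncl n lam N ▸ ⟨m, rfl⟩
  have hx' : x ∈ ⨆ β ∈ B.uRoots n, adWeightSpace D.toG (id β) := hx
  -- If `β + μ` were in `K`, it would lie below some `ν` in the coset. Then `ν - μ`, which is `β`
  -- plus a sum of positive roots, would be in `ℤΦₙ`.
  have h1 := smul_mem_iSup_weightSpace (K' := Kᶜ) (fun β hβ μ hμ hβμ => by
    obtain ⟨ν, hν, h⟩ := hK.le _ hβμ
    have h2 := sub_mem_coset hμ hν
    rw [show ν - μ = β + (ν - (β + μ)) by abel] at h2
    exact hB.add_notMem_closure hβ h h2) hx' hm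
  have h2 := (weight_support_iff _ _ _).1 ⟨hN.1, hN.2.2⟩
  exact Submodule.disjoint_def.1 (disjoint_weights D.toG N (disjoint_compl_right (a := K))) _
    (h2 ▸ Submodule.mem_top) h1

end Res

end CharZero

end PositiveSystem

end RootReductive

end CatO

namespace CatO

namespace RootReductive

namespace PositiveSystem

/-! ### Verma modules in truncated categories -/

section Verma

variable {k : Type u} [Field k] {g : Type u} [LieRing g] [LieAlgebra k g] {D : RootReductive k g}
  {B : D.PositiveSystem} {n : ℕ} {μ : D.Weight}

lemma borel_smul_mem {M : ModuleCat.{u} (Env k g)} {v : M} (hv : v ∈ weightSpace D.toG M μ)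
    (hn : ∀ x ∈ B.nPlus, toEnv k x • v = 0) {x : g} (hx : x ∈ B.borel) {w : M}
    (hw : w ∈ Submodule.span k {v}) : toEnv k x • w ∈ Submodule.span k {v} := by
  obtain ⟨c, rfl⟩ := Submodule.mem_span_singleton.1 hw
  obtain ⟨h, hh, y, hy, rfl⟩ := Submodule.mem_sup.1 hx
  rw [smul_algebra_smul_comm, toEnv_add_smul, hn y hy, add_zero]
  have : toEnv k h • v = μ ⟨h, hh⟩ • v := hv ⟨h, hh⟩
  rw [this]
  exact Submodule.smul_mem _ _ (Submodule.smul_mem _ _ (Submodule.mem_span_singleton_self v))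

lemma borelN_smul_mem {M : ModuleCat.{u} (Env k (D.gn n))} {v : M}
    (hv : v ∈ weightSpace (D.toGn n) M μ)
    (hn : ∀ x ∈ B.nPlusN n, toEnv k x • v = 0) {x : D.gn n} (hx : x ∈ B.borelN n) {w : M}
    (hw : w ∈ Submodule.span k {v}) : toEnv k x • w ∈ Submodule.span k {v} := by
  obtain ⟨c, rfl⟩ := Submodule.mem_span_singleton.1 hw
  obtain ⟨h, hh, y, hy, he⟩ := Submodule.mem_sup.1 (show (x : g) ∈ B.borel.toSubmodule from hx)
  have hy' : y ∈ D.gn n := by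
    rw [← add_sub_cancel_left h y, he]
    exact (D.gn n).sub_mem x.2 (D.cartan_le_gn n hh)
  have hx' : x = D.toGn n ⟨h, hh⟩ + ⟨y, hy'⟩ := Subtype.ext he.symm
  rw [hx', smul_algebra_smul_comm, toEnv_add_smul, hn ⟨y, hy'⟩ hy, add_zero, hv]
  exact Submodule.smul_mem _ _ (Submodule.smul_mem _ _ (Submodule.mem_span_singleton_self v))

variable [CharZero k] [IsAlgClosed k] {lam : D.Weight} {Kn K : Set D.Weight}

/-- Highest weight modules lie in category `O`. -/
lemma IsDynkin.mem_of_generates (hB : B.IsDynkin) (hK : B.IsTruncation n lam Kn K) (hμ : μ ∈ Kn)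
    {X : ModuleCat.{u} (Env k g)} {v : X} (hgen : Generates (Submodule.span k {v}))
    (hv : v ∈ weightSpace D.toG X μ) (hn : ∀ x ∈ B.nPlus, toEnv k x • v = 0) : B.O K X := by
  let T : Set D.Weight := {ν | ∃ σ ∈ AddSubmonoid.closure B.pos, ν = μ - σ}
  have hle : Submodule.span k {v} ≤
      ⨆ ν ∈ T, weightSpace D.toG X ν := by
    rw [Submodule.span_le, Set.singleton_subset_iff]
    exact mem_weights (show μ ∈ T from ⟨0, zero_mem _, by simp⟩) hv
  have hst : ∀ a ∈ B.nMinus, ∀ z ∈ ⨆ ν ∈ T, weightSpace D.toG X ν,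
      toEnv k a • z ∈ ⨆ ν ∈ T, weightSpace D.toG X ν := by
    intro a ha z hz
    have ha' : a ∈ ⨆ β ∈ B.pos, adWeightSpace D.toG (-β) := ha
    refine smul_mem_iSup_weightSpace ?_ ha' hz
    rintro β hβ _ ⟨σ, hσ, rfl⟩
    exact ⟨σ + β, AddMemClass.add_mem hσ (AddSubmonoid.subset_closure hβ), by abel⟩
  have htop := hgen.sup_eq_top B.nMinus B.borel.toSubmodule B.top_le_nMinus
    (fun p hp w hw => borel_smul_mem hv hn hp hw) _ (fun a ha w hw => hst a ha w (hle hw)) hst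
  have h1 := (weight_support_iff D.toG X K).2 (by
    rw [eq_top_iff, ← htop]
    refine (sup_le hle le_rfl).trans (weights_mono _ _ ?_)
    rintro _ ⟨σ, hσ, rfl⟩
    exact hK.sub_mem μ hμ σ hσ)
  refine ⟨h1.1, hB.isLocallyFinite hgen fun w hw => ?_, h1.2⟩
  -- The line through `v` is `𝔟`-stable and killed by all of `𝔫⁺`, so any level serves; `0` is
  -- chosen.
  refine ⟨_, hw, inferInstance, fun x hx w hw => borel_smul_mem hv hn hx hw, 0,
    fun x hx w hw => ?_⟩
  obtain ⟨c, rfl⟩ := Submodule.mem_span_singleton.1 hw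
  have := hn x (B.uPlus_le_nPlus 0 hx)
  rw [smul_algebra_smul_comm, this, smul_zero]

lemma IsDynkin.verma_mem (hB : B.IsDynkin) (hK : B.IsTruncation n lam Kn K) (hμ : μ ∈ Kn) :
    B.O K (B.Δ μ) :=
  hB.mem_of_generates hK hμ (generates_vermaGen _ _ _) (vermaGen_mem _ _ _)
    fun _ hx => smul_vermaGen_eq_zero _ _ _ hx

lemma top_le_sup_borelN (n : ℕ) :
    ⊤ ≤ (⨆ α ∈ D.rootsN n ∩ B.pos, adWeightSpace (D.toGn n) (-α)) ⊔ (B.borelN n).toSubmodule := by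
  intro x _
  obtain ⟨a, ha, b, hb, he⟩ := Submodule.mem_sup.1 (B.gn_le_nMinus n x.2)
  have hle : (⨆ α ∈ D.rootsN n ∩ B.pos, D.rootSpace (-α)) ≤
      (⨆ α ∈ D.rootsN n ∩ B.pos, adWeightSpace (D.toGn n) (-α)).map
        (D.gn n).toSubmodule.subtype := by
    refine iSup₂_le fun α hα y hy => ?_
    have hyn : y ∈ D.gn n := D.gt_le_gn n (D.rootSpace_le_gt (D.neg_mem_rootsN hα.1) hy)
    exact ⟨⟨y, hyn⟩, (le_iSup₂ (f := fun α (_ : α ∈ D.rootsN n ∩ B.pos) =>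
      adWeightSpace (D.toGn n) (-α)) α hα) (D.mem_adWeightSpace_toGn.2 hy), rfl⟩
  obtain ⟨a', ha', rfl⟩ := hle ha
  exact Submodule.mem_sup.2 ⟨a', ha', ⟨b, hb.2⟩, hb.1, Subtype.ext he⟩

/-- The weights of the module are `μ` minus sums of roots in `Φₙ⁺`. They lie in `K` and in the
coset, hence in `Kn`. -/
lemma IsTruncation.mem_of_generates (hK : B.IsTruncation n lam Kn K) (hμ : μ ∈ Kn)
    {X : ModuleCat.{u} (Env k (D.gn n))} {v : X} (hgen : Generates (Submodule.span k {v}))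
    (hv : v ∈ weightSpace (D.toGn n) X μ) (hn : ∀ x ∈ B.nPlusN n, toEnv k x • v = 0) :
    B.On n Kn X := by
  let T : Set D.Weight := {ν | ∃ σ ∈ AddSubmonoid.closure (D.rootsN n ∩ B.pos), ν = μ - σ}
  have hle : Submodule.span k {v} ≤
      ⨆ ν ∈ T, weightSpace (D.toGn n) X ν := by
    rw [Submodule.span_le, Set.singleton_subset_iff]
    exact mem_weights (show μ ∈ T from ⟨0, zero_mem _, by simp⟩) hv
  have hst : ∀ a ∈ ⨆ α ∈ D.rootsN n ∩ B.pos, adWeightSpace (D.toGn n) (-α),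
      ∀ z ∈ ⨆ ν ∈ T, weightSpace (D.toGn n) X ν,
      toEnv k a • z ∈ ⨆ ν ∈ T, weightSpace (D.toGn n) X ν := by
    intro a ha z hz
    refine smul_mem_iSup_weightSpace ?_ ha hz
    rintro β hβ _ ⟨σ, hσ, rfl⟩
    exact ⟨σ + β, AddMemClass.add_mem hσ (AddSubmonoid.subset_closure hβ), by abel⟩
  have htop := hgen.sup_eq_top _ (B.borelN n).toSubmodule (top_le_sup_borelN n)
    (fun p hp w hw => borelN_smul_mem hv hn hp hw) _ (fun a ha w hw => hst a ha w (hle hw)) hst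
  have h1 := (weight_support_iff (D.toGn n) X Kn).2 (by
    rw [eq_top_iff, ← htop]
    refine (sup_le hle le_rfl).trans (weights_mono _ _ ?_)
    rintro _ ⟨σ, hσ, rfl⟩
    obtain ⟨h1, h2⟩ := closure_rootsN_pos_le n hσ
    exact hK.inter _ (hK.sub_mem μ hμ σ h1) (sub_mem_coset' (hK.subset hμ) h2))
  refine ⟨h1.1, isLocallyFinite_gn hgen fun w hw => ?_, h1.2⟩
  refine ⟨_, hw, inferInstance, fun x hx w hw => borelN_smul_mem hv hn hx hw, 0,
    fun x hx w _ => ?_⟩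
  rw [(Submodule.mem_bot k).1 hx, toEnv, map_zero, zero_smul]

lemma IsTruncation.vermaN_mem (hK : B.IsTruncation n lam Kn K) (hμ : μ ∈ Kn) :
    B.On n Kn (B.Δn n μ) :=
  hK.mem_of_generates hμ (generates_vermaGen _ _ _) (vermaGen_mem _ _ _)
    fun _ hx => smul_vermaGen_eq_zero _ _ _ hx

/-- Parabolic induction maps Verma modules to Verma modules. -/
lemma IsDynkin.nonempty_ind_verma_iso (hB : B.IsDynkin) (n : ℕ) (μ : D.Weight) :
    Nonempty ((B.ind n).obj (B.Δn n μ) ≅ B.Δ μ) := by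
  let v : B.Δ μ := vermaGen D.toG B.nPlus μ
  let w : B.Δn n μ := vermaGen (D.toGn n) (B.nPlusN n) μ
  have hv : v ∈ weightSpace D.toG (B.Δ μ) μ := vermaGen_mem _ _ _
  have hn : ∀ x ∈ B.nPlus, toEnv k x • v = 0 := fun x hx => smul_vermaGen_eq_zero _ _ _ hx
  have hw : w ∈ weightSpace (D.toGn n) (B.Δn n μ) μ := vermaGen_mem _ _ _
  have hwn : ∀ x ∈ B.nPlusN n, toEnv k x • w = 0 := fun x hx => smul_vermaGen_eq_zero _ _ _ hx
  have hgv : Generates (Submodule.span k {v}) := generates_vermaGen _ _ _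
  have hgw : Generates (Submodule.span k {w}) := generates_vermaGen _ _ _
  -- The two inverse maps come from the universal properties of `Δ(μ)` and of `Ind`. Each matches
  -- the highest weight generators, which determine the composites.
  obtain ⟨G, hG⟩ : ∃ G : B.Δ μ ⟶ (B.ind n).obj (B.Δn n μ), G.hom v = unitMap B n _ w := by
    refine exists_vermaHom (unitMap_mem_weightSpace hw) fun x hx => ?_
    obtain ⟨a, ha, y, hy, rfl⟩ := Submodule.mem_sup.1 (B.nPlus_le_sup n hx)
    have h1 := gn_smul_unitMap (B := B) (⟨a, ha.2⟩ : D.gn n) w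
    rw [hwn ⟨a, ha.2⟩ ha.1, map_zero] at h1
    rw [toEnv_add_smul, uPlus_smul_unitMap hy, add_zero]
    exact h1
  let v' : (restriction (D.gn n)).obj (B.Δ μ) := (resId (D.gn n) (B.Δ μ)).symm v
  obtain ⟨φ, hφ⟩ : ∃ φ : B.Δn n μ ⟶ (restriction (D.gn n)).obj (B.Δ μ), φ.hom w = v' := by
    refine exists_vermaHom ((D.resId_mem_weightSpace n).1 ?_) fun x hx => ?_
    · rw [LinearEquiv.apply_symm_apply]
      exact hv
    · apply (resId (D.gn n) (B.Δ μ)).injective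
      rw [resId_smul, LinearEquiv.apply_symm_apply, map_zero]
      exact hn _ hx
  let f : B.Δn n μ →ₗ[k] B.Δ μ := (resId (D.gn n) (B.Δ μ)).toLinearMap ∘ₗ φ.hom.restrictScalars k
  have hfw : f w = v := by
    change resId (D.gn n) (B.Δ μ) (φ.hom w) = v
    rw [hφ, LinearEquiv.apply_symm_apply]
  have hf : ∀ (y : D.gn n) m, f (toEnv k y • m) = toEnv k (y : g) • f m := fun y m => by
    change resId (D.gn n) (B.Δ μ) (φ.hom (toEnv k y • m)) = _
    rw [map_smul, resId_smul]
    rfl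
  -- The vectors whose image is killed by the nilradical form a `𝔤ₙ`-submodule, since `𝔤ₙ`
  -- normalizes the nilradical, and it contains the generator.
  have hu : ∀ x ∈ B.uPlus n, ∀ m, toEnv k x • f m = 0 := by
    let S : Submodule k (B.Δn n μ) := ⨅ x ∈ B.uPlus n, LinearMap.ker (act (B.Δ μ) x ∘ₗ f)
    have hS : ∀ m, m ∈ S ↔ ∀ x ∈ B.uPlus n, toEnv k x • f m = 0 := fun m => by
      simp [S, act]
    have htop : S = ⊤ := by
      refine hgw S (fun y m hm => ?_) ?_
      · rw [hS] at hm ⊢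
        intro x hx
        rw [hf, smul_smul_lie, hm x hx, smul_zero, zero_add, ← lie_skew, toEnv, map_neg, neg_smul,
          neg_eq_zero]
        exact hm _ (hB.gn_lie_mem_uPlus y.2 hx)
      · rw [Submodule.span_le, Set.singleton_subset_iff]
        exact (hS w).2 fun x hx => by rw [hfw]; exact hn x (B.uPlus_le_nPlus n hx)
    exact fun x hx m => (hS m).1 (htop ▸ Submodule.mem_top) x hx
  obtain ⟨F, hF⟩ : ∃ F : (B.ind n).obj (B.Δn n μ) ⟶ B.Δ μ, ∀ m, F.hom (unitMap B n _ m) = f m :=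
    exists_indHom f hf hu
  have hgen : Generates (Submodule.span k {unitMap B n (B.Δn n μ) w}) := by
    intro S hS hle
    refine generates_indUnit (D.gn n) (B.uPlus n) S hS ?_
    have htop : S.comap (unitMap B n (B.Δn n μ)) = ⊤ := by
      refine hgw _ (fun y m hm => ?_) ?_
      · change unitMap B n (B.Δn n μ) _ ∈ S
        rw [← gn_smul_unitMap]
        exact hS _ _ hm
      · rw [Submodule.span_le, Set.singleton_subset_iff]
        exact hle (Submodule.mem_span_singleton_self _)
    rintro _ ⟨m, rfl⟩
    exact (htop ▸ Submodule.mem_top : m ∈ S.comap (unitMap B n (B.Δn n μ)))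
  refine ⟨⟨F, G, hgen.hom_ext fun m hm => ?_, hgv.hom_ext fun m hm => ?_⟩⟩
  · obtain ⟨c, rfl⟩ := Submodule.mem_span_singleton.1 hm
    rw [hom_smul_k, hom_smul_k]
    change c • G.hom (F.hom _) = c • _
    rw [hF, hfw, hG]
    rfl
  · obtain ⟨c, rfl⟩ := Submodule.mem_span_singleton.1 hm
    rw [hom_smul_k, hom_smul_k]
    change c • F.hom (G.hom _) = c • _
    rw [hG, hF, hfw]
    rfl

end Verma

end PositiveSystem

end RootReductive

end CatO

namespace CatO

/-! ## Morphisms which become invertible in the Serre quotients -/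

section Serre

variable {k : Type u} [Field k] {L : Type u} [LieRing L] [LieAlgebra k L]
  {H : Type u} [AddCommGroup H] [Module k H] {j : H →ₗ[k] L} {b : LieSubalgebra k L}
  {K N : Set (Module.Dual k H)} {X Y : TruncO j b K} (f : X ⟶ Y)

/-- The map underlying a morphism of `ᴷO`. -/
abbrev fn {X Y : TruncO j b K} (f : X ⟶ Y) : X.obj ⟶ Y.obj := (truncO j b K).ι.map f

lemma fn_zero : fn (0 : X ⟶ Y) = 0 := Functor.map_zero _ _ _

lemma kernel_ι_injective : Function.Injective (fn (kernel.ι f)).hom :=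
  (ModuleCat.mono_iff_injective _).1 (inferInstanceAs (Mono ((truncO j b K).ι.map (kernel.ι f))))

lemma cokernel_π_surjective : Function.Surjective (fn (cokernel.π f)).hom :=
  (ModuleCat.epi_iff_surjective _).1 (inferInstanceAs (Epi ((truncO j b K).ι.map (cokernel.π f))))

lemma apply_kernel_ι (y : (kernel f).obj) : (fn f).hom ((fn (kernel.ι f)).hom y) = 0 := by
  have h : fn (kernel.ι f) ≫ fn f = 0 := by
    rw [← Functor.map_comp, kernel.condition, Functor.map_zero]
  exact congrArg (fun t => t.hom y) h

lemma cokernel_π_apply (x : X.obj) : (fn (cokernel.π f)).hom ((fn f).hom x) = 0 := by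
  have h : fn f ≫ fn (cokernel.π f) = 0 := by
    rw [← Functor.map_comp, cokernel.condition, Functor.map_zero]
  exact congrArg (fun t => t.hom x) h

/-- The kernel computed in modules lies in `ᴷO`, which is closed under submodules, so it factors
through the categorical kernel. -/
lemma exists_kernel_ι_eq {x : X.obj} (hx : (fn f).hom x = 0) :
    ∃ y, (fn (kernel.ι f)).hom y = x := by
  let i : ModuleCat.of _ (LinearMap.ker (fn f).hom) ⟶ X.obj :=
    ModuleCat.ofHom (LinearMap.ker (fn f).hom).subtype
  let Z : TruncO j b K := ⟨ModuleCat.of _ (LinearMap.ker (fn f).hom),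
    truncO_of_injective j b K i Subtype.val_injective X.property⟩
  let i' : Z ⟶ X := (truncO j b K).fullyFaithfulι.preimage i
  have hi' : fn i' = i := (truncO j b K).fullyFaithfulι.map_preimage (X := Z) (Y := X) i
  have h0 : i' ≫ f = 0 := by
    apply (truncO j b K).ι.map_injective
    change fn (i' ≫ f) = fn 0
    rw [fn, Functor.map_comp]
    change fn i' ≫ fn f = _
    rw [hi', fn_zero]
    ext z
    exact z.2
  refine ⟨(fn (kernel.lift f i' h0)).hom ⟨x, hx⟩, ?_⟩
  have h1 : fn (kernel.lift f i' h0) ≫ fn (kernel.ι f) = i := by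
    rw [← Functor.map_comp, kernel.lift_ι]
    exact hi'
  exact congrArg (fun t => t.hom ⟨x, hx⟩) h1

/-- Dually, the module cokernel lies in `ᴷO` and receives a map from the categorical one. -/
lemma exists_apply_eq {y : Y.obj} (hy : (fn (cokernel.π f)).hom y = 0) :
    ∃ x, (fn f).hom x = y := by
  let q : Y.obj ⟶ ModuleCat.of _ (Y.obj ⧸ LinearMap.range (fn f).hom) :=
    ModuleCat.ofHom (LinearMap.range (fn f).hom).mkQ
  let Z : TruncO j b K := ⟨ModuleCat.of _ (Y.obj ⧸ LinearMap.range (fn f).hom),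
    truncO_of_surjective j b K q (Submodule.mkQ_surjective _) Y.property⟩
  let q' : Y ⟶ Z := (truncO j b K).fullyFaithfulι.preimage q
  have hq' : fn q' = q := (truncO j b K).fullyFaithfulι.map_preimage (X := Y) (Y := Z) q
  have h0 : f ≫ q' = 0 := by
    apply (truncO j b K).ι.map_injective
    change fn (f ≫ q') = fn 0
    rw [fn, Functor.map_comp]
    change fn f ≫ fn q' = _
    rw [hq', fn_zero]
    ext z
    exact (Submodule.Quotient.mk_eq_zero _).2 ⟨z, rfl⟩
  have h1 : fn (cokernel.π f) ≫ fn (cokernel.desc f q' h0) = q := by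
    rw [← Functor.map_comp, cokernel.π_desc]
    exact hq'
  have h2 : q.hom y = 0 := by
    rw [← h1]
    change (fn (cokernel.desc f q' h0)).hom ((fn (cokernel.π f)).hom y) = 0
    rw [hy, map_zero]
  exact (Submodule.Quotient.mk_eq_zero _).1 h2

lemma TruncO.weights_eq_top (X : TruncO j b K) : ⨆ μ ∈ K, weightSpace j X.obj μ = ⊤ :=
  (weight_support_iff _ _ _).1 ⟨X.property.1, X.property.2.2⟩

/-- Kernel and cokernel inherit their weights from `K`, and the two conditions exclude the weights
outside `N`. -/
lemma isoModSerre_of_weights {f : X ⟶ Y}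
    (h₁ : ∀ μ ∈ K \ N, ∀ x ∈ weightSpace j X.obj μ, (fn f).hom x = 0 → x = 0)
    (h₂ : ∀ μ ∈ K \ N, ∀ y ∈ weightSpace j Y.obj μ, ∃ x, (fn f).hom x = y) :
    (serreSub j b K N).isoModSerre f := by
  refine ⟨?_, ?_⟩
  · refine ⟨(kernel f).property.1, (kernel f).property.2.1, fun μ hμ => ?_⟩
    by_contra hN
    refine hμ (eq_bot_iff.2 fun x hx => ?_)
    have hK : μ ∈ K := (kernel f).property.2.2 hμ
    have := h₁ μ ⟨hK, hN⟩ _ (map_mem_weightSpace j (fn (kernel.ι f)) hx) (apply_kernel_ι f x)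
    exact kernel_ι_injective f (this.trans (map_zero _).symm)
  · have h := (weight_support_iff j (cokernel f).obj N).2 (by
      rw [eq_top_iff]
      intro z _
      obtain ⟨y, rfl⟩ := cokernel_π_surjective f z
      have hle : (⨆ μ ∈ K, weightSpace j Y.obj μ) ≤
          (⨆ μ ∈ N, weightSpace j (cokernel f).obj μ).comap
            ((fn (cokernel.π f)).hom.restrictScalars k) := by
        refine iSup₂_le fun μ hμ y hy => ?_
        change (fn (cokernel.π f)).hom y ∈ ⨆ μ ∈ N, weightSpace j (cokernel f).obj μ
        by_cases hN : μ ∈ N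
        · exact mem_weights hN (map_mem_weightSpace j _ hy)
        · obtain ⟨x, rfl⟩ := h₂ μ ⟨hμ, hN⟩ y hy
          rw [cokernel_π_apply]
          exact Submodule.zero_mem _
      exact hle (Y.weights_eq_top ▸ Submodule.mem_top))
    exact ⟨h.1, (cokernel f).property.2.1, h.2⟩

/-- A morphism whose kernel and cokernel have their weights in `N` is bijective on the sum of the
other weight spaces. -/
lemma weights_of_isoModSerre {f : X ⟶ Y} (hf : (serreSub j b K N).isoModSerre f)
    {S : Set (Module.Dual k H)} (hS : Disjoint S N) :
    (∀ x ∈ ⨆ μ ∈ S, weightSpace j X.obj μ, (fn f).hom x = 0 → x = 0) ∧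
      ∀ y ∈ ⨆ μ ∈ S, weightSpace j Y.obj μ,
        ∃ x ∈ ⨆ μ ∈ S, weightSpace j X.obj μ, (fn f).hom x = y := by
  refine ⟨fun x hx hx0 => ?_, fun y hy => ?_⟩
  · obtain ⟨z, rfl⟩ := exists_kernel_ι_eq f hx0
    have hker : truncO j b N (kernel f).obj := hf.1
    have htop := (weight_support_iff _ _ _).1 ⟨hker.1, hker.2.2⟩
    have hz := map_mem_iSup j N (fn (kernel.ι f)) (htop ▸ Submodule.mem_top (x := z))
    exact Submodule.disjoint_def.1 (disjoint_weights j _ hS) _ hx hz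
  · have hcok : truncO j b N (cokernel f).obj := hf.2
    have htop := (weight_support_iff _ _ _).1 ⟨hcok.1, hcok.2.2⟩
    have h0 := Submodule.disjoint_def.1 (disjoint_weights j (cokernel f).obj hS)
      ((fn (cokernel.π f)).hom y) (map_mem_iSup j S _ hy) (htop ▸ Submodule.mem_top)
    obtain ⟨x, rfl⟩ := exists_apply_eq f h0
    have hx : x ∈ (⨆ μ ∈ S, weightSpace j X.obj μ) ⊔ ⨆ μ ∈ K \ S, weightSpace j X.obj μ := by
      have hle : (⨆ μ ∈ K, weightSpace j X.obj μ) ≤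
          (⨆ μ ∈ S, weightSpace j X.obj μ) ⊔ ⨆ μ ∈ K \ S, weightSpace j X.obj μ := by
        refine iSup₂_le fun μ hμ x hx => ?_
        by_cases h : μ ∈ S
        · exact Submodule.mem_sup_left (mem_weights h hx)
        · exact Submodule.mem_sup_right (mem_weights (show μ ∈ K \ S from ⟨hμ, h⟩) hx)
      exact hle (X.weights_eq_top ▸ Submodule.mem_top)
    -- The component `x₂` may be dropped from the preimage: its image has weights outside `S`, but
    -- as a difference it also has weights in `S`, so it is zero.
    obtain ⟨x₁, h1, x₂, h2, rfl⟩ := Submodule.mem_sup.1 hx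
    refine ⟨x₁, h1, ?_⟩
    rw [map_add] at hy ⊢
    have h3 := Submodule.sub_mem _ hy (map_mem_iSup j S (fn f) h1)
    rw [add_sub_cancel_left] at h3
    rw [Submodule.disjoint_def.1 (disjoint_weights j Y.obj Set.disjoint_sdiff_right) _ h3
      (map_mem_iSup j _ (fn f) h2), add_zero]

/-- Bijective morphisms of `ᴷO` are isomorphisms. -/
lemma isIso_of_bijective {f : X ⟶ Y} (hf : Function.Bijective (fn f).hom) : IsIso f := by
  have : IsIso (fn f) := (ConcreteCategory.isIso_iff_bijective _).2 hf
  exact isIso_of_reflects_iso f (truncO j b K).ι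

end Serre

/-- An adjunction-like situation `I : C ⥤ A`, `R : A ⥤ C`, where the unit is invertible and the
counit is inverted by the localization, gives an equivalence of `C` with a localization of `A`. -/
def equivalenceOfUnitCounit {C A : Type*} [Category* C] [Category* A] (W : MorphismProperty A)
    (I : C ⥤ A) (R : A ⥤ C) (hR : W.IsInvertedBy R) (η : 𝟭 C ≅ I ⋙ R) (ε : R ⋙ I ⟶ 𝟭 A)
    (hε : ∀ X, W (ε.app X)) : C ≌ W.Localization :=
  -- The quotient functor inverts the counit, and the resulting isomorphism of functors on `A`
  -- descends to the localization.
  have : IsIso (Functor.whiskerRight ε W.Q) :=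
    have (X : A) : IsIso ((Functor.whiskerRight ε W.Q).app X) :=
      Localization.inverts W.Q W (ε.app X) (hε X)
    NatIso.isIso_of_isIso_app _
  let fac : W.Q ⋙ Localization.Construction.lift R hR ≅ R :=
    eqToIso (Localization.Construction.fac R hR)
  let e : (R ⋙ I) ⋙ W.Q ≅ W.Q := asIso (Functor.whiskerRight ε W.Q) ≪≫ W.Q.leftUnitor
  let _ : Localization.Lifting W.Q W ((R ⋙ I) ⋙ W.Q)
      (Localization.Construction.lift R hR ⋙ I ⋙ W.Q) :=
    ⟨Functor.isoWhiskerRight fac (I ⋙ W.Q)⟩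
  CategoryTheory.Equivalence.mk (I ⋙ W.Q) (Localization.Construction.lift R hR)
    (η ≪≫ Functor.isoWhiskerLeft I fac.symm)
    (Localization.liftNatIso W.Q W ((R ⋙ I) ⋙ W.Q) W.Q _ (𝟭 _) e)

/-! ### Unit and counit of induction and restriction -/

namespace RootReductive

namespace PositiveSystem

variable {k : Type u} [Field k] {g : Type u} [LieRing g] [LieAlgebra k g] {D : RootReductive k g}
  {B : D.PositiveSystem} [CharZero k] [IsAlgClosed k] {n : ℕ} {lam : D.Weight} {Kn K : Set D.Weight}

/-- `Ind`, as a functor between the truncated categories. -/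
abbrev indO (hInd : ∀ M : (B.On n Kn).FullSubcategory, B.O K (((B.On n Kn).ι ⋙ B.ind n).obj M)) :
    (B.On n Kn).FullSubcategory ⥤ (B.O K).FullSubcategory :=
  (B.O K).lift _ hInd

/-- `Res`, as a functor between the truncated categories. -/
abbrev resO (hRes : ∀ M : (B.O K).FullSubcategory, B.On n Kn (((B.O K).ι ⋙ D.res n lam).obj M)) :
    (B.O K).FullSubcategory ⥤ (B.On n Kn).FullSubcategory :=
  (B.On n Kn).lift _ hRes

/-- By `inter`, the coset is disjoint from `K \ Kn`. A morphism with kernel and cokernel supported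
in `K \ Kn` is thus bijective on the coset part, which is all that `Res` retains. -/
lemma resO_isInvertedBy (hK : B.IsTruncation n lam Kn K)
    (hRes : ∀ M : (B.O K).FullSubcategory, B.On n Kn (((B.O K).ι ⋙ D.res n lam).obj M)) :
    (serreSub D.toG B.borel K (K \ Kn)).isoModSerre.IsInvertedBy (resO hRes) := by
  intro X Y f hf
  have hS : Disjoint (D.coset n lam) (K \ Kn) :=
    Set.disjoint_left.2 fun μ h1 h2 => h2.2 (hK.inter μ h2.1 h1)
  obtain ⟨h1, h2⟩ := weights_of_isoModSerre hf hS
  refine isIso_of_bijective ⟨(injective_iff_map_eq_zero _).2 fun x hx => ?_, fun y => ?_⟩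
  · have h3 : (fn f).hom (D.resIncl n lam X.obj x) = 0 := by
      have := congrArg (D.resIncl n lam Y.obj) hx
      rw [map_zero] at this
      exact this
    have h4 := h1 _ (D.range_resIncl n lam X.obj ▸ ⟨x, rfl⟩) h3
    exact D.resIncl_injective n lam X.obj (h4.trans (map_zero _).symm)
  · obtain ⟨z, hz, h⟩ := h2 (D.resIncl n lam Y.obj y) (D.range_resIncl n lam Y.obj ▸ ⟨y, rfl⟩)
    rw [← D.range_resIncl] at hz
    obtain ⟨x, rfl⟩ := hz
    exact ⟨x, D.resIncl_injective n lam Y.obj h⟩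

/-- Inside `Ind M`, both `Res Ind M` and the image of `M` are the sum of the weight spaces for the
coset. The unit compares these two descriptions, and it is bijective because `M → Ind M` is
injective. -/
lemma IsDynkin.exists_unit (hB : B.IsDynkin) (hKn : Kn ⊆ D.coset n lam)
    (M : (B.On n Kn).FullSubcategory) :
    ∃ η : M.obj ⟶ (D.res n lam).obj ((B.ind n).obj M.obj),
      (∀ m, D.resIncl n lam _ (η.hom m) = unitMap B n M.obj m) ∧ Function.Bijective η.hom := by
  have hr := hB.range_unitMap hKn (TruncO.weights_eq_top M)
  have hex : ∀ m : M.obj, ∃ x, D.resIncl n lam _ x = unitMap B n M.obj m := fun m => by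
    change unitMap B n M.obj m ∈ LinearMap.range (D.resIncl n lam _)
    rw [D.range_resIncl, ← hr]
    exact ⟨m, rfl⟩
  choose φ hφ using hex
  have inj := D.resIncl_injective n lam ((B.ind n).obj M.obj)
  let f : M.obj →ₗ[k] (D.res n lam).obj ((B.ind n).obj M.obj) :=
    { toFun := φ
      map_add' := fun x y => inj (by rw [map_add, hφ, hφ, hφ, map_add])
      map_smul' := fun c x => inj (by rw [map_smul, hφ, hφ, map_smul]; rfl) }
  refine ⟨homOfLie f fun y m => inj ?_, hφ, fun x y h => ?_, fun y => ?_⟩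
  · change D.resIncl n lam _ (φ _) = D.resIncl n lam _ (_ • φ m)
    rw [D.resIncl_smul, hφ, hφ, gn_smul_unitMap]
  · have := congrArg (D.resIncl n lam _) h
    change D.resIncl n lam _ (φ x) = D.resIncl n lam _ (φ y) at this
    rw [hφ, hφ] at this
    exact hB.unitMap_injective _ this
  · have hy : D.resIncl n lam _ y ∈ LinearMap.range (unitMap B n M.obj) := by
      rw [hr, ← D.range_resIncl]
      exact ⟨y, rfl⟩
    obtain ⟨m, hm⟩ := hy
    exact ⟨m, inj ((hφ m).trans hm)⟩

lemma IsDynkin.exists_counit (hB : B.IsDynkin) (hK : B.IsTruncation n lam Kn K)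
    (N : (B.O K).FullSubcategory) :
    ∃ ε : (B.ind n).obj ((D.res n lam).obj N.obj) ⟶ N.obj,
      ∀ m, ε.hom (unitMap B n _ m) = D.resIncl n lam N.obj m :=
  exists_indHom (D.resIncl n lam N.obj) (fun y m => D.resIncl_smul n lam N.obj y m)
    fun _ hx m => hB.uPlus_smul_eq_zero hK N.property hx m

end PositiveSystem

end RootReductive

end CatO

/-! ### The equivalence with the Serre quotient -/

namespace CatO

namespace RootReductive

namespace PositiveSystem

variable {k : Type u} [Field k] {g : Type u} [LieRing g] [LieAlgebra k g] {D : RootReductive k g}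
  {B : D.PositiveSystem} [CharZero k] [IsAlgClosed k] {n : ℕ} {lam : D.Weight} {Kn K : Set D.Weight}

lemma IsDynkin.nonempty_unit (hB : B.IsDynkin) (hKn : Kn ⊆ D.coset n lam)
    (hInd : ∀ M : (B.On n Kn).FullSubcategory, B.O K (((B.On n Kn).ι ⋙ B.ind n).obj M))
    (hRes : ∀ M : (B.O K).FullSubcategory, B.On n Kn (((B.O K).ι ⋙ D.res n lam).obj M)) :
    Nonempty (𝟭 (B.On n Kn).FullSubcategory ≅ indO hInd ⋙ resO hRes) := by
  choose η h1 h2 using fun M => hB.exists_unit (lam := lam) hKn M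
  let η' (M : (B.On n Kn).FullSubcategory) :
      (𝟭 (B.On n Kn).FullSubcategory).obj M ⟶ (indO hInd ⋙ resO hRes).obj M :=
    (B.On n Kn).fullyFaithfulι.preimage (η M)
  have hη' (M : (B.On n Kn).FullSubcategory) : fn (η' M) = η M :=
    (B.On n Kn).fullyFaithfulι.map_preimage (X := M) (Y := (indO hInd ⋙ resO hRes).obj M) (η M)
  have hiso (M : (B.On n Kn).FullSubcategory) : IsIso (η' M) :=
    isIso_of_bijective ((hη' M).symm ▸ h2 M)
  refine ⟨NatIso.ofComponents (fun M => asIso (η' M)) fun {M N} f => ?_⟩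
  apply (B.On n Kn).ι.map_injective
  change fn (f ≫ η' N) = fn (η' M ≫ (indO hInd ⋙ resO hRes).map f)
  have e1 : fn (f ≫ η' N) = fn f ≫ η N := by
    rw [← hη' N]; exact Functor.map_comp _ _ _
  have e2 : fn (η' M ≫ (indO hInd ⋙ resO hRes).map f) =
      η M ≫ (D.res n lam).map ((B.ind n).map (fn f)) := by
    rw [← hη' M]; exact Functor.map_comp _ _ _
  rw [e1, e2]
  ext m
  apply D.resIncl_injective n lam
  change D.resIncl n lam _ ((η N).hom ((fn f).hom m)) =
    D.resIncl n lam _ (((D.res n lam).map ((B.ind n).map (fn f))).hom ((η M).hom m))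
  rw [h1, D.resIncl_map, h1]
  rfl

lemma IsDynkin.exists_natTrans_counit (hB : B.IsDynkin) (hK : B.IsTruncation n lam Kn K)
    (hInd : ∀ M : (B.On n Kn).FullSubcategory, B.O K (((B.On n Kn).ι ⋙ B.ind n).obj M))
    (hRes : ∀ M : (B.O K).FullSubcategory, B.On n Kn (((B.O K).ι ⋙ D.res n lam).obj M)) :
    ∃ ε : resO hRes ⋙ indO hInd ⟶ 𝟭 (B.O K).FullSubcategory,
      ∀ X, (serreSub D.toG B.borel K (K \ Kn)).isoModSerre (ε.app X) := by
  choose ε hε using fun N => hB.exists_counit hK N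
  let ε' (N : (B.O K).FullSubcategory) : (resO hRes ⋙ indO hInd).obj N ⟶ (𝟭 _).obj N :=
    (B.O K).fullyFaithfulι.preimage (ε N)
  have hε' (N : (B.O K).FullSubcategory) : fn (ε' N) = ε N :=
    (B.O K).fullyFaithfulι.map_preimage (X := (resO hRes ⋙ indO hInd).obj N) (Y := N) (ε N)
  refine ⟨{ app := ε', naturality := fun {M N} f => ?_ }, fun N => ?_⟩
  · apply (B.O K).ι.map_injective
    change fn ((resO hRes ⋙ indO hInd).map f ≫ ε' N) = fn (ε' M ≫ f)
    have e1 : fn ((resO hRes ⋙ indO hInd).map f ≫ ε' N) =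
        (B.ind n).map ((D.res n lam).map (fn f)) ≫ ε N := by
      rw [← hε' N]; exact Functor.map_comp _ _ _
    have e2 : fn (ε' M ≫ f) = ε M ≫ fn f := by
      rw [← hε' M]; exact Functor.map_comp _ _ _
    rw [e1, e2]
    refine (generates_indUnit (D.gn n) (B.uPlus n)).hom_ext ?_
    rintro _ ⟨m, rfl⟩
    change (ε N).hom (unitMap B n _ (((D.res n lam).map (fn f)).hom m)) =
      (fn f).hom ((ε M).hom (unitMap B n _ m))
    rw [hε, hε, D.resIncl_map]
  · have hr := hB.range_unitMap hK.subset (TruncO.weights_eq_top ((resO hRes).obj N))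
    refine isoModSerre_of_weights (fun μ hμ x hx hx0 => ?_) fun μ hμ y hy => ?_
    · have hμ' : μ ∈ Kn := by
        by_contra h
        exact hμ.2 ⟨hμ.1, h⟩
      have hx' : x ∈ LinearMap.range (unitMap B n ((resO hRes).obj N).obj) := by
        rw [hr]
        exact mem_weights (hK.subset hμ') hx
      obtain ⟨m, rfl⟩ := hx'
      change (fn (ε' N)).hom _ = 0 at hx0
      rw [hε'] at hx0
      have h3 : D.resIncl n lam N.obj m = 0 := (hε N m).symm.trans hx0
      have h4 : m = 0 := D.resIncl_injective n lam N.obj (h3.trans (map_zero _).symm)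
      rw [h4, map_zero]
    · have hμ' : μ ∈ Kn := by
        by_contra h
        exact hμ.2 ⟨hμ.1, h⟩
      have hy' : y ∈ LinearMap.range (D.resIncl n lam N.obj) := by
        rw [D.range_resIncl]
        exact mem_weights (hK.subset hμ') hy
      obtain ⟨m, rfl⟩ := hy'
      refine ⟨unitMap B n _ m, ?_⟩
      change (fn (ε' N)).hom _ = _
      rw [hε']
      exact hε N m

omit [CharZero k] [IsAlgClosed k] in
instance ind_additive (n : ℕ) : (B.ind n).Additive where
  map_add {M N f f'} := by
    refine (generates_indUnit (D.gn n) (B.uPlus n)).hom_ext ?_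
    rintro _ ⟨m, rfl⟩
    change unitMap B n N ((f + f').hom m) = unitMap B n N (f.hom m) + unitMap B n N (f'.hom m)
    rw [← map_add]
    rfl

omit [CharZero k] [IsAlgClosed k] in
lemma indO_additive
    (hInd : ∀ M : (B.On n Kn).FullSubcategory, B.O K (((B.On n Kn).ι ⋙ B.ind n).obj M)) :
    (indO hInd).Additive where
  map_add {M N f f'} := by
    apply (B.O K).ι.map_injective
    exact (B.ind n).map_add (f := fn f) (g := fn f')

/-- Truncated categories for `𝔤ₙ` are equivalent to Serre subquotients of category `O` for `g`. -/
theorem IsDynkin.exists_equivalence (hB : B.IsDynkin) (hK : B.IsTruncation n lam Kn K) :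
    ∃ (hInd : ∀ M : (B.On n Kn).FullSubcategory, B.O K (((B.On n Kn).ι ⋙ B.ind n).obj M))
      (hRes : ∀ M : (B.O K).FullSubcategory, B.On n Kn (((B.O K).ι ⋙ D.res n lam).obj M))
      (hΔn : ∀ μ ∈ Kn, B.On n Kn (B.Δn n μ)) (hΔ : ∀ μ ∈ Kn, B.O K (B.Δ μ))
      (e : (B.On n Kn).FullSubcategory ≌ SerreQuotient D.toG B.borel K (K \ Kn)),
      e.functor = (B.O K).lift _ hInd ⋙ B.π K (K \ Kn) ∧
      B.π K (K \ Kn) ⋙ e.inverse = (B.On n Kn).lift _ hRes ∧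
      e.functor.Additive ∧ e.inverse.Additive ∧
      ∀ (μ : D.Weight) (hμ : μ ∈ Kn), Nonempty (e.functor.obj ⟨B.Δn n μ, hΔn μ hμ⟩ ≅
        (B.π K (K \ Kn)).obj ⟨B.Δ μ, hΔ μ hμ⟩) := by
  have hInd : ∀ M : (B.On n Kn).FullSubcategory, B.O K (((B.On n Kn).ι ⋙ B.ind n).obj M) :=
    fun M => hB.ind_mem hK M.property
  have hRes : ∀ M : (B.O K).FullSubcategory, B.On n Kn (((B.O K).ι ⋙ D.res n lam).obj M) :=
    fun M => res_mem hK M.property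
  obtain ⟨η⟩ := hB.nonempty_unit hK.subset hInd hRes
  obtain ⟨ε, hε⟩ := hB.exists_natTrans_counit hK hInd hRes
  let e := equivalenceOfUnitCounit (serreSub D.toG B.borel K (K \ Kn)).isoModSerre
    (indO hInd) (resO hRes) (resO_isInvertedBy hK hRes) η ε hε
  have hadd : e.functor.Additive := by
    have := indO_additive (B := B) hInd
    exact inferInstanceAs (indO hInd ⋙ B.π K (K \ Kn)).Additive
  -- The formula for the inverse is an equality of functors, because `Res` factors strictly through
  -- the constructed localization.
  refine ⟨hInd, hRes, fun μ hμ => hK.vermaN_mem hμ, fun μ hμ => hB.verma_mem hK hμ, e, rfl,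
    Localization.Construction.fac _ _, hadd, e.inverse_additive, fun μ hμ => ?_⟩
  obtain ⟨i⟩ := hB.nonempty_ind_verma_iso n μ
  exact ⟨(B.π K (K \ Kn)).mapIso ((B.O K).fullyFaithfulι.preimageIso
    (X := (indO hInd).obj ⟨B.Δn n μ, hK.vermaN_mem hμ⟩) (Y := ⟨B.Δ μ, hB.verma_mem hK hμ⟩) i)⟩

end PositiveSystem

end RootReductive

end CatO

theorem mainTheorem3 {k : Type u} [Field k] [IsAlgClosed k] [CharZero k]
    {g : Type u} [LieRing g] [LieAlgebra k g] (D : CatO.RootReductive k g)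
    (B : D.PositiveSystem) (hB : B.IsDynkin) (n : ℕ) (lam : D.Weight) :
    -- the case of the coset `Λₙ = λ + ℤΦₙ`
    (∃ (hInd : ∀ M : (B.On n (D.coset n lam)).FullSubcategory,
          B.O (B.ideal (D.coset n lam)) (((B.On n (D.coset n lam)).ι ⋙ B.ind n).obj M))
       (hRes : ∀ M : (B.O (B.ideal (D.coset n lam))).FullSubcategory,
          B.On n (D.coset n lam) (((B.O (B.ideal (D.coset n lam))).ι ⋙ D.res n lam).obj M))
       (hΔn : ∀ μ ∈ D.coset n lam, B.On n (D.coset n lam) (B.Δn n μ))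
       (hΔ : ∀ μ ∈ D.coset n lam, B.O (B.ideal (D.coset n lam)) (B.Δ μ))
       (e : (B.On n (D.coset n lam)).FullSubcategory ≌
          CatO.SerreQuotient D.toG B.borel (B.ideal (D.coset n lam))
            (B.ideal (D.coset n lam) \ D.coset n lam)),
        e.functor = (B.O (B.ideal (D.coset n lam))).lift _ hInd ⋙
          B.π (B.ideal (D.coset n lam)) (B.ideal (D.coset n lam) \ D.coset n lam) ∧
        B.π (B.ideal (D.coset n lam)) (B.ideal (D.coset n lam) \ D.coset n lam) ⋙ e.inverse =
          (B.On n (D.coset n lam)).lift _ hRes ∧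
        e.functor.Additive ∧ e.inverse.Additive ∧
        ∀ (μ : D.Weight) (hμ : μ ∈ D.coset n lam),
          Nonempty (e.functor.obj ⟨B.Δn n μ, hΔn μ hμ⟩ ≅
            (B.π (B.ideal (D.coset n lam)) (B.ideal (D.coset n lam) \ D.coset n lam)).obj
              ⟨B.Δ μ, hΔ μ hμ⟩)) ∧
    -- the case of the ideals generated by finitely many weights in one coset of `ℤΦₙ`
    (∀ E : Finset D.Weight, (∀ ν ∈ E, ν ∈ D.coset n lam) →
      ∃ (hInd : ∀ M : (B.On n (B.idealN n E)).FullSubcategory,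
          B.O (B.ideal E) (((B.On n (B.idealN n E)).ι ⋙ B.ind n).obj M))
       (hRes : ∀ M : (B.O (B.ideal E)).FullSubcategory,
          B.On n (B.idealN n E) (((B.O (B.ideal E)).ι ⋙ D.res n lam).obj M))
       (hΔn : ∀ μ ∈ B.idealN n E, B.On n (B.idealN n E) (B.Δn n μ))
       (hΔ : ∀ μ ∈ B.idealN n E, B.O (B.ideal E) (B.Δ μ))
       (e : (B.On n (B.idealN n E)).FullSubcategory ≌
          CatO.SerreQuotient D.toG B.borel (B.ideal E) (B.ideal E \ B.idealN n E)),
        e.functor = (B.O (B.ideal E)).lift _ hInd ⋙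
          B.π (B.ideal E) (B.ideal E \ B.idealN n E) ∧
        B.π (B.ideal E) (B.ideal E \ B.idealN n E) ⋙ e.inverse =
          (B.On n (B.idealN n E)).lift _ hRes ∧
        e.functor.Additive ∧ e.inverse.Additive ∧
        ∀ (μ : D.Weight) (hμ : μ ∈ B.idealN n E),
          Nonempty (e.functor.obj ⟨B.Δn n μ, hΔn μ hμ⟩ ≅
            (B.π (B.ideal E) (B.ideal E \ B.idealN n E)).obj ⟨B.Δ μ, hΔ μ hμ⟩)) := by
  exact ⟨hB.exists_equivalence (CatO.RootReductive.PositiveSystem.isTruncation_coset n lam),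
    fun E hE => hB.exists_equivalence (hB.isTruncation_ideal n lam E fun ν hν => hE ν hν)⟩
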